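/- Let $\mathbb{V}=([0,1],\max,\cdot,0,1)$ be the Viterbi semiring. For a propositional formula $\varphi$ in negation normal form (a tree with internal nodes $\vee,\wedge$ and with leaves labeled by $0$, $1$, a variable $x$ or a negated variable $\neg x$) and an interpretation $\pi$ of its variables in $[0,1]$, define $\mathsf{Conf}(\varphi,\pi)\in[0,1]$ by $\mathsf{Conf}(0,\pi)=0$, $\mathsf{Conf}(1,\pi)=1$, $\mathsf{Conf}(x,\pi)=\pi(x)$, $\mathsf{Conf}(\neg x,\pi)=1-\pi(x)$, $\mathsf{Conf}(\alpha\vee\beta,\pi)=\max(\mathsf{Conf}(\alpha,\pi),\mathsf{Conf}(\beta,\pi))$ and $\mathsf{Conf}(\alpha\wedge\beta,\pi)=\mathsf{Conf}(\alpha,\pi)\cdot\mathsf{Conf}(\beta,\pi)$. The problem $\mathsf{optConf}$ is: given $\varphi$, output an optimal interpretation, i.e. an interpretation $\pi^*$ with $\mathsf{Conf}(\varphi,\pi^*)=\max_{\pi}\mathsf{Conf}(\varphi,\pi)$, where $\pi$ ranges over all interpretations of the variables by real numbers in $[0,1]$. Theorem. $\mathsf{optConf}$ for formulas in negation normal form can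 be computed in $\mathrm{FP}^{\mathrm{NP}}$. That is, there are a language $A\in\mathrm{NP}$ and a function $f:\{0,1\}^*\to\{0,1\}^*$, computed by a deterministic polynomial-time Turing machine with oracle $A$ (hence with polynomially many queries), such that for every formula $\varphi$ in negation normal form, $f$ maps the binary encoding of $\varphi$ to a binary encoding of an optimal interpretation $\pi^*$ of $\varphi$, in which each variable of $\varphi$ is assigned a rational number, written as a fraction with numerator and denominator in binary. -/

import Mathlib

/-! ### Formulas in negation normal form and their semantics over a semiring -/

/-- Propositional formulas in negation normal form over the variables `X`: the leaves are the
constants `0`, `1` and the literals `x`, `¬ x`; the internal nodes are `∨` and `∧`. -/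
inductive NNF (X : Type) : Type
  | bot : NNF X
  | top : NNF X
  | pos : X → NNF X
  | neg : X → NNF X
  | or : NNF X → NNF X → NNF X
  | and : NNF X → NNF X → NNF X

namespace NNF

/-- The value of a formula over the semiring `K` with negation function `ng`, under the
`K`-interpretation `π`. -/
def sem {X K : Type} [CommSemiring K] (ng : K → K) (π : X → K) : NNF X → K
  | bot => 0
  | top => 1
  | pos x => π x
  | neg x => ng (π x)
  | or α β => sem ng π α + sem ng π β
  | and α β => sem ng π α * sem ng π β

/-- The set of variables that occur in a formula. -/
def vars {X : Type} : NNF X → Set X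
  | bot => ∅
  | top => ∅
  | pos x => {x}
  | neg x => {x}
  | or α β => vars α ∪ vars β
  | and α β => vars α ∪ vars β

end NNF

/-! ### The Viterbi semiring -/

/-- The carrier `[0, 1]` of the Viterbi semiring `([0, 1], max, ·, 0, 1)`. -/
def Viterbi : Type := unitInterval

namespace Viterbi

/-- The underlying real number. -/
def toReal (x : Viterbi) : ℝ := Subtype.val x

theorem toReal_injective : Function.Injective toReal := Subtype.val_injective

/-- The usual order of `[0, 1]`. -/
noncomputable instance : LinearOrder Viterbi := inferInstanceAs (LinearOrder unitInterval)

/-- Semiring addition is the maximum. -/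
noncomputable instance : Add Viterbi := ⟨fun x y => max x y⟩

/-- Semiring multiplication is the product of real numbers. -/
noncomputable instance : Mul Viterbi := inferInstanceAs (Mul unitInterval)

noncomputable instance : Zero Viterbi := inferInstanceAs (Zero unitInterval)

noncomputable instance : One Viterbi := inferInstanceAs (One unitInterval)

noncomputable instance : CommSemiring Viterbi where
  add_assoc := max_assoc (α := Viterbi)
  add_comm := max_comm (α := Viterbi)
  zero_add x := max_eq_right (α := Viterbi) (unitInterval.nonneg' (t := x))
  add_zero x := max_eq_left (α := Viterbi) (unitInterval.nonneg' (t := x))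
  mul_assoc := mul_assoc (G := unitInterval)
  mul_comm := mul_comm (G := unitInterval)
  one_mul := one_mul (M := unitInterval)
  mul_one := mul_one (M := unitInterval)
  zero_mul := zero_mul (M₀ := unitInterval)
  mul_zero := mul_zero (M₀ := unitInterval)
  left_distrib x y z := mul_max (α := unitInterval) x y z
  right_distrib x y z := max_mul (α := unitInterval) x y z
  nsmul := nsmulRec

theorem toReal_zero : toReal 0 = 0 := rfl
theorem toReal_one : toReal 1 = 1 := rfl
theorem add_eq_max (x y : Viterbi) : x + y = max x y := rfl
theorem toReal_mul (x y : Viterbi) : toReal (x * y) = toReal x * toReal y := rfl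
theorem le_iff (x y : Viterbi) : x ≤ y ↔ toReal x ≤ toReal y := Iff.rfl

/-- The negation function `x ↦ 1 - x`. -/
noncomputable def compl (x : Viterbi) : Viterbi := unitInterval.symm x

theorem toReal_compl (x : Viterbi) : toReal (compl x) = 1 - toReal x := rfl

end Viterbi

/-- The confidence `Conf(φ, π)`: the value of `φ` over the Viterbi semiring under the
interpretation `π`, with negation `x ↦ 1 - x`. -/
noncomputable def conf {X : Type} (φ : NNF X) (π : X → Viterbi) : Viterbi :=
  φ.sem Viterbi.compl π

/-- `v` is the optimal confidence `optConfVal(φ)`: the maximum of `Conf(φ, π)` over all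
interpretations `π`. -/
def IsOptConfVal {X : Type} (φ : NNF X) (v : Viterbi) : Prop :=
  IsGreatest (Set.range (conf φ)) v

/-- `π` is an optimal interpretation for `φ`, i.e. `Conf(φ, π) = optConfVal(φ)`. -/
def IsOptConf {X : Type} (φ : NNF X) (π : X → Viterbi) : Prop :=
  IsOptConfVal φ (conf φ π)

/-! ### Encoding by bit strings -/

/-- A self-delimiting code for bit strings: each bit is preceded by `true`, and `false` marks the
end. -/
def encodeStr (w : List Bool) : List Bool :=
  w.flatMap (fun b => [true, b]) ++ [false]

/-- Numbers are written in binary. -/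
def encodeBin (n : ℕ) : List Bool :=
  encodeStr (Computability.encodeNat n)

/-- Formulas over the variables `x₀, x₁, x₂, …` are written in prefix notation, with the index of
each variable in binary. -/
def encodeNNF : NNF ℕ → List Bool
  | .bot => [false, false, false]
  | .top => [false, false, true]
  | .pos i => [false, true, true] ++ encodeBin i
  | .neg i => [false, true, false] ++ encodeBin i
  | .or α β => [true, false] ++ encodeNNF α ++ encodeNNF β
  | .and α β => [true, true] ++ encodeNNF α ++ encodeNNF β

/-- A finite rational assignment is a list of triples `(i, p, q)`, read as `xᵢ = p / q`;
all three numbers are written in binary. -/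
def encodeAssignment (a : List (ℕ × ℕ × ℕ)) : List Bool :=
  a.flatMap (fun t => encodeBin t.1 ++ encodeBin t.2.1 ++ encodeBin t.2.2)

/-- The list `a` assigns exactly one fraction to each variable of `φ` and to no other variable,
and these fractions are the values of the interpretation `π` there. -/
structure Describes (a : List (ℕ × ℕ × ℕ)) (φ : NNF ℕ) (π : ℕ → Viterbi) : Prop where
  nodup : (a.map Prod.fst).Nodup
  vars_eq : ∀ i, i ∈ a.map Prod.fst ↔ i ∈ φ.vars
  den_pos : ∀ t ∈ a, 0 < t.2.2
  value : ∀ t ∈ a, (π t.1).toReal = (t.2.1 : ℝ) / (t.2.2 : ℝ)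

/-- The bit string `w` is a correct answer to the problem optConf on the instance `φ`: it encodes
the values, on the variables of `φ`, of an optimal interpretation. (The value of `φ` does not
depend on the values of `π` elsewhere.) -/
def IsOptConfOutput (φ : NNF ℕ) (w : List Bool) : Prop :=
  ∃ (a : List (ℕ × ℕ × ℕ)) (π : ℕ → Viterbi),
    w = encodeAssignment a ∧ Describes a φ π ∧ IsOptConf φ π

/-! ### The class NP -/

/-- The pair `(x, y)` written as `x # y`, where the separator `#` is `none`. -/
def encodePair (p : List Bool × List Bool) : List (Option Bool) :=
  p.1.map some ++ none :: p.2.map some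

/-- `A` is in NP: membership has certificates of polynomial length that are verified by a
deterministic polynomial-time Turing machine. -/
def InNP (A : Language Bool) : Prop :=
  ∃ (V : List Bool × List Bool → Bool) (p : Polynomial ℕ),
    Nonempty (Turing.TM2ComputableInPolyTime encodePair Computability.encodeBool V) ∧
    ∀ x, x ∈ A ↔ ∃ y : List Bool, y.length ≤ p.eval x.length ∧ V (x, y) = true

/-! ### Oracle Turing machines and the class FP^NP -/

/-- A deterministic oracle Turing machine: a Turing machine with several work stacks whose input,
output and query stacks carry bits, and with three distinguished labels for asking the oracle. -/
structure OracleTM where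
  /-- the underlying machine -/
  tm : Turing.FinTM2
  /-- the query stack -/
  kq : tm.K
  inputAlphabet : tm.Γ tm.k₀ ≃ Bool
  outputAlphabet : tm.Γ tm.k₁ ≃ Bool
  queryAlphabet : tm.Γ kq ≃ Bool
  /-- at this label the oracle is asked about the content of the query stack -/
  ask : tm.Λ
  /-- the label where the computation continues after the answer yes -/
  yes : tm.Λ
  /-- the label where the computation continues after the answer no -/
  no : tm.Λ

namespace OracleTM

open Classical in
/-- One step with oracle `A`. At the label `ask` the machine goes to `yes` or `no`, according to
whether the string on the query stack belongs to `A`, and the query stack is erased. At every other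
label it makes a step of the underlying machine. -/
noncomputable def step (M : OracleTM) (A : Language Bool)
    (c : Turing.TM2.Cfg M.tm.Γ M.tm.Λ M.tm.σ) : Option (Turing.TM2.Cfg M.tm.Γ M.tm.Λ M.tm.σ) :=
  if c.l = some M.ask then
    some { l := some (if (c.stk M.kq).map M.queryAlphabet ∈ A then M.yes else M.no)
           var := c.var
           stk := Function.update c.stk M.kq [] }
  else Turing.TM2.step M.tm.m c

/-- Started on the input `x`, the machine with oracle `A` halts with output `y` after at most `t`
steps. Each query counts as one step, so that there are at most `t` queries. -/
def OutputsInTime (M : OracleTM) (A : Language Bool) (x y : List Bool) (t : ℕ) : Prop :=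
  Nonempty (StateTransition.EvalsToInTime (M.step A)
    (Turing.initList M.tm (x.map M.inputAlphabet.symm))
    (some (Turing.haltList M.tm (y.map M.outputAlphabet.symm))) t)

end OracleTM

/-- `f` is in `FP^NP`: it is computed by a deterministic polynomial-time oracle Turing machine
(which thus makes polynomially many queries) with an oracle in NP. -/
def InFPNP (f : List Bool → List Bool) : Prop :=
  ∃ A : Language Bool, InNP A ∧
    ∃ (M : OracleTM) (p : Polynomial ℕ), ∀ x, M.OutputsInTime A x (f x) (p.eval x.length)

/-! Choosing one argument of every disjunction that is reached turns a formula into a monomial, a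
product of literals. By distributivity the confidence under π is the maximum of the values of the
monomials under π: `value_walk_le` gives one inequality, and `exists_walk_eq` follows the larger
argument of each disjunction to attain equality. The maxima over monomials and over π commute. In a
fixed monomial the variables separate: a variable with a positive and b negative selected
occurrences contributes x^a (1-x)^b, which is largest at x = a/(a+b) (`pow_mul_pow_le`). Hence some
optimal interpretation has numerators and denominators bounded by numbers of occurrences, and its
encoding is no longer than `NNF.ruler` (`exists_optimum`).

The oracle decides `Attains φ B E`: some assignment whose encoding extends E and respects the length
bound has confidence at least the binary fraction 0.B. This is in NP, since a certificate can name a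
monomial and the missing part of the encoding, after which the value of the monomial is an explicit
fraction to be compared with 0.B (`mem_optConfOracle`, `inNP_optConfOracle`).

With n the length of the encoded formula, the search determines n² digits of the largest attained
fraction, most significant first, and then extends a prefix of an encoding bit by bit while keeping
that fraction attained. The exact optimum is never computed. Every admissible assignment has a
confidence whose denominator is at most 2^(n m) with 4 m ≤ n (`exists_conf_eq_div`), so distinct
values differ by more than 2^(-n²), and attaining the best fraction with n² digits already means
being optimal (`isOptConf_of_maximal`). The prefix ends as a complete encoding because all encodings
in question are shorter than n².

The machines come from a small structured language `Cmd`, compiled once and for all (`Exec.reach`)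
with a cost proportional to the number of loop iterations. The oracle machine runs without a clock,
and its iterations are counted. The verifier has to halt quickly on arbitrary input as well. It
therefore carries a clock, initially the length of the query plus that of the certificate; a run
that exhausts the clock rejects. Running time is then linear by construction, and honest
certificates are padded so that the clock lasts (`verifier_complete`). For soundness it is enough
that runs which keep the clock positive and report no error have read a legal certificate
(`Rejects`, `verifier_sound`). -/

open Function (update)

/-! ### A structured language for stack programs -/


/-- Structured programs over bit stacks indexed by `K`; oracle questions are available only when
`ora` holds. In `loop k brk f`, while stack `k` is nonempty, its top bit `b` is popped and `f b` is
executed; the loop is left after the first bit `b` with `brk b`. -/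
inductive Cmd (K : Type) (ora : Prop) : Type
  | skip : Cmd K ora
  | push (k : K) (b : Bool) : Cmd K ora
  | seq (c d : Cmd K ora) : Cmd K ora
  | pop (k : K) (f : Option Bool → Cmd K ora) : Cmd K ora
  | loop (k : K) (brk : Bool → Bool) (f : Bool → Cmd K ora) : Cmd K ora
  | ask (h : ora) (f : Bool → Cmd K ora) : Cmd K ora

namespace Cmd

variable {K : Type} {ora : Prop}

/-- A constant that bounds the number of machine steps per unit of the clock. -/
def weight : Cmd K ora → ℕ
  | skip => 1
  | push _ _ => 1
  | seq c d => c.weight + d.weight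
  | pop _ f => 1 + ((f none).weight + (f (some false)).weight + (f (some true)).weight)
  | loop _ _ f => 2 + ((f false).weight + (f true).weight)
  | ask _ f => 3 + ((f false).weight + (f true).weight)

theorem weight_pop_le (k : K) (f : Option Bool → Cmd K ora) (o : Option Bool) :
    1 + (f o).weight ≤ (pop k f).weight := by
  rcases o with _ | _ | _ <;> simp only [weight] <;> omega

theorem weight_loop_le (k : K) (brk) (f : Bool → Cmd K ora) (b : Bool) :
    2 + (f b).weight ≤ (loop k brk f).weight := by
  rcases b with _ | _ <;> simp only [weight] <;> omega

theorem weight_ask_le (h : ora) (f : Bool → Cmd K ora) (b : Bool) :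
    3 + (f b).weight ≤ (ask h f).weight := by
  rcases b with _ | _ <;> simp only [weight] <;> omega

variable [DecidableEq K]

/-- Big-step semantics with a clock: every iteration of a loop consumes one unit of the clock, and a
loop is left when the clock is used up. Questions are read from the stack `kq`. -/
inductive Exec (kq : K) (A : List Bool → Prop) :
    Cmd K ora → (K → List Bool) → ℕ → (K → List Bool) → ℕ → Prop
  | skip (s n) : Exec kq A skip s n s n
  | push (k b s n) : Exec kq A (push k b) s n (update s k (b :: s k)) n
  | seq {c d s n s₁ n₁ s₂ n₂} : Exec kq A c s n s₁ n₁ → Exec kq A d s₁ n₁ s₂ n₂ →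
      Exec kq A (seq c d) s n s₂ n₂
  | pop {k f s n s' n'} : Exec kq A (f (s k).head?) (update s k (s k).tail) n s' n' →
      Exec kq A (pop k f) s n s' n'
  | loop_nil {k} (brk f) {s} (n) : s k = [] → Exec kq A (loop k brk f) s n s n
  | loop_dead {k} (brk f) {s b l} : s k = b :: l →
      Exec kq A (loop k brk f) s 0 (update s k l) 0
  | loop_brk {k brk f s b l n s' n'} : s k = b :: l → brk b = true →
      Exec kq A (f b) (update s k l) n s' n' → Exec kq A (loop k brk f) s (n + 1) s' n'
  | loop_step {k brk f s b l n s₁ n₁ s₂ n₂} : s k = b :: l → brk b = false →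
      Exec kq A (f b) (update s k l) n s₁ n₁ → Exec kq A (loop k brk f) s₁ n₁ s₂ n₂ →
      Exec kq A (loop k brk f) s (n + 1) s₂ n₂
  | ask_yes {h f s n s' n'} : A (s kq) → Exec kq A (f true) (update s kq []) n s' n' →
      Exec kq A (ask h f) s n s' n'
  | ask_no {h f s n s' n'} : ¬ A (s kq) → Exec kq A (f false) (update s kq []) n s' n' →
      Exec kq A (ask h f) s n s' n'

variable {kq : K} {A : List Bool → Prop}

theorem Exec.clock_le {c : Cmd K ora} {s n s' n'} (h : Exec kq A c s n s' n') : n' ≤ n := by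
  induction h <;> omega

theorem Exec.det {c : Cmd K ora} {s n s' n'} (h : Exec kq A c s n s' n') :
    ∀ {s'' n''}, Exec kq A c s n s'' n'' → s'' = s' ∧ n'' = n' := by
  induction h with
  | skip => intro _ _ h; cases h; exact ⟨rfl, rfl⟩
  | push => intro _ _ h; cases h; exact ⟨rfl, rfl⟩
  | seq _ _ ih₁ ih₂ =>
    intro _ _ h
    cases h with
    | seq h₁ h₂ => obtain ⟨rfl, rfl⟩ := ih₁ h₁; exact ih₂ h₂
  | pop _ ih => intro _ _ h; cases h with | pop h => exact ih h
  | loop_nil brk f n hk =>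
    intro _ _ h
    cases h <;> simp_all
  | loop_dead brk f hk =>
    intro _ _ h
    cases h <;> simp_all
  | loop_brk hk hb _ ih =>
    intro _ _ h
    cases h with
    | loop_nil _ _ _ hk' => simp_all
    | loop_brk hk' hb' h =>
      obtain ⟨rfl, rfl⟩ : _ = _ ∧ _ = _ := by simpa using hk.symm.trans hk'
      exact ih h
    | loop_step hk' hb' h =>
      obtain ⟨rfl, rfl⟩ : _ = _ ∧ _ = _ := by simpa using hk.symm.trans hk'
      simp_all
  | loop_step hk hb _ _ ih₁ ih₂ =>
    intro _ _ h
    cases h with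
    | loop_nil _ _ _ hk' => simp_all
    | loop_brk hk' hb' h =>
      obtain ⟨rfl, rfl⟩ : _ = _ ∧ _ = _ := by simpa using hk.symm.trans hk'
      simp_all
    | loop_step hk' hb' h₁ h₂ =>
      obtain ⟨rfl, rfl⟩ : _ = _ ∧ _ = _ := by simpa using hk.symm.trans hk'
      obtain ⟨rfl, rfl⟩ := ih₁ h₁
      exact ih₂ h₂
  | ask_yes ha _ ih =>
    intro _ _ h
    cases h with
    | ask_yes _ h => exact ih h
    | ask_no ha' _ => exact absurd ha ha'
  | ask_no ha _ ih =>
    intro _ _ h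
    cases h with
    | ask_yes ha' _ => exact absurd ha' ha
    | ask_no _ h => exact ih h

/-- The clock never rises and `loop_dead` leaves it at 0, so a run that ends with a positive clock
has used `loop_dead` nowhere, and additional units are merely carried along. -/
theorem Exec.mono {c : Cmd K ora} {s n s' n'} (h : Exec kq A c s n s' n') (hn : 0 < n') (m : ℕ) :
    Exec kq A c s (n + m) s' (n' + m) := by
  induction h with
  | skip => exact .skip _ _
  | push => exact .push _ _ _ _
  | seq h₁ h₂ ih₁ ih₂ => exact .seq (ih₁ (hn.trans_le h₂.clock_le)) (ih₂ hn)
  | pop _ ih => exact .pop (ih hn)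
  | loop_nil brk f n hk => exact .loop_nil _ _ _ hk
  | loop_dead brk f hk => omega
  | loop_brk hk hb _ ih => rw [Nat.add_right_comm]; exact .loop_brk hk hb (ih hn)
  | loop_step hk hb _ h₂ ih₁ ih₂ =>
    rw [Nat.add_right_comm]
    exact .loop_step hk hb (ih₁ (hn.trans_le h₂.clock_le)) (ih₂ hn)
  | ask_yes ha _ ih => exact .ask_yes ha (ih hn)
  | ask_no ha _ ih => exact .ask_no ha (ih hn)

/-- The clock forces termination: for `loop` the inner induction is on the clock, which every
iteration strictly decreases. -/
theorem Exec.total (kq : K) (A : List Bool → Prop) (c : Cmd K ora) (s : K → List Bool) (n : ℕ) :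
    ∃ s' n', Exec kq A c s n s' n' := by
  induction c generalizing s n with
  | skip => exact ⟨_, _, .skip _ _⟩
  | push k b => exact ⟨_, _, .push _ _ _ _⟩
  | seq c d ih₁ ih₂ =>
    obtain ⟨s₁, n₁, h₁⟩ := ih₁ s n
    obtain ⟨s₂, n₂, h₂⟩ := ih₂ s₁ n₁
    exact ⟨_, _, .seq h₁ h₂⟩
  | pop k f ih =>
    obtain ⟨s₁, n₁, h₁⟩ := ih (s k).head? (update s k (s k).tail) n
    exact ⟨_, _, .pop h₁⟩
  | loop k brk f ih =>
    induction n using Nat.strong_induction_on generalizing s with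
    | _ n ihn =>
      rcases hk : s k with _ | ⟨b, l⟩
      · exact ⟨_, _, .loop_nil _ _ _ hk⟩
      · rcases n with _ | n
        · exact ⟨_, _, .loop_dead _ _ hk⟩
        · obtain ⟨s₁, n₁, h₁⟩ := ih b (update s k l) n
          rcases hb : brk b with _ | _
          · obtain ⟨s₂, n₂, h₂⟩ := ihn n₁ (Nat.lt_succ_of_le h₁.clock_le) s₁
            exact ⟨_, _, .loop_step hk hb h₁ h₂⟩
          · exact ⟨_, _, .loop_brk hk hb h₁⟩
  | ask h f ih =>
    by_cases ha : A (s kq)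
    · obtain ⟨s₁, n₁, h₁⟩ := ih true (update s kq []) n
      exact ⟨_, _, .ask_yes ha h₁⟩
    · obtain ⟨s₁, n₁, h₁⟩ := ih false (update s kq []) n
      exact ⟨_, _, .ask_no ha h₁⟩

/-- Between two ticks of the clock only boundedly many pushes occur, and `weight` bounds them. This
later limits the time needed to empty the stacks when the machine stops. -/
theorem Exec.length_le {c : Cmd K ora} {s n s' n'} (h : Exec kq A c s n s' n') (k : K) :
    (s' k).length ≤ (s k).length + c.weight * (1 + (n - n')) := by
  induction h with
  | skip => omega
  | push k' b s n =>
    by_cases hk : k = k'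
    · subst hk; simp [weight]
    · simp [hk]
  | @seq c d s n s₁ n₁ s₂ n₂ h₁ h₂ ih₁ ih₂ =>
    have := h₁.clock_le
    have := h₂.clock_le
    have e₁ : c.weight * (1 + (n - n₁)) ≤ c.weight * (1 + (n - n₂)) :=
      Nat.mul_le_mul_left _ (by omega)
    have e₂ : d.weight * (1 + (n₁ - n₂)) ≤ d.weight * (1 + (n - n₂)) :=
      Nat.mul_le_mul_left _ (by omega)
    simp only [weight, add_mul]
    omega
  | @pop k' f s n s' n' h ih =>
    have e : (f (s k').head?).weight * (1 + (n - n')) ≤ (Cmd.pop k' f).weight * (1 + (n - n')) :=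
      Nat.mul_le_mul_right _ (by have := weight_pop_le k' f (s k').head?; omega)
    have : (update s k' (s k').tail k).length ≤ (s k).length := by
      by_cases hk : k = k'
      · subst hk; simp
      · simp [hk]
    omega
  | loop_nil => omega
  | @loop_dead k' brk f s b l hk' =>
    have : (update s k' l k).length ≤ (s k).length := by
      by_cases hk : k = k'
      · subst hk; simp [hk']
      · simp [hk]
    omega
  | @loop_brk k' brk f s b l n s' n' hk' hb h ih =>
    have := h.clock_le
    have e : (f b).weight * (1 + (n - n')) ≤ (Cmd.loop k' brk f).weight * (1 + (n + 1 - n')) :=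
      Nat.mul_le_mul (by have := weight_loop_le k' brk f b; omega) (by omega)
    have : (update s k' l k).length ≤ (s k).length := by
      by_cases hk : k = k'
      · subst hk; simp [hk']
      · simp [hk]
    omega
  | @loop_step k' brk f s b l n s₁ n₁ s₂ n₂ hk' hb h₁ h₂ ih₁ ih₂ =>
    have := h₁.clock_le
    have := h₂.clock_le
    have e : (f b).weight * (1 + (n - n₁)) ≤ (Cmd.loop k' brk f).weight * (1 + (n - n₁)) :=
      Nat.mul_le_mul_right _ (by have := weight_loop_le k' brk f b; omega)
    have e' : (Cmd.loop k' brk f).weight * (1 + (n + 1 - n₂)) =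
        (Cmd.loop k' brk f).weight * (1 + (n - n₁)) +
        (Cmd.loop k' brk f).weight * (1 + (n₁ - n₂)) := by
      rw [← mul_add]; congr 1; omega
    have : (update s k' l k).length ≤ (s k).length := by
      by_cases hk : k = k'
      · subst hk; simp [hk']
      · simp [hk]
    omega
  | @ask_yes h' f s n s' n' ha h ih =>
    have e : (f true).weight * (1 + (n - n')) ≤ (Cmd.ask h' f).weight * (1 + (n - n')) :=
      Nat.mul_le_mul_right _ (by have := weight_ask_le h' f true; omega)
    have : (update s kq [] k).length ≤ (s k).length := by
      by_cases hk : k = kq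
      · subst hk; simp
      · simp [hk]
    omega
  | @ask_no h' f s n s' n' ha h ih =>
    have e : (f false).weight * (1 + (n - n')) ≤ (Cmd.ask h' f).weight * (1 + (n - n')) :=
      Nat.mul_le_mul_right _ (by have := weight_ask_le h' f false; omega)
    have : (update s kq [] k).length ≤ (s k).length := by
      by_cases hk : k = kq
      · subst hk; simp
      · simp [hk]
    omega

/-- The program never removes anything from stack `k`. -/
def Keeps (k : K) : Cmd K ora → Prop
  | skip => True
  | push _ _ => True
  | seq c d => c.Keeps k ∧ d.Keeps k
  | pop k' f => k' ≠ k ∧ ∀ o, (f o).Keeps k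
  | loop k' _ f => k' ≠ k ∧ ∀ b, (f b).Keeps k
  | ask _ f => ∀ b, (f b).Keeps k

/-- Errors are recorded by pushing onto a stack that is never popped, so an error once reported
survives the rest of the run. The query stack must be excluded because asking empties it. -/
theorem Exec.keeps {c : Cmd K ora} {s n s' n'} (h : Exec kq A c s n s' n') {k : K} (hkq : k ≠ kq)
    (hc : c.Keeps k) (hs : s k ≠ []) : s' k ≠ [] := by
  induction h with
  | skip => exact hs
  | push k' b s n => by_cases h : k = k' <;> simp [h, hs]
  | seq _ _ ih₁ ih₂ => exact ih₂ hc.2 (ih₁ hc.1 hs)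
  | pop _ ih => exact ih (hc.2 _) (by rwa [Function.update_of_ne hc.1.symm])
  | loop_nil => exact hs
  | loop_dead => rwa [Function.update_of_ne hc.1.symm]
  | loop_brk _ _ _ ih => exact ih (hc.2 _) (by rwa [Function.update_of_ne hc.1.symm])
  | loop_step _ _ _ _ ih₁ ih₂ =>
    exact ih₂ hc (ih₁ (hc.2 _) (by rwa [Function.update_of_ne hc.1.symm]))
  | ask_yes _ _ ih => exact ih (hc _) (by rwa [Function.update_of_ne hkq])
  | ask_no _ _ ih => exact ih (hc _) (by rwa [Function.update_of_ne hkq])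

/-! ### Running without exhausting the clock -/

/-- `c` leads from `s` to `s'` with at most `t` iterations of loops. -/
def Runs (kq : K) (A : List Bool → Prop) (c : Cmd K ora) (s s' : K → List Bool) (t : ℕ) : Prop :=
  ∃ t' ≤ t, ∀ n, Exec kq A c s (n + t') s' n

theorem Runs.mono {c : Cmd K ora} {s s' t t'} (h : Runs kq A c s s' t) (ht : t ≤ t') :
    Runs kq A c s s' t' := by
  obtain ⟨u, hu, h⟩ := h
  exact ⟨u, hu.trans ht, h⟩

/-- A run that did not exhaust the clock computes what `Runs` says. -/
theorem Runs.eq_of_exec {c : Cmd K ora} {s s' t s'' n n''} (h : Runs kq A c s s' t)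
    (he : Exec kq A c s n s'' n'') (hn : 0 < n'') : s'' = s' := by
  obtain ⟨u, -, h⟩ := h
  -- Both runs now start with the clock `n + u`, so determinism applies.
  exact ((h n).det (he.mono hn u)).1

theorem Runs.skip (s : K → List Bool) : Runs kq A (skip : Cmd K ora) s s 0 :=
  ⟨0, le_rfl, fun _ => .skip _ _⟩

theorem Runs.push (k : K) (b : Bool) (s : K → List Bool) :
    Runs kq A (push k b : Cmd K ora) s (update s k (b :: s k)) 0 :=
  ⟨0, le_rfl, fun _ => .push _ _ _ _⟩

theorem Runs.seq {c d : Cmd K ora} {s s₁ s₂ t₁ t₂} (h₁ : Runs kq A c s s₁ t₁)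
    (h₂ : Runs kq A d s₁ s₂ t₂) : Runs kq A (c.seq d) s s₂ (t₁ + t₂) := by
  obtain ⟨u₁, hu₁, h₁⟩ := h₁
  obtain ⟨u₂, hu₂, h₂⟩ := h₂
  refine ⟨u₂ + u₁, by omega, fun n => .seq ?_ (h₂ n)⟩
  rw [← add_assoc]
  exact h₁ _

theorem Runs.pop {k : K} {f : Option Bool → Cmd K ora} {s s' t}
    (h : Runs kq A (f (s k).head?) (update s k (s k).tail) s' t) : Runs kq A (pop k f) s s' t := by
  obtain ⟨u, hu, h⟩ := h
  exact ⟨u, hu, fun n => .pop (h n)⟩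

theorem Runs.loop_nil {k : K} (brk) (f : Bool → Cmd K ora) {s} (hk : s k = []) :
    Runs kq A (loop k brk f) s s 0 :=
  ⟨0, le_rfl, fun _ => .loop_nil _ _ _ hk⟩

theorem Runs.loop_brk {k : K} {brk} {f : Bool → Cmd K ora} {s b l s' t} (hk : s k = b :: l)
    (hb : brk b = true) (h : Runs kq A (f b) (update s k l) s' t) :
    Runs kq A (loop k brk f) s s' (t + 1) := by
  obtain ⟨u, hu, h⟩ := h
  exact ⟨u + 1, by omega, fun n => .loop_brk hk hb (h n)⟩

theorem Runs.loop_step {k : K} {brk} {f : Bool → Cmd K ora} {s b l s₁ s₂ t₁ t₂} (hk : s k = b :: l)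
    (hb : brk b = false) (h₁ : Runs kq A (f b) (update s k l) s₁ t₁)
    (h₂ : Runs kq A (loop k brk f) s₁ s₂ t₂) :
    Runs kq A (loop k brk f) s s₂ (t₁ + t₂ + 1) := by
  obtain ⟨u₁, hu₁, h₁⟩ := h₁
  obtain ⟨u₂, hu₂, h₂⟩ := h₂
  refine ⟨u₂ + u₁ + 1, by omega, fun n => .loop_step hk hb ?_ (h₂ n)⟩
  simpa only [Nat.add_eq, ← add_assoc] using h₁ (n + u₂)

open Classical in
theorem Runs.ask {h : ora} {f : Bool → Cmd K ora} {s s' t}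
    (h' : Runs kq A (f (decide (A (s kq)))) (update s kq []) s' t) :
    Runs kq A (ask h f) s s' t := by
  obtain ⟨u, hu, h'⟩ := h'
  refine ⟨u, hu, fun n => ?_⟩
  by_cases ha : A (s kq)
  · exact .ask_yes ha (by simpa [ha] using h' n)
  · exact .ask_no ha (by simpa [ha] using h' n)

end Cmd

/-! ### Compilation to stack machines -/

/-- The stacks of the compiled machine: an input stack over `Option Bool`, the clock, and the stacks
of the program. -/
inductive Stk (K : Type) : Type
  | inp : Stk K
  | clk : Stk K
  | reg (k : K) : Stk K
  deriving DecidableEq, Fintype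

namespace Stk

variable {K : Type}

/-- The alphabets of the compiled machine. -/
abbrev Γ : Stk K → Type
  | inp => Option Bool
  | clk => Bool
  | reg _ => Bool

/-- The stacks with contents `i` (input), `c` (clock) and `s` (program). -/
def mk (i : List (Option Bool)) (c : List Bool) (s : K → List Bool) : ∀ k : Stk K, List (Γ k)
  | inp => i
  | clk => c
  | reg k => s k

variable (i : List (Option Bool)) (c : List Bool) (s : K → List Bool)

@[simp] theorem mk_inp : mk i c s inp = i := rfl
@[simp] theorem mk_clk : mk i c s clk = c := rfl
@[simp] theorem mk_reg (k : K) : mk i c s (reg k) = s k := rfl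

variable [DecidableEq K]

@[simp] theorem update_mk_inp (l : List (Option Bool)) : update (mk i c s) inp l = mk l c s := by
  funext k; cases k <;> simp [mk, update]

@[simp] theorem update_mk_clk (l : List Bool) : update (mk i c s) clk l = mk i l s := by
  funext k; cases k <;> simp [mk, update]

@[simp] theorem update_mk_reg (k : K) (l : List Bool) :
    update (mk i c s) (reg k) l = mk i c (update s k l) := by
  funext k'
  cases k' with
  | inp => simp [mk]
  | clk => simp [mk]
  | reg k' =>
    by_cases h : k' = k
    · subst h; simp [mk]
    · rw [Function.update_of_ne (by simpa using h)]; simp [mk, h]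

end Stk

namespace Cmd

/-- `b` is reached from `a` in exactly `t` steps. -/
def Reach {C : Type} (step : C → Option C) (a b : C) (t : ℕ) : Prop :=
  (flip bind step)^[t] (some a) = some b

theorem Reach.single {C : Type} {step : C → Option C} {a b : C} (h : step a = some b) :
    Reach step a b 1 := h

theorem Reach.trans {C : Type} {step : C → Option C} {a b c : C} {t u : ℕ} (h : Reach step a b t)
    (h' : Reach step b c u) : Reach step a c (t + u) := by
  unfold Reach at *
  rw [Nat.add_comm, Function.iterate_add_apply, h, h']

theorem Reach.head {C : Type} {step : C → Option C} {a b c : C} {t : ℕ} (h : step a = some b)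
    (h' : Reach step b c t) : Reach step a c (1 + t) :=
  (Reach.single h).trans h'

theorem Reach.congr {C : Type} {step : C → Option C} {a a' b b' : C} {t : ℕ} (h : Reach step a b t)
    (ha : a' = a) (hb : b' = b) : Reach step a' b' t := by
  subst ha hb
  exact h

theorem Reach.nonempty_evalsToInTime {C : Type} {step : C → Option C} {a b : C} {t u : ℕ}
    (h : Reach step a b t) (htu : t ≤ u) :
    Nonempty (StateTransition.EvalsToInTime step a (some b) u) :=
  ⟨⟨⟨t, h⟩, htu⟩⟩

variable {K : Type} {ora : Prop}

/-- Positions in a program. -/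
def Lbl : Cmd K ora → Type
  | skip => Unit
  | push _ _ => Unit
  | seq c d => c.Lbl ⊕ d.Lbl
  | pop _ f => Option (Σ o, (f o).Lbl)
  | loop _ _ f => Option (Σ b, (f b).Lbl)
  | ask _ f => Option (Σ b, (f b).Lbl)

/-- The position at which the execution starts. -/
def entry : (c : Cmd K ora) → c.Lbl
  | skip => ()
  | push _ _ => ()
  | seq c _ => .inl c.entry
  | pop _ _ => none
  | loop _ _ _ => none
  | ask _ _ => none

theorem finite_lbl (c : Cmd K ora) : Finite c.Lbl := by
  induction c with
  | skip => exact inferInstanceAs (Finite Unit)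
  | push => exact inferInstanceAs (Finite Unit)
  | seq c d ih₁ ih₂ => exact inferInstanceAs (Finite (c.Lbl ⊕ d.Lbl))
  | pop k f ih => exact inferInstanceAs (Finite (Option (Σ o, (f o).Lbl)))
  | loop k brk f ih => exact inferInstanceAs (Finite (Option (Σ o, (f o).Lbl)))
  | ask h f ih => exact inferInstanceAs (Finite (Option (Σ o, (f o).Lbl)))

/-- The control variables: the bit read last, a flag, and the labels for the answers yes and no. -/
abbrev Var (Λ : Type) : Type := Option Bool × Bool × Λ × Λ

/-- Machine statements over the labels `Λ`. -/
abbrev MStmt (K Λ : Type) : Type := Turing.TM2.Stmt (Stk.Γ (K := K)) Λ (Var Λ)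

/-- The code of a program; `emb` places its positions among the labels of the machine, `exit` is
the label where the execution continues, and `ask` is the label for questions. -/
def code {Λ : Type} (clocked : Bool) (ask : Λ) :
    (c : Cmd K ora) → (c.Lbl → Λ) → Λ → c.Lbl → MStmt K Λ
  | .skip, _, exit, _ => .goto fun _ => exit
  | .push k b, _, exit, _ => .push (.reg k) (fun _ => b) <| .goto fun _ => exit
  | .seq c d, emb, _, .inl l => c.code clocked ask (emb ∘ .inl) (emb (.inr d.entry)) l
  | .seq _ d, emb, exit, .inr l => d.code clocked ask (emb ∘ .inr) exit l
  | .pop k f, emb, _, none => .pop (.reg k) (fun v o => (o, v.2)) <|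
      .goto fun v => emb (some ⟨v.1, (f v.1).entry⟩)
  | .pop _ f, emb, exit, some ⟨o, l⟩ =>
      (f o).code clocked ask (fun l => emb (some ⟨o, l⟩)) exit l
  | .loop k _ f, emb, exit, none => .pop (.reg k) (fun v o => (o, v.2)) <|
      .branch (fun v => v.1.isNone) (.goto fun _ => exit) <|
      bif clocked then
        .pop .clk (fun v o => (v.1, o.isSome, v.2.2)) <|
        .branch (fun v => v.2.1)
          (.goto fun v => emb (some ⟨v.1.getD false, (f (v.1.getD false)).entry⟩))
          (.goto fun _ => exit)
      else .goto fun v => emb (some ⟨v.1.getD false, (f (v.1.getD false)).entry⟩)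
  | .loop _ brk f, emb, exit, some ⟨b, l⟩ =>
      (f b).code clocked ask (fun l => emb (some ⟨b, l⟩)) (bif brk b then exit else emb none) l
  | .ask _ f, emb, _, none =>
      .load (fun v => (none, v.2.1, emb (some ⟨true, (f true).entry⟩),
        emb (some ⟨false, (f false).entry⟩))) <|
      .goto fun _ => ask
  | .ask _ f, emb, exit, some ⟨b, l⟩ =>
      (f b).code clocked ask (fun l => emb (some ⟨b, l⟩)) exit l

variable [DecidableEq K]

open Turing.TM2 in
open Classical in
/-- The compiled code simulates the big-step semantics. -/
theorem Exec.reach {Λ : Type} {kq : K} {A : List Bool → Prop} (clocked : Bool) {ask yes no : Λ}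
    {m : Λ → MStmt K Λ}
    {step : Cfg (Stk.Γ (K := K)) Λ (Var Λ) → Option (Cfg (Stk.Γ (K := K)) Λ (Var Λ))}
    (hstep : ∀ l v S, l ≠ ask → step ⟨some l, v, S⟩ = some (stepAux (m l) v S))
    (hask : ora → ∀ v i c s, step ⟨some ask, v, Stk.mk i c s⟩ =
      some ⟨some (if A (s kq) then yes else no), v, Stk.mk i c (update s kq [])⟩)
    (hyes : yes ≠ ask) (hno : no ≠ ask)
    (hmyes : m yes = .goto fun v => v.2.2.1) (hmno : m no = .goto fun v => v.2.2.2)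
    (i : List (Option Bool))
    {c : Cmd K ora} {s n s' n'} (h : Exec kq A c s n s' n')
    (hclk : clocked = true ∨ 0 < n') (emb : c.Lbl → Λ) (exit : Λ) (hemb : ∀ l, emb l ≠ ask)
    (hm : ∀ l, m (emb l) = c.code clocked ask emb exit l) (v : Var Λ) :
    ∃ v' t, t ≤ c.weight * (1 + (n - n')) ∧
      Reach step ⟨some (emb c.entry), v, Stk.mk i (bif clocked then List.replicate n true else []) s⟩
        ⟨some exit, v', Stk.mk i (bif clocked then List.replicate n' true else []) s'⟩ t := by
  induction h generalizing exit v with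
  | skip s n =>
    refine ⟨v, 1, by simp [weight], Reach.single ?_⟩
    rw [hstep _ _ _ (hemb _), hm]
    simp [code]
  | push k b s n =>
    refine ⟨v, 1, by simp [weight], Reach.single ?_⟩
    rw [hstep _ _ _ (hemb _), hm]
    simp [code]
  | @seq c d s n s₁ n₁ s₂ n₂ h₁ h₂ ih₁ ih₂ =>
    have l₁ := h₁.clock_le
    have l₂ := h₂.clock_le
    obtain ⟨v₁, t₁, ht₁, r₁⟩ := ih₁ (hclk.imp id fun h => h.trans_le l₂) (emb ∘ .inl)
      (emb (.inr d.entry)) (fun _ => hemb _) (fun l => hm _) v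
    obtain ⟨v₂, t₂, ht₂, r₂⟩ := ih₂ hclk (emb ∘ .inr)
      exit (fun _ => hemb _) (fun l => hm _) v₁
    refine ⟨v₂, t₁ + t₂, ?_, r₁.trans r₂⟩
    have e₁ : c.weight * (1 + (n - n₁)) ≤ c.weight * (1 + (n - n₂)) :=
      Nat.mul_le_mul_left _ (by omega)
    have e₂ : d.weight * (1 + (n₁ - n₂)) ≤ d.weight * (1 + (n - n₂)) :=
      Nat.mul_le_mul_left _ (by omega)
    simp only [weight, add_mul]
    omega
  | @pop k f s n s' n' h ih =>
    obtain ⟨v₁, t₁, ht₁, r₁⟩ := ih hclk (fun l => emb (some ⟨_, l⟩)) exit (fun _ => hemb _)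
      (fun l => hm (some ⟨_, l⟩)) ((s k).head?, v.2)
    refine ⟨v₁, 1 + t₁, ?_, r₁.head ?_⟩
    · have e : (1 + (f (s k).head?).weight) * (1 + (n - n')) ≤
          (Cmd.pop k f).weight * (1 + (n - n')) :=
        Nat.mul_le_mul_right _ (weight_pop_le k f (s k).head?)
      rw [add_mul] at e
      omega
    · rw [hstep _ _ _ (hemb _), hm]
      simp [code, entry]
  | @loop_nil k brk f s n hk =>
    have hs : update s k [] = s := by rw [← hk, Function.update_eq_self]
    refine ⟨(none, v.2), 1, ?_, Reach.single ?_⟩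
    · simp [weight]; omega
    · rw [hstep _ _ _ (hemb _), hm]
      simp [code, entry, hk, hs]
  | @loop_dead k brk f s b l hk =>
    -- The final clock is 0 here, which rules out `0 < n'`. Unclocked machines are simulated only
    -- along runs that never exhaust the clock.
    have hc : clocked = true := by simpa using hclk
    refine ⟨(some b, false, v.2.2), 1, ?_, Reach.single ?_⟩
    · simp [weight]; omega
    · rw [hstep _ _ _ (hemb _), hm]
      simp [code, entry, hk, hc]
  | @loop_brk k brk f s b l n s' n' hk hb h ih =>
    obtain ⟨v₁, t₁, ht₁, r₁⟩ := ih hclk (fun l => emb (some ⟨_, l⟩)) exit (fun _ => hemb _)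
      (fun l => (hm (some ⟨b, l⟩)).trans (by rw [code, hb]; rfl)) (some b, bif clocked then true else v.2.1, v.2.2)
    refine ⟨v₁, 1 + t₁, ?_, r₁.head ?_⟩
    · have l₁ := h.clock_le
      have e : (2 + (f b).weight) * (1 + (n - n')) ≤
          (Cmd.loop k brk f).weight * (1 + (n + 1 - n')) :=
        Nat.mul_le_mul (weight_loop_le k brk f b) (by omega)
      rw [add_mul] at e
      omega
    · rw [hstep _ _ _ (hemb _), hm]
      cases clocked <;> simp [code, entry, hk, List.replicate_succ]
  | @loop_step k brk f s b l n s₁ n₁ s₂ n₂ hk hb h₁ h₂ ih₁ ih₂ =>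
    have l₁ := h₁.clock_le
    have l₂ := h₂.clock_le
    obtain ⟨v₁, t₁, ht₁, r₁⟩ := ih₁ (hclk.imp id fun h => h.trans_le l₂)
      (fun l => emb (some ⟨_, l⟩)) (emb none) (fun _ => hemb _)
      (fun l => (hm (some ⟨b, l⟩)).trans (by rw [code, hb]; rfl)) (some b, bif clocked then true else v.2.1, v.2.2)
    obtain ⟨v₂, t₂, ht₂, r₂⟩ := ih₂ hclk emb exit hemb hm v₁
    refine ⟨v₂, 1 + (t₁ + t₂), ?_, (r₁.trans r₂).head ?_⟩
    · have e : (2 + (f b).weight) * (1 + (n - n₁)) ≤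
          (Cmd.loop k brk f).weight * (1 + (n - n₁)) :=
        Nat.mul_le_mul (weight_loop_le k brk f b) (by omega)
      have e' : (Cmd.loop k brk f).weight * (1 + (n + 1 - n₂)) =
          (Cmd.loop k brk f).weight * (1 + (n - n₁)) +
          (Cmd.loop k brk f).weight * (1 + (n₁ - n₂)) := by
        rw [← mul_add]; congr 1; omega
      rw [add_mul] at e
      omega
    · rw [hstep _ _ _ (hemb _), hm]
      cases clocked <;> simp [code, entry, hk, List.replicate_succ]
  | @ask_yes h' f s n s' n' ha h ih =>
    obtain ⟨v₁, t₁, ht₁, r₁⟩ := ih hclk (fun l => emb (some ⟨true, l⟩)) exit (fun _ => hemb _)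
      (fun l => hm (some ⟨_, l⟩)) (none, v.2.1, emb (some ⟨true, (f true).entry⟩),
        emb (some ⟨false, (f false).entry⟩))
    have q := hask h' (none, v.2.1, emb (some ⟨true, (f true).entry⟩),
      emb (some ⟨false, (f false).entry⟩)) i (bif clocked then List.replicate n true else []) s
    refine ⟨v₁, 1 + (1 + (1 + t₁)), ?_, (Reach.head q (r₁.head ?_)).head ?_⟩
    · have e : (3 + (f true).weight) * (1 + (n - n')) ≤
          (Cmd.ask h' f).weight * (1 + (n - n')) :=
        Nat.mul_le_mul_right _ (weight_ask_le h' f true)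
      rw [add_mul] at e
      omega
    · rw [if_pos ha, hstep _ _ _ hyes, hmyes]
      simp
    · rw [hstep _ _ _ (hemb _), hm]
      simp [code, entry]
  | @ask_no h' f s n s' n' ha h ih =>
    obtain ⟨v₁, t₁, ht₁, r₁⟩ := ih hclk (fun l => emb (some ⟨false, l⟩)) exit (fun _ => hemb _)
      (fun l => hm (some ⟨_, l⟩)) (none, v.2.1, emb (some ⟨true, (f true).entry⟩),
        emb (some ⟨false, (f false).entry⟩))
    have q := hask h' (none, v.2.1, emb (some ⟨true, (f true).entry⟩),
      emb (some ⟨false, (f false).entry⟩)) i (bif clocked then List.replicate n true else []) s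
    refine ⟨v₁, 1 + (1 + (1 + t₁)), ?_, (Reach.head q (r₁.head ?_)).head ?_⟩
    · have e : (3 + (f false).weight) * (1 + (n - n')) ≤
          (Cmd.ask h' f).weight * (1 + (n - n')) :=
        Nat.mul_le_mul_right _ (weight_ask_le h' f false)
      rw [add_mul] at e
      omega
    · rw [if_neg ha, hstep _ _ _ hno, hmno]
      simp
    · rw [hstep _ _ _ (hemb _), hm]
      simp [code, entry]

end Cmd

open Function



/-- Auxiliary labels of the compiled machines. -/
inductive Aux : Type
  | load | load' | fin | clean | ask | yes | no
  deriving DecidableEq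

instance : Fintype Aux :=
  ⟨{.load, .load', .fin, .clean, .ask, .yes, .no}, fun x => by cases x <;> decide⟩

namespace Cmd

variable {K : Type} {ora : Prop} [DecidableEq K]

open Turing.TM2

/-! ### Emptying stacks -/

/-- Pop every stack in the list `ks` once; the flag records whether one of them was nonempty. -/
def popAll {Λ : Type} (ks : List (Stk K)) (q : MStmt K Λ) : MStmt K Λ :=
  ks.foldr (fun k q => .pop k (fun v o => (v.1, v.2.1 || o.isSome, v.2.2)) q) q

theorem stepAux_popAll {Λ : Type} {ks : List (Stk K)} (hks : ks.Nodup) (q : MStmt K Λ) (v : Var Λ)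
    (S : ∀ k : Stk K, List k.Γ) :
    stepAux (popAll ks q) v S =
      stepAux q (v.1, v.2.1 || ks.any (fun k => (S k).head?.isSome), v.2.2)
        (fun k => if k ∈ ks then (S k).tail else S k) := by
  induction ks generalizing v S with
  | nil => simp [popAll]
  | cons k ks ih =>
    rw [List.nodup_cons] at hks
    have h := ih hks.2 (v.1, v.2.1 || (S k).head?.isSome, v.2.2) (update S k (S k).tail)
    simp only [popAll, List.foldr_cons, stepAux] at h ⊢
    rw [h]
    have e : (ks.any fun k' => (update S k (S k).tail k').head?.isSome) =
        ks.any fun k' => (S k').head?.isSome := by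
      rw [Bool.eq_iff_iff, List.any_eq_true, List.any_eq_true]
      refine exists_congr fun k' => and_congr_right fun hk' => ?_
      rw [Function.update_of_ne (by rintro rfl; exact hks.1 hk')]
    rw [e]
    simp only [List.any_cons, Bool.or_assoc]
    congr 1
    funext k'
    by_cases hk : k' = k
    · subst hk; simp [hks.1]
    · simp [hk]

/-- A label at which the stacks in `ks` are emptied before `q` is executed. -/
def cleanStmt {Λ : Type} (l : Λ) (ks : List (Stk K)) (q : MStmt K Λ) : MStmt K Λ :=
  .load (fun v => (v.1, false, v.2.2)) <| popAll ks <| .branch (fun v => v.2.1) (.goto fun _ => l) q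

/-- One visit to the label pops all stacks of `ks` simultaneously, so the number of rounds is
governed by the longest stack; one last round finds everything empty and leaves. -/
theorem clean_reach {Λ : Type} {l : Λ} {ks : List (Stk K)} (hks : ks.Nodup) {q : MStmt K Λ}
    {step : Cfg (Stk.Γ (K := K)) Λ (Var Λ) → Option (Cfg (Stk.Γ (K := K)) Λ (Var Λ))}
    (hstep : ∀ v S, step ⟨some l, v, S⟩ = some (stepAux (cleanStmt l ks q) v S)) (N : ℕ)
    (v : Var Λ) (S : ∀ k : Stk K, List k.Γ) (hS : ∀ k ∈ ks, (S k).length ≤ N) :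
    ∃ t ≤ N + 1, Reach step ⟨some l, v, S⟩
      (stepAux q (v.1, false, v.2.2) (fun k => if k ∈ ks then [] else S k)) t := by
  have key : ∀ (N : ℕ) (v : Var Λ) (S : ∀ k : Stk K, List k.Γ),
      ks.any (fun k => (S k).head?.isSome) = false →
      ∃ t ≤ N + 1, Reach step ⟨some l, v, S⟩
        (stepAux q (v.1, false, v.2.2) (fun k => if k ∈ ks then [] else S k)) t := by
    intro N v S h0
    refine ⟨1, by omega, Reach.single ?_⟩
    rw [hstep, cleanStmt, stepAux, stepAux_popAll hks, h0]
    have h1 : (fun k => if k ∈ ks then (S k).tail else S k) =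
        fun k => if k ∈ ks then [] else S k := by
      funext k
      by_cases hk : k ∈ ks
      · have := (List.any_eq_false.mp h0) k hk
        have h2 : S k = [] := by simpa using this
        simp [hk, h2]
      · simp [hk]
    rw [h1]
    simp
  induction N generalizing v S with
  | zero =>
    refine key _ _ _ ?_
    rw [List.any_eq_false]
    intro k hk
    simp [List.length_eq_zero_iff.mp (Nat.le_zero.mp (hS k hk))]
  | succ N ih =>
    rcases h0 : ks.any (fun k => (S k).head?.isSome) with _ | _
    · exact key _ _ _ h0
    · have h1 : (fun k => if k ∈ ks then [] else if k ∈ ks then (S k).tail else S k) =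
          fun k => if k ∈ ks then [] else S k := by
        funext k
        by_cases hk : k ∈ ks <;> simp [hk]
      obtain ⟨t, ht, r⟩ := ih (v.1, true, v.2.2)
        (fun k => if k ∈ ks then (S k).tail else S k) (by
          intro k hk
          have := hS k hk
          simp only [hk, if_true, List.length_tail]
          omega)
      rw [h1] at r
      refine ⟨1 + t, by omega, r.head ?_⟩
      rw [hstep, cleanStmt, stepAux, stepAux_popAll hks, h0]
      simp

/-! ### The machine of a verifier -/

/-- The labels of the compiled machines. -/
abbrev MLbl (c : Cmd K ora) : Type := Aux ⊕ c.Lbl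

/-- The initial values of the control variables. -/
def initVar (c : Cmd K ora) : Var (MLbl c) := (none, false, .inl .ask, .inl .ask)

theorem stepAux_label {Λ : Type} {m : Λ → MStmt K Λ} (l : Λ) (v : Var Λ) (S) :
    Turing.TM2.step m ⟨some l, v, S⟩ = some (stepAux (m l) v S) := rfl

/-- The program of a verifier: the two parts of the input are moved to the stacks `zk` and `yk`
while the clock is set to their total length; after the execution of `c`, the machine accepts if
the clock has not run out and the stack `err` is empty. -/
noncomputable def verifierCode [Fintype K] (c : Cmd K False) (zk yk err : K) :
    MLbl c → MStmt K (MLbl c)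
  | .inl .load => .pop .inp (fun v o => (o.getD none, v.2)) <|
      .branch (fun v => v.1.isSome)
        (.push (.reg zk) (fun v => v.1.getD false) <| .push .clk (fun _ => true) <|
          .goto fun _ => .inl .load)
        (.goto fun _ => .inl .load')
  | .inl .load' => .pop .inp (fun v o => (o.getD none, v.2)) <|
      .branch (fun v => v.1.isSome)
        (.push (.reg yk) (fun v => v.1.getD false) <| .push .clk (fun _ => true) <|
          .goto fun _ => .inl .load')
        (.goto fun _ => .inr c.entry)
  | .inl .fin => .pop .clk (fun v o => (o, v.2)) <|
      .pop (.reg err) (fun v o => (bif o.isSome then none else v.1, v.2)) <|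
      .goto fun _ => .inl .clean
  | .inl .clean => cleanStmt (.inl .clean) (Finset.univ.toList) <|
      .push .clk (fun v => v.1.isSome) <| .load (fun _ => c.initVar) .halt
  | .inl .yes => .goto fun v => v.2.2.1
  | .inl .no => .goto fun v => v.2.2.2
  | .inl .ask => .halt
  | .inr l => c.code true (.inl .ask) .inr (.inl .fin) l

/-- The machine of a verifier. -/
noncomputable def verifierTM [Fintype K] (c : Cmd K False) (zk yk err : K) : Turing.FinTM2 where
  K := Stk K
  k₀ := .inp
  k₁ := .clk
  Γ := Stk.Γ
  Λ := MLbl c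
  main := .inl .load
  ΛFin := haveI := c.finite_lbl; Fintype.ofFinite _
  σ := Var (MLbl c)
  initialState := c.initVar
  σFin := haveI := c.finite_lbl; Fintype.ofFinite _
  Γk₀Fin := inferInstanceAs (Fintype (Option Bool))
  m := verifierCode c zk yk err

/-- The store at the beginning of a verification. -/
def verifierInit (zk yk : K) (z y : List Bool) : K → List Bool :=
  update (update (fun _ => []) zk z.reverse) yk y.reverse

/-- The verifier given by `c` accepts the certificate `y` for `z`. -/
def Accepts (c : Cmd K False) (zk yk err : K) (z y : List Bool) : Prop :=
  ∃ s' n', Exec zk (fun _ => False) c (verifierInit zk yk z y) (z.length + y.length) s' n' ∧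
    0 < n' ∧ s' err = []

theorem load_reach [Fintype K] (c : Cmd K False) (zk yk err : K) (z : List Bool) (v) (i n s) :
    ∃ v', Reach (Turing.TM2.step (verifierCode c zk yk err))
      ⟨some (.inl .load), v, Stk.mk (z.map some ++ none :: i) (List.replicate n true) s⟩
      ⟨some (.inl .load'), v', Stk.mk i (List.replicate (z.length + n) true)
        (update s zk (z.reverse ++ s zk))⟩ (z.length + 1) := by
  induction z generalizing v n s with
  | nil =>
    refine ⟨(none, v.2), Reach.single ?_⟩
    rw [stepAux_label]
    simp [verifierCode]
  | cons b z ih =>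
    obtain ⟨v', h⟩ := ih (some b, v.2) (n + 1) (update s zk (b :: s zk))
    refine ⟨v', ?_⟩
    have e : update (update s zk (b :: s zk)) zk (z.reverse ++ update s zk (b :: s zk) zk) =
        update s zk ((b :: z).reverse ++ s zk) := by simp
    rw [e, show z.length + (n + 1) = (b :: z).length + n by simp; omega] at h
    rw [show (b :: z).length + 1 = 1 + (z.length + 1) by simp; omega]
    refine Reach.head ?_ h
    rw [stepAux_label]
    simp [verifierCode, List.replicate_succ]

/-- The second component has no end marker: `o.getD none` turns the missing symbol of an empty input
stack into the `none` that also serves as separator. Loading reverses both components. -/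
theorem load_reach' [Fintype K] (c : Cmd K False) (zk yk err : K) (y : List Bool) (v) (n s) :
    ∃ v', Reach (Turing.TM2.step (verifierCode c zk yk err))
      ⟨some (.inl .load'), v, Stk.mk (y.map some) (List.replicate n true) s⟩
      ⟨some (.inr c.entry), v', Stk.mk [] (List.replicate (y.length + n) true)
        (update s yk (y.reverse ++ s yk))⟩ (y.length + 1) := by
  induction y generalizing v n s with
  | nil =>
    refine ⟨(none, v.2), Reach.single ?_⟩
    rw [stepAux_label]
    simp [verifierCode]
  | cons b z ih =>
    obtain ⟨v', h⟩ := ih (some b, v.2) (n + 1) (update s yk (b :: s yk))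
    refine ⟨v', ?_⟩
    have e : update (update s yk (b :: s yk)) yk (z.reverse ++ update s yk (b :: s yk) yk) =
        update s yk ((b :: z).reverse ++ s yk) := by simp
    rw [e, show z.length + (n + 1) = (b :: z).length + n by simp; omega] at h
    rw [show (b :: z).length + 1 = 1 + (z.length + 1) by simp; omega]
    refine Reach.head ?_ h
    rw [stepAux_label]
    simp [verifierCode, List.replicate_succ]

theorem initList_verifierTM [Fintype K] (c : Cmd K False) (zk yk err : K)
    (l : List (Option Bool)) :
    Turing.initList (verifierTM c zk yk err) l =
      ⟨some (.inl .load), c.initVar, Stk.mk l [] fun _ => []⟩ := by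
  unfold Turing.initList
  congr 1
  funext k
  cases k <;> rfl

theorem haltList_verifierTM [Fintype K] (c : Cmd K False) (zk yk err : K)
    (l : List Bool) :
    Turing.haltList (verifierTM c zk yk err) l =
      ⟨none, c.initVar, Stk.mk [] l fun _ => []⟩ := by
  unfold Turing.haltList
  congr 1
  funext k
  cases k <;> rfl

open Classical in
/-- A verifier runs in linear time. -/
theorem verifier_polyTime [Fintype K] (c : Cmd K False) {zk yk : K} (err : K) (hk : zk ≠ yk) :
    Nonempty (Turing.TM2ComputableInPolyTime encodePair Computability.encodeBool
      fun p : List Bool × List Bool => decide (Accepts c zk yk err p.1 p.2)) := by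
  refine ⟨{ tm := verifierTM c zk yk err
            inputAlphabet := Equiv.refl _
            outputAlphabet := Equiv.refl _
            -- Loading is linear in the input, the simulation takes at most `weight * (1 + n)`
            -- steps, and the stacks to be emptied afterwards obey a bound of the same kind.
            time := (2 + 2 * (.C c.weight + 1)) * (1 + .X) + 4
            outputsFun := fun p => Classical.choice ?_ }⟩
  obtain ⟨z, y⟩ := p
  obtain ⟨s', n', h⟩ := Exec.total zk (fun _ => False) c (verifierInit zk yk z y)
    (z.length + y.length)
  obtain ⟨v₁, r₁⟩ := load_reach c zk yk err z c.initVar (y.map some) 0 fun _ => []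
  obtain ⟨v₂, r₂⟩ := load_reach' c zk yk err y v₁ (z.length + 0)
    (update (fun _ => []) zk (z.reverse ++ []))
  obtain ⟨v₃, t₃, ht₃, r₃⟩ := h.reach true (ask := .inl .ask) (yes := .inl .yes) (no := .inl .no)
    (m := verifierCode c zk yk err) (step := Turing.TM2.step (verifierCode c zk yk err))
    (fun _ _ _ _ => rfl) (fun h => h.elim) (by simp) (by simp) rfl rfl [] (.inl rfl)
    .inr (.inl .fin) (by simp) (fun _ => rfl) v₂
  have hl := h.length_le
  have hc := h.clock_le
  set n := z.length + y.length with hn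
  have hfin : Turing.TM2.step (verifierCode c zk yk err)
      ⟨some (.inl .fin), v₃, Stk.mk [] (List.replicate n' true) s'⟩ = some
      ⟨some (.inl .clean), (bif (s' err).head?.isSome then none else
        (List.replicate n' true).head?, v₃.2),
        Stk.mk [] (List.replicate n' true).tail (update s' err (s' err).tail)⟩ := by
    rw [stepAux_label]
    simp [verifierCode]
  obtain ⟨t₄, ht₄, r₄⟩ := clean_reach (l := .inl .clean) (Finset.nodup_toList Finset.univ)
    (q := .push .clk (fun v => v.1.isSome) <| .load (fun _ => c.initVar) .halt)
    (step := Turing.TM2.step (verifierCode c zk yk err)) (fun _ _ => rfl)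
    (n + c.weight * (1 + n)) (bif (s' err).head?.isSome then none else
        (List.replicate n' true).head?, v₃.2)
    (Stk.mk [] (List.replicate n' true).tail (update s' err (s' err).tail)) (by
      intro k _
      cases k with
      | inp => simp
      | clk => simp; omega
      | reg k =>
        have h1 : (update s' err (s' err).tail k).length ≤ (s' k).length := by
          by_cases hk : k = err
          · subst hk; simp
          · simp [hk]
        have h2 : (verifierInit zk yk z y k).length ≤ n := by
          unfold verifierInit
          by_cases h : k = yk
          · subst h; simp [hn]
          · by_cases h' : k = zk
            · subst h'; simp [hk]; omega
            · simp [h, h']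
        have h3 := hl k
        have h4 : c.weight * (1 + (n - n')) ≤ c.weight * (1 + n) :=
          Nat.mul_le_mul_left _ (by omega)
        simp only [Stk.mk_reg]
        omega)
  have r := r₁.trans (r₂.trans (Reach.trans (b := ⟨some (.inl .fin), v₃,
    Stk.mk [] (List.replicate n' true) s'⟩) (t := t₃) ?_ (Reach.head hfin r₄)))
  · have hacc : Accepts c zk yk err z y ↔ 0 < n' ∧ s' err = [] := by
      constructor
      · rintro ⟨s'', n'', h', h''⟩
        obtain ⟨rfl, rfl⟩ := h.det h'
        exact h''
      · exact fun h' => ⟨s', n', h, h'⟩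
    -- The bit that survives in the control variable is the top of the clock unless an error is
    -- present, so it exists exactly when the clock is positive and `err` is empty.
    have hout : ((bif (s' err).head?.isSome then none else
        (List.replicate n' true).head?).isSome) = decide (Accepts c zk yk err z y) := by
      rw [Bool.eq_iff_iff, decide_eq_true_iff, hacc]
      rcases h1 : s' err with _ | ⟨b, l⟩ <;> rcases n' with _ | n' <;>
        simp [List.replicate_succ]
    have hend : stepAux (.push .clk (fun v => v.1.isSome) <| .load (fun _ => c.initVar) .halt)
        ((bif (s' err).head?.isSome then none else (List.replicate n' true).head?), false, v₃.2.2)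
        (fun k => if k ∈ (Finset.univ : Finset (Stk K)).toList then [] else
          (Stk.mk [] (List.replicate n' true).tail (update s' err (s' err).tail)) k) =
        (⟨none, c.initVar, Stk.mk [] [decide (Accepts c zk yk err z y)] fun _ => []⟩ :
          Cfg (Stk.Γ (K := K)) (MLbl c) (Var (MLbl c))) := by
      simp only [stepAux, hout]
      congr 1
      funext k
      cases k <;> simp [Stk.mk]
    rw [hend] at r
    have e : (encodePair (z, y)).map (Equiv.refl (Option Bool)).invFun =
        z.map some ++ none :: y.map some := by simp [encodePair]
    refine Reach.nonempty_evalsToInTime (Reach.congr r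
      ((congrArg (Turing.initList (verifierTM c zk yk err)) e).trans
        (initList_verifierTM c zk yk err _))
      (haltList_verifierTM c zk yk err [decide (Accepts c zk yk err z y)])) ?_
    have e' : (encodePair (z, y)).length = n + 1 := by simp [encodePair, hn]; omega
    rw [e']
    simp
    have h4 : c.weight * (1 + (n - n')) ≤ c.weight * (1 + n) :=
      Nat.mul_le_mul_left _ (by omega)
    nlinarith
  · have e : update (update (fun _ => []) zk (z.reverse ++ [])) yk
        (y.reverse ++ update (fun _ => []) zk (z.reverse ++ []) yk) = verifierInit zk yk z y := by
      simp [verifierInit, hk.symm]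
    rw [e, show y.length + (z.length + 0) = n by omega]
    exact r₃

/-! ### Oracle machines -/

/-- The program of an oracle machine: after the execution of `c` all stacks but the output stack are
emptied. -/
noncomputable def oracleCode [Fintype K] (c : Cmd K True) (kout : K) :
    MLbl c → MStmt K (MLbl c)
  | .inl .load => .goto fun _ => .inr c.entry
  | .inl .load' => .halt
  | .inl .fin => .goto fun _ => .inl .clean
  | .inl .clean => cleanStmt (.inl .clean) ((Finset.univ.erase (.reg kout)).toList) <|
      .load (fun _ => c.initVar) .halt
  | .inl .yes => .goto fun v => v.2.2.1
  | .inl .no => .goto fun v => v.2.2.2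
  | .inl .ask => .halt
  | .inr l => c.code false (.inl .ask) .inr (.inl .fin) l

/-- The oracle machine of a program. -/
noncomputable def oracleTM [Fintype K] (c : Cmd K True) (kin kout kq : K) : OracleTM where
  tm :=
  { K := Stk K
    k₀ := .reg kin
    k₁ := .reg kout
    Γ := Stk.Γ
    Λ := MLbl c
    main := .inr c.entry
    ΛFin := haveI := c.finite_lbl; Fintype.ofFinite _
    σ := Var (MLbl c)
    initialState := c.initVar
    σFin := haveI := c.finite_lbl; Fintype.ofFinite _
    Γk₀Fin := inferInstanceAs (Fintype Bool)
    m := oracleCode c kout }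
  kq := .reg kq
  inputAlphabet := Equiv.refl _
  outputAlphabet := Equiv.refl _
  queryAlphabet := Equiv.refl _
  ask := .inl .ask
  yes := .inl .yes
  no := .inl .no

theorem initList_oracleTM [Fintype K] (c : Cmd K True) (kin kout kq : K) (l : List Bool) :
    Turing.initList (oracleTM c kin kout kq).tm l =
      ⟨some (.inr c.entry), c.initVar, Stk.mk [] [] (update (fun _ => []) kin l)⟩ := by
  unfold Turing.initList
  congr 1
  funext k
  cases k with
  | inp => rfl
  | clk => rfl
  | reg k =>
    by_cases h : k = kin
    · subst h
      simp [oracleTM]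
      rfl
    · simp [oracleTM, h]

theorem haltList_oracleTM [Fintype K] (c : Cmd K True) (kin kout kq : K) (l : List Bool) :
    Turing.haltList (oracleTM c kin kout kq).tm l =
      ⟨none, c.initVar, Stk.mk [] [] (update (fun _ => []) kout l)⟩ := by
  unfold Turing.haltList
  congr 1
  funext k
  cases k with
  | inp => rfl
  | clk => rfl
  | reg k =>
    by_cases h : k = kout
    · subst h
      simp [oracleTM]
      rfl
    · simp [oracleTM, h]

theorem oracleTM_step [Fintype K] (A : Language Bool) (c : Cmd K True) (kin kout kq : K)
    {l : MLbl c} (hl : l ≠ .inl .ask) (v S) : (oracleTM c kin kout kq).step A ⟨some l, v, S⟩ =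
      some (stepAux (oracleCode c kout l) v S) :=
  if_neg fun h => hl (Option.some.inj h)

open Classical in
theorem oracleTM_step_ask [Fintype K] (A : Language Bool) (c : Cmd K True) (kin kout kq : K)
    (v i d s) : (oracleTM c kin kout kq).step A ⟨some (.inl .ask), v, Stk.mk i d s⟩ =
      some ⟨some (if s kq ∈ A then .inl .yes else .inl .no), v,
        Stk.mk i d (update s kq [])⟩ := by
  refine (if_pos rfl).trans ?_
  have e : (s kq).map (Equiv.refl Bool) = s kq := List.map_id _
  rw [← Stk.update_mk_reg, ← e]
  congr

/-- A program whose number of iterations is polynomially bounded gives a function in `FP^NP`. -/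
theorem inFPNP_of_runs [Fintype K] {A : Language Bool} (hA : InNP A) (c : Cmd K True)
    (kin kout kq : K) (f : List Bool → List Bool) (p : Polynomial ℕ)
    (h : ∀ x, ∃ s', s' kout = f x ∧
      Runs kq (· ∈ A) c (update (fun _ => []) kin x) s' (p.eval x.length)) : InFPNP f := by
  refine ⟨A, hA, oracleTM c kin kout kq, (2 * .C c.weight) * (2 + p) + .X + 4, fun x => ?_⟩
  obtain ⟨s', hs', u, hu, hx⟩ := h x
  -- Starting with one unit more than needed makes the final clock positive, which is what a
  -- simulation without a clock requires.
  have h := hx 1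
  obtain ⟨v₃, t₃, ht₃, r₃⟩ := h.reach false (ask := .inl .ask) (yes := .inl .yes) (no := .inl .no)
    (m := oracleCode c kout) (step := (oracleTM c kin kout kq).step A)
    (fun l v S hl => oracleTM_step A c kin kout kq hl v S)
    (fun _ v i d s => oracleTM_step_ask A c kin kout kq v i d s) (by simp) (by simp) rfl rfl [] (.inr Nat.one_pos)
    .inr (.inl .fin) (by simp) (fun _ => rfl) c.initVar
  have hl := h.length_le
  set n := x.length with hn
  have hfin : (oracleTM c kin kout kq).step A
      ⟨some (.inl .fin), v₃, Stk.mk [] [] s'⟩ = some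
      ⟨some (.inl .clean), v₃, Stk.mk [] [] s'⟩ :=
    oracleTM_step A c kin kout kq (by simp) _ _
  obtain ⟨t₄, ht₄, r₄⟩ := clean_reach (l := .inl .clean) (Finset.nodup_toList
      (Finset.univ.erase (.reg kout)))
    (q := .load (fun _ => c.initVar) .halt)
    (step := (oracleTM c kin kout kq).step A) (fun _ _ =>
      oracleTM_step A c kin kout kq (by simp) _ _)
    (n + c.weight * (2 + u)) v₃
    (Stk.mk [] [] s') (by
      intro k _
      cases k with
      | inp => simp
      | clk => simp
      | reg k =>
        have h2 : (update (fun _ => []) kin x k).length ≤ n := by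
          by_cases h : k = kin
          · subst h; simp [hn]
          · simp [h]
        have h3 := hl k
        have h4 : c.weight * (1 + (1 + u - 1)) ≤ c.weight * (2 + u) :=
          Nat.mul_le_mul_left _ (by omega)
        simp only [Stk.mk_reg]
        omega)
  have r := r₃.trans (Reach.head hfin r₄)
  have hend : stepAux (.load (fun _ => c.initVar) .halt) (v₃.1, false, v₃.2.2)
      (fun k => if k ∈ ((Finset.univ : Finset (Stk K)).erase (.reg kout)).toList then [] else
        Stk.mk [] [] s' k) =
      (⟨none, c.initVar, Stk.mk [] [] (update (fun _ => []) kout (f x))⟩ :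
        Cfg (Stk.Γ (K := K)) (MLbl c) (Var (MLbl c))) := by
    simp only [stepAux]
    congr 1
    funext k
    cases k with
    | inp => simp
    | clk => simp
    | reg k =>
      by_cases hk : k = kout
      · subst hk; simp [hs']
      · simp [hk]
  rw [hend] at r
  unfold OracleTM.OutputsInTime
  have e : x.map (Equiv.refl Bool).symm = x := List.map_id x
  have e' : (f x).map (Equiv.refl Bool).symm = f x := List.map_id _
  refine Reach.nonempty_evalsToInTime (Reach.congr r
    ((congrArg (Turing.initList (oracleTM c kin kout kq).tm) e).trans
      (initList_oracleTM c kin kout kq _))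
    ((congrArg (Turing.haltList (oracleTM c kin kout kq).tm) e').trans
      (haltList_oracleTM c kin kout kq _))) ?_
  simp
  have h4 : c.weight * (2 + u) ≤ c.weight * (2 + p.eval n) :=
    Nat.mul_le_mul_left _ (by omega)
  have h5 : c.weight * (1 + (1 + u - 1)) ≤ c.weight * (2 + u) :=
    Nat.mul_le_mul_left _ (by omega)
  nlinarith

end Cmd

/-! ### Binary numbers -/

/-- The number with the binary digits `l`, least significant digit first. -/
def bval : List Bool → ℕ
  | [] => 0
  | b :: l => b.toNat + 2 * bval l

@[simp] theorem bval_nil : bval [] = 0 := rfl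
@[simp] theorem bval_cons (b : Bool) (l : List Bool) : bval (b :: l) = b.toNat + 2 * bval l := rfl

theorem bval_append (l m : List Bool) : bval (l ++ m) = bval l + 2 ^ l.length * bval m := by
  induction l with
  | nil => simp
  | cons b l ih => simp [ih, pow_succ]; ring

theorem bval_lt (l : List Bool) : bval l < 2 ^ l.length := by
  induction l with
  | nil => simp
  | cons b l ih => simp [pow_succ]; cases b <;> simp <;> omega

/-- The carry as the content of a stack. -/
def carry (b : Bool) : List Bool := bif b then [true] else []

@[simp] theorem carry_true : carry true = [true] := rfl
@[simp] theorem carry_false : carry false = [] := rfl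
@[simp] theorem head?_carry (b : Bool) : (carry b).head?.isSome = b := by cases b <;> rfl
@[simp] theorem tail_carry (b : Bool) : (carry b).tail = [] := by cases b <;> rfl

namespace Cmd

variable {K : Type} {ora : Prop} [DecidableEq K] {kq : K} {A : List Bool → Prop}

theorem Runs.congr {c : Cmd K ora} {s s' s'' : K → List Bool} {t t' : ℕ} (h : Runs kq A c s s' t)
    (hs : s'' = s') (ht : t ≤ t') : Runs kq A c s s'' t' := hs ▸ h.mono ht

/-- Push `b` onto stack `k` if `p` holds. -/
def pushIf (p : Bool) (k : K) (b : Bool) : Cmd K ora := bif p then push k b else skip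

theorem Runs.pushIf (p : Bool) (k : K) (b : Bool) (s : K → List Bool) :
    Runs kq A (pushIf p k b : Cmd K ora) s (bif p then update s k (b :: s k) else s) 0 := by
  cases p
  · exact .skip s
  · exact .push k b s

theorem Runs.pushIf_carry (p : Bool) (k : K) {s : K → List Bool} (hs : s k = []) :
    Runs kq A (Cmd.pushIf p k true : Cmd K ora) s (update s k (carry p)) 0 := by
  refine (Runs.pushIf p k true s).congr ?_ le_rfl
  cases p
  · simp [← hs]
  · simp [hs]

/-! ### Moving and erasing -/

/-- Move the content of stack `a` to stack `b`, reversing it. -/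
def move (a b : K) : Cmd K ora := loop a (fun _ => false) fun x => push b x

theorem Runs.move {a b : K} (hab : a ≠ b) (s : K → List Bool) :
    Runs kq A (move a b : Cmd K ora) s (update (update s a []) b ((s a).reverse ++ s b))
      (s a).length := by
  generalize hw : s a = w
  induction w generalizing s with
  | nil =>
    refine (Runs.loop_nil _ _ hw).congr ?_ le_rfl
    funext k
    simp only [update_apply]
    split_ifs <;> simp_all
  | cons x w ih =>
    refine (Runs.loop_step hw rfl (.push _ _ _)
      (ih (update (update s a w) b (x :: update s a w b)) (by simp [hab]))).congr ?_ (by simp)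
    funext k
    simp only [update_apply]
    split_ifs <;> simp_all

/-- Move the content of stack `a` to the stacks `b` and `c`, reversing it. -/
def move₂ (a b c : K) : Cmd K ora := loop a (fun _ => false) fun x => (push b x).seq (push c x)

theorem Runs.move₂ {a b c : K} (hab : a ≠ b) (hac : a ≠ c) (hbc : b ≠ c) (s : K → List Bool) :
    Runs kq A (move₂ a b c : Cmd K ora) s (update (update (update s a []) b
      ((s a).reverse ++ s b)) c ((s a).reverse ++ s c)) (s a).length := by
  generalize hw : s a = w
  induction w generalizing s with
  | nil =>
    refine (Runs.loop_nil _ _ hw).congr ?_ le_rfl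
    funext k
    simp only [update_apply]
    split_ifs <;> simp_all
  | cons x w ih =>
    refine (Runs.loop_step hw rfl (.seq (.push _ _ _) (.push _ _ _))
      (ih _ (by simp [hab, hac]))).congr ?_ (by simp)
    funext k
    simp only [update_apply]
    split_ifs <;> simp_all

/-- Erase the content of stack `a`. -/
def erase (a : K) : Cmd K ora := loop a (fun _ => false) fun _ => skip

theorem Runs.erase (a : K) (s : K → List Bool) :
    Runs kq A (erase a : Cmd K ora) s (update s a []) (s a).length := by
  generalize hw : s a = w
  induction w generalizing s with
  | nil =>
    refine (Runs.loop_nil _ _ hw).congr ?_ le_rfl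
    funext k
    simp only [update_apply]
    split_ifs <;> simp_all
  | cons x w ih =>
    refine (Runs.loop_step hw rfl (.skip _) (ih _ (by simp))).congr (by simp) (by simp)

/-- Push `b` onto stack `c` once for every element of stack `a`, which is moved to `a'`. -/
def pushLength (a a' c : K) (b : Bool) : Cmd K ora :=
  loop a (fun _ => false) fun x => (push a' x).seq (push c b)

theorem Runs.pushLength {a a' c : K} (hab : a ≠ a') (hac : a ≠ c) (hbc : a' ≠ c) (b : Bool)
    (s : K → List Bool) :
    Runs kq A (pushLength a a' c b : Cmd K ora) s (update (update (update s a []) a'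
      ((s a).reverse ++ s a')) c (List.replicate (s a).length b ++ s c)) (s a).length := by
  generalize hw : s a = w
  induction w generalizing s with
  | nil =>
    refine (Runs.loop_nil _ _ hw).congr ?_ le_rfl
    funext k
    simp only [update_apply]
    split_ifs <;> simp_all
  | cons x w ih =>
    refine (Runs.loop_step hw rfl (.seq (.push _ _ _) (.push _ _ _))
      (ih _ (by simp [hab, hac]))).congr ?_ (by simp)
    funext k
    simp only [update_apply]
    split_ifs <;> simp_all [List.replicate_succ']

/-! ### Addition -/

/-- One step of `addLoop`. -/
def addStep (a' acc r cy : K) (x : Bool) : Cmd K ora :=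
  (push a' x).seq <| pop acc fun y => pop cy fun z =>
    (push r (x ^^ y.getD false ^^ z.isSome)).seq <|
    pushIf (Bool.atLeastTwo x (y.getD false) z.isSome) cy true

/-- The digits of stack `a` are added to those of `acc`; the digits of the sum are pushed onto
`r`, and stack `a` is moved to `a'`. -/
def addLoop (a a' acc r cy : K) : Cmd K ora :=
  loop a (fun _ => false) (addStep a' acc r cy)

/-- Ripple-carry addition with the least significant digit on top. Only `a` drives the loop: missing
digits of `acc` count as zero, while surplus digits of `acc` stay unread and reappear in the
invariant together with the carry. -/
theorem Runs.addLoop {a a' acc r cy : K} (hd : [a, a', acc, r, cy].Nodup) (s : K → List Bool)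
    (κ : Bool) (hκ : s cy = carry κ) :
    ∃ w κ', w.length = (s a).length ∧
      bval w + 2 ^ w.length * (κ'.toNat + bval ((s acc).drop w.length)) =
        bval (s a) + bval (s acc) + κ.toNat ∧
      Runs kq A (addLoop a a' acc r cy : Cmd K ora) s
        (update (update (update (update (update s a []) a' ((s a).reverse ++ s a'))
          acc ((s acc).drop w.length)) r (w.reverse ++ s r)) cy (carry κ')) (s a).length := by
  have hd' := List.nodup_reverse.mpr hd
  simp at hd hd'
  generalize hw : s a = w
  induction w generalizing s κ with
  | nil =>
    refine ⟨[], κ, rfl, by simp; ring, (Runs.loop_nil _ _ hw).congr ?_ le_rfl⟩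
    funext k
    simp only [update_apply]
    split_ifs <;> simp_all
  | cons x w ih =>
    have hb : Runs kq A (addStep a' acc r cy x : Cmd K ora) (update s a w)
        (update (update (update (update (update s a w) a' (x :: s a')) acc (s acc).tail) r
          ((x ^^ (s acc).head?.getD false ^^ κ) :: s r)) cy
          (carry (Bool.atLeastTwo x ((s acc).head?.getD false) κ))) 0 := by
      refine (Runs.seq (.push _ _ _) (.pop (.pop (.seq (.push _ _ _)
        (.pushIf_carry _ _ ?_))))).congr ?_ le_rfl
      · simp [hd, hd', hκ]
      · clear ih
        funext k
        simp only [update_apply, hd, hd', hκ, if_false, head?_carry]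
        split_ifs <;> rfl
    obtain ⟨u, κ', hu, hv, hr⟩ := ih (update (update (update (update (update s a w) a' (x :: s a')) acc (s acc).tail) r
          ((x ^^ (s acc).head?.getD false ^^ κ) :: s r)) cy
          (carry (Bool.atLeastTwo x ((s acc).head?.getD false) κ))) (Bool.atLeastTwo x ((s acc).head?.getD false) κ)
      (by simp) (by simp [hd, hd'])
    refine ⟨(x ^^ (s acc).head?.getD false ^^ κ) :: u, κ', by simp [hu], ?_,
      (Runs.loop_step hw rfl hb hr).congr ?_ (by simp)⟩
    · simp [hd, hd'] at hv
      rcases hc : s acc with _ | ⟨y, c⟩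
      · rw [hc] at hv
        cases x <;> cases κ <;> simp [pow_succ] at hv ⊢ <;> linarith
      · rw [hc] at hv
        cases x <;> cases y <;> cases κ <;> simp [pow_succ] at hv ⊢ <;> linarith
    · clear ih hb hr hv
      funext k
      simp only [update_apply, hd, hd', if_false]
      simp only [List.reverse_cons, List.append_assoc, List.singleton_append, List.length_cons]
      split_ifs <;> first | rfl | simp

/-- One step of `carryLoop`. -/
def carryStep (r cy : K) (x : Bool) : Cmd K ora :=
  pop cy fun z => (push r (x ^^ z.isSome)).seq <| pushIf (x && z.isSome) cy true

/-- The carry `cy` is added to the digits of stack `a`. -/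
def carryLoop (a r cy : K) : Cmd K ora := loop a (fun _ => false) (carryStep r cy)

/-- This completes an addition when `acc` is longer than `a`: the remaining digits only have to
absorb the carry. -/
theorem Runs.carryLoop {a r cy : K} (hd : [a, r, cy].Nodup) (s : K → List Bool)
    (κ : Bool) (hκ : s cy = carry κ) :
    ∃ w κ', w.length = (s a).length ∧ bval w + 2 ^ w.length * κ'.toNat = bval (s a) + κ.toNat ∧
      Runs kq A (carryLoop a r cy : Cmd K ora) s
        (update (update (update s a []) r (w.reverse ++ s r)) cy (carry κ')) (s a).length := by
  have hd' := List.nodup_reverse.mpr hd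
  simp at hd hd'
  generalize hw : s a = w
  induction w generalizing s κ with
  | nil =>
    refine ⟨[], κ, rfl, by simp, (Runs.loop_nil _ _ hw).congr ?_ le_rfl⟩
    funext k
    simp only [update_apply]
    split_ifs <;> simp_all
  | cons x w ih =>
    have hb : Runs kq A (carryStep r cy x : Cmd K ora) (update s a w)
        (update (update (update s a w) r ((x ^^ κ) :: s r)) cy (carry (x && κ))) 0 := by
      refine (Runs.pop (.seq (.push _ _ _) (.pushIf_carry _ _ ?_))).congr ?_ le_rfl
      · simp [hd, hd', hκ]
      · clear ih
        funext k
        simp only [update_apply, hd, hd', hκ, if_false, head?_carry]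
        split_ifs <;> rfl
    obtain ⟨u, κ', hu, hv, hr⟩ := ih (update (update (update s a w) r ((x ^^ κ) :: s r)) cy
      (carry (x && κ))) (x && κ) (by simp) (by simp [hd])
    refine ⟨(x ^^ κ) :: u, κ', by simp [hu], ?_,
      (Runs.loop_step hw rfl hb hr).congr ?_ (by simp)⟩
    · cases x <;> cases κ <;> simp [pow_succ] at hv ⊢ <;> linarith
    · clear ih hb hr hv
      funext k
      simp only [update_apply, hd, hd', if_false]
      simp only [List.reverse_cons, List.append_assoc, List.singleton_append]
      split_ifs <;> rfl

/-- Push the carry onto `r`. -/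
def popCarry (r cy : K) : Cmd K ora := pop cy fun z => pushIf z.isSome r true

theorem Runs.popCarry {r cy : K} (h : r ≠ cy) (s : K → List Bool) (κ : Bool)
    (hκ : s cy = carry κ) : Runs kq A (popCarry r cy : Cmd K ora) s
      (update (update s cy []) r (carry κ ++ s r)) 0 := by
  refine Runs.pop ((Runs.pushIf _ _ _ _).congr ?_ le_rfl)
  cases κ <;> simp [hκ, h]

/-- The content of stack `a` is added to `acc`. -/
def add (a a' acc r cy : K) : Cmd K ora :=
  (addLoop a a' acc r cy).seq <| (carryLoop acc r cy).seq <|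
  (popCarry r cy).seq <| (move r acc).seq (move a' a)

theorem Runs.add {a a' acc r cy : K} (hd : [a, a', acc, r, cy].Nodup) (s : K → List Bool)
    (ha' : s a' = []) (hr : s r = []) (hcy : s cy = []) :
    ∃ w, bval w = bval (s acc) + bval (s a) ∧
      w.length ≤ max (s a).length (s acc).length + 1 ∧
      Runs kq A (add a a' acc r cy : Cmd K ora) s (update s acc w)
        (3 * (s a).length + 2 * (s acc).length + 1) := by
  obtain ⟨w₁, κ₁, hl₁, hv₁, hr₁⟩ := Runs.addLoop (ora := ora) (kq := kq) (A := A) hd s false hcy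
  have hd' := List.nodup_reverse.mpr hd
  simp at hd hd'
  obtain ⟨w₂, κ₂, hl₂, hv₂, hr₂⟩ := Runs.carryLoop (ora := ora) (kq := kq) (A := A)
    (show [acc, r, cy].Nodup by simp [hd]) (update (update (update (update (update s a []) a'
      ((s a).reverse ++ s a')) acc ((s acc).drop w₁.length)) r (w₁.reverse ++ s r)) cy (carry κ₁))
    κ₁ (by simp)
  have hl₂' : w₂.length = (s acc).length - w₁.length := by
    simpa [hd, hd'] using hl₂
  have hv₂' : bval w₂ + 2 ^ w₂.length * κ₂.toNat =
      bval ((s acc).drop w₁.length) + κ₁.toNat := by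
    simpa [hd, hd'] using hv₂
  refine ⟨w₁ ++ (w₂ ++ carry κ₂), ?_, ?_, (hr₁.seq (hr₂.seq (.seq (.popCarry ?_ _ κ₂ ?_)
    ((Runs.move ?_ _).seq (.move ?_ _))))).congr ?_ ?_⟩
  · have : bval (carry κ₂) = κ₂.toNat := by cases κ₂ <;> rfl
    simp only [bval_append, this]
    simp at hv₁
    rw [hv₂', Nat.add_comm (bval (List.drop _ _)), hv₁, Nat.add_comm]
  · have : (carry κ₂).length ≤ 1 := by cases κ₂ <;> simp
    simp only [List.length_append]
    omega
  · exact hd.2.2.2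
  · simp
  · exact hd'.2.1.1
  · exact hd'.2.2.2
  · funext k
    cases κ₂ <;> simp only [update_apply, hd, hd', if_false, if_true, ha', hr, hcy] <;> simp <;>
    split_ifs <;> simp_all
  · cases κ₂ <;> simp [hd, hd', hr, ha'] <;> omega

/-! ### Multiplication -/

/-- One step of `mulLoop`. -/
def mulStep (p' a a' acc r cy : K) (x : Bool) : Cmd K ora :=
  (push p' x).seq <| (push acc false).seq <| bif x then add a a' acc r cy else skip

/-- Horner's scheme: `acc` becomes the product of stack `a` and the number on stack `p`, the most
significant digit of which is on top. -/
def mulLoop (p p' a a' acc r cy : K) : Cmd K ora :=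
  loop p (fun _ => false) (mulStep p' a a' acc r cy)

/-- Pushing a zero onto `acc` doubles it, and adding `a` follows if the current digit is one. Each
step lengthens `acc` by at most two, one for the shift and one for the carry; `M` dominates all
intermediate lengths and makes the cost per step uniform. -/
theorem Runs.mulLoop {p p' a a' acc r cy : K} (hd : [p, p', a, a', acc, r, cy].Nodup)
    (s : K → List Bool) (ha' : s a' = []) (hr : s r = []) (hcy : s cy = []) (M : ℕ)
    (hM : max (s acc).length (s a).length + 2 * (s p).length ≤ M) :
    ∃ w, bval w = bval (s acc) * 2 ^ (s p).length + bval (s p).reverse * bval (s a) ∧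
      w.length ≤ max (s acc).length (s a).length + 2 * (s p).length ∧
      Runs kq A (mulLoop p p' a a' acc r cy : Cmd K ora) s
        (update (update (update s p []) p' ((s p).reverse ++ s p')) acc w)
        ((s p).length * (5 * M + 4)) := by
  have hd₀ : [a, a', acc, r, cy].Nodup := hd.sublist (by simp)
  have hd' := List.nodup_reverse.mpr hd
  simp at hd hd'
  generalize hw : s p = w at hM
  induction w generalizing s with
  | nil =>
    refine ⟨s acc, by simp, by simp, (Runs.loop_nil _ _ hw).congr ?_ (by simp)⟩
    funext k
    simp only [update_apply]
    split_ifs <;> simp_all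
  | cons x w ih =>
    have hb : ∃ u, bval u = 2 * bval (s acc) + x.toNat * bval (s a) ∧
        u.length ≤ max (s acc).length (s a).length + 2 ∧
        Runs kq A (mulStep p' a a' acc r cy x : Cmd K ora) (update s p w)
        (update (update (update s p w) p' (x :: s p')) acc u) (5 * M + 3) := by
      cases x with
      | false =>
        refine ⟨false :: s acc, by simp, by simp; omega, ?_⟩
        refine (Runs.seq (.push _ _ _) (.seq (.push _ _ _) (.skip _))).congr ?_ (by simp)
        simp [hd, hd']
      | true =>
        obtain ⟨u, hu, hl, hr⟩ := Runs.add (ora := ora) (kq := kq) (A := A) hd₀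
          (update (update (update s p w) p' (true :: s p')) acc (false :: s acc))
          (by simp [hd, hd', ha']) (by simp [hd, hd', hr]) (by simp [hd, hd', hcy])
        refine ⟨u, by simpa [hd, hd'] using hu, ?_, ?_⟩
        · simp [hd, hd'] at hl
          omega
        · refine (Runs.seq (.push _ _ _) (.seq (.push _ _ _)
            (t₂ := 5 * M + 3) (s₂ := update (update (update s p w) p' (true :: s p')) acc u)
            ?_)).congr rfl (by simp)
          refine (show Runs kq A (Cmd.add a a' acc r cy : Cmd K ora) _ _ _ from ?_)
          have e : update (update (update s p w) p' (true :: update s p w p')) acc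
              (false :: update (update s p w) p' (true :: update s p w p') acc) =
              update (update (update s p w) p' (true :: s p')) acc (false :: s acc) := by
            simp [hd, hd']
          rw [e]
          refine hr.congr (by simp) ?_
          simp [hd, hd'] at hM ⊢
          omega
    obtain ⟨u, hu, hl, hr₁⟩ := hb
    obtain ⟨v, hv, hl', hr₂⟩ := ih (update (update (update s p w) p' (x :: s p')) acc u)
      (by simp [hd, hd', ha']) (by simp [hd, hd', hr]) (by simp [hd, hd', hcy]) (by simp [hd, hd'])
      (by simp [hd, hd'] at hM ⊢; omega)
    simp only [List.length_cons] at hM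
    refine ⟨v, ?_, ?_, (Runs.loop_step hw rfl hr₁ hr₂).congr ?_ ?_⟩
    · simp [hd, hd'] at hv
      rw [hv, hu]
      simp [bval_append, pow_succ]
      ring
    · simp [hd, hd'] at hl' ⊢
      omega
    · clear ih hr₁ hr₂ hv
      funext k
      simp only [update_apply, hd, hd', if_false]
      simp only [List.reverse_cons, List.append_assoc, List.singleton_append]
      split_ifs <;> rfl
    · rw [List.length_cons]
      ring_nf
      omega

/-- Stack `a` is multiplied by the number on stack `p`, the most significant digit of which is on
top. -/
def mul (p p' a a' acc r cy : K) : Cmd K ora :=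
  (mulLoop p p' a a' acc r cy).seq <| (move p' p).seq <| (erase a).seq <|
  (move acc r).seq (move r a)

theorem Runs.mul {p p' a a' acc r cy : K} (hd : [p, p', a, a', acc, r, cy].Nodup)
    (s : K → List Bool) (hp' : s p' = []) (ha' : s a' = []) (hacc : s acc = []) (hr : s r = [])
    (hcy : s cy = []) :
    ∃ w, bval w = bval (s p).reverse * bval (s a) ∧
      w.length ≤ (s a).length + 2 * (s p).length ∧
      Runs kq A (mul p p' a a' acc r cy : Cmd K ora) s (update s a w)
        ((s p).length * (5 * ((s a).length + 2 * (s p).length) + 9) + 3 * (s a).length) := by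
  obtain ⟨w, hv, hl, hw⟩ := Runs.mulLoop (ora := ora) (kq := kq) (A := A) hd s ha' hr hcy
    ((s a).length + 2 * (s p).length) (by simp [hacc])
  have hd' := List.nodup_reverse.mpr hd
  simp at hd hd'
  simp only [hacc, List.length_nil, zero_le, sup_of_le_right] at hl
  refine ⟨w, by simpa [hacc] using hv, hl, (hw.seq ((Runs.move ?_ _).seq ((Runs.erase _ _).seq
    ((Runs.move ?_ _).seq (.move ?_ _))))).congr ?_ ?_⟩
  · exact hd'.2.2.2.2.2
  · exact hd.2.2.2.2.1.1
  · exact hd'.2.1.2.2.1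
  · clear hw hv
    funext k
    simp only [update_apply, hd, hd', if_false, if_true]
    simp
    split_ifs <;> simp_all
  · simp [hd, hd', hp', hr]
    ring_nf
    omega

/-! ### Subtraction -/

/-- One step of `subLoop`. -/
def subStep (w u cy : K) (x : Bool) : Cmd K ora :=
  pop w fun y => pop cy fun z =>
    (push u (x ^^ y.getD false ^^ z.isSome)).seq <|
    pushIf (Bool.atLeastTwo (!x) (y.getD false) z.isSome) cy true

/-- The digits of stack `w` are subtracted from those of `x`; the digits of the difference are
pushed onto `u`. -/
def subLoop (x w u cy : K) : Cmd K ora := loop x (fun _ => false) (subStep w u cy)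

/-- The stack `cy` holds a borrow, which arises exactly when at least two of `!x`, `y` and the
previous borrow are set. The invariant is additive, so that no truncated subtraction enters. -/
theorem Runs.subLoop {x w u cy : K} (hd : [x, w, u, cy].Nodup) (s : K → List Bool)
    (κ : Bool) (hκ : s cy = carry κ) :
    ∃ v κ', v.length = (s x).length ∧
      bval v + bval (s w) + κ.toNat =
        bval (s x) + 2 ^ v.length * (κ'.toNat + bval ((s w).drop v.length)) ∧
      Runs kq A (subLoop x w u cy : Cmd K ora) s
        (update (update (update (update s x []) w ((s w).drop v.length)) u (v.reverse ++ s u))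
          cy (carry κ')) (s x).length := by
  have hd' := List.nodup_reverse.mpr hd
  simp at hd hd'
  generalize hl : s x = l
  induction l generalizing s κ with
  | nil =>
    refine ⟨[], κ, rfl, by simp; ring, (Runs.loop_nil _ _ hl).congr ?_ le_rfl⟩
    funext k
    simp only [update_apply]
    split_ifs <;> simp_all
  | cons b l ih =>
    have hb : Runs kq A (subStep w u cy b : Cmd K ora) (update s x l)
        (update (update (update (update s x l) w (s w).tail) u
          ((b ^^ (s w).head?.getD false ^^ κ) :: s u)) cy
          (carry (Bool.atLeastTwo (!b) ((s w).head?.getD false) κ))) 0 := by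
      refine (Runs.pop (.pop (.seq (.push _ _ _) (.pushIf_carry _ _ ?_)))).congr ?_ le_rfl
      · simp [hd, hd', hκ]
      · clear ih
        funext k
        simp only [update_apply, hd, hd', hκ, if_false, head?_carry]
        split_ifs <;> rfl
    obtain ⟨v, κ', hu, hv, hr⟩ := ih (update (update (update (update s x l) w (s w).tail) u
          ((b ^^ (s w).head?.getD false ^^ κ) :: s u)) cy
          (carry (Bool.atLeastTwo (!b) ((s w).head?.getD false) κ)))
          (Bool.atLeastTwo (!b) ((s w).head?.getD false) κ)
      (by simp) (by simp [hd, hd'])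
    refine ⟨(b ^^ (s w).head?.getD false ^^ κ) :: v, κ', by simp [hu], ?_,
      (Runs.loop_step hl rfl hb hr).congr ?_ (by simp)⟩
    · simp [hd, hd'] at hv
      rcases hc : s w with _ | ⟨y, c⟩
      · rw [hc] at hv
        cases b <;> cases κ <;> simp [pow_succ] at hv ⊢ <;> linarith
      · rw [hc] at hv
        cases b <;> cases y <;> cases κ <;> simp [pow_succ] at hv ⊢ <;> linarith
    · clear ih hb hr hv
      funext k
      simp only [update_apply, hd, hd', if_false]
      simp only [List.reverse_cons, List.append_assoc, List.singleton_append, List.length_cons]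
      split_ifs <;> first | rfl | simp

/-- Push `true` onto `err` for every digit one of stack `w`, which is emptied. -/
def checkZero (w err : K) : Cmd K ora := loop w (fun _ => false) fun b => pushIf b err true

theorem Runs.checkZero {w err : K} (h : w ≠ err) (s : K → List Bool) :
    ∃ e, (e = [] ↔ bval (s w) = 0) ∧ Runs kq A (checkZero w err : Cmd K ora) s
      (update (update s w []) err (e ++ s err)) (s w).length := by
  generalize hl : s w = l
  induction l generalizing s with
  | nil =>
    refine ⟨[], by simp, (Runs.loop_nil _ _ hl).congr ?_ le_rfl⟩
    funext k
    simp only [update_apply]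
    split_ifs <;> simp_all
  | cons b l ih =>
    obtain ⟨e, he, hr⟩ := ih (bif b then update (update s w l) err (true :: update s w l err)
      else update s w l) (by cases b <;> simp [h])
    refine ⟨e ++ carry b, ?_, (Runs.loop_step hl rfl (.pushIf b err true (update s w l)) hr).congr ?_
      (by simp)⟩
    · cases b <;> simp [he]
    · clear ih hr
      funext k
      cases b <;> simp only [cond_true, cond_false, update_apply, h, h.symm, if_false] <;>
        split_ifs <;> simp_all

/-- The difference of `x` and `w` is pushed onto `u`; an element is pushed onto `err` if the
difference is negative. -/
def sub (x w u cy err : K) : Cmd K ora :=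
  (subLoop x w u cy).seq <| (popCarry err cy).seq (checkZero w err)

/-- Since `bval v < 2 ^ v.length`, the identity of `subLoop` shows that the difference is
nonnegative precisely when both the final borrow and the unread digits of `w` vanish. These are the
two things that are reported on `err`. -/
theorem Runs.sub {x w u cy err : K} (hd : [x, w, u, cy, err].Nodup) (s : K → List Bool)
    (hcy : s cy = []) :
    ∃ v e, v.length = (s x).length ∧ (e = [] ↔ bval (s w) ≤ bval (s x)) ∧
      (bval (s w) ≤ bval (s x) → bval v + bval (s w) = bval (s x)) ∧
      Runs kq A (sub x w u cy err : Cmd K ora) s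
        (update (update (update (update s x []) w []) u (v.reverse ++ s u)) err (e ++ s err))
        ((s x).length + (s w).length) := by
  obtain ⟨v, κ, hl, hv, hr⟩ := Runs.subLoop (ora := ora) (kq := kq) (A := A)
    (show [x, w, u, cy].Nodup from hd.sublist (by simp)) s false hcy
  have hd' := List.nodup_reverse.mpr hd
  simp at hd hd'
  have hp := Runs.popCarry (ora := ora) (kq := kq) (A := A) hd'.1.1 (update (update (update
    (update s x []) w ((s w).drop v.length)) u (v.reverse ++ s u)) cy (carry κ)) κ (by simp)
  obtain ⟨e, he, hr'⟩ := Runs.checkZero (ora := ora) (kq := kq) (A := A) (w := w) (err := err)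
    hd.2.1.2.2 (update (update (update (update (update (update s x []) w ((s w).drop v.length)) u
      (v.reverse ++ s u)) cy (carry κ)) cy []) err (carry κ ++ (update (update (update
    (update s x []) w ((s w).drop v.length)) u (v.reverse ++ s u)) cy (carry κ)) err))
  simp [hd, hd'] at he
  simp at hv
  have hlt := bval_lt v
  have key : e ++ carry κ = [] ↔ bval (s w) ≤ bval (s x) := by
    rw [List.append_eq_nil_iff, he]
    rcases Nat.eq_zero_or_pos (κ.toNat + bval ((s w).drop v.length)) with h0 | h0
    · rw [h0] at hv
      have : κ = false := by cases κ <;> simp at h0 ⊢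
      subst this
      simp at h0 ⊢
      omega
    · have : 2 ^ v.length * 1 ≤ 2 ^ v.length * (κ.toNat + bval ((s w).drop v.length)) :=
        Nat.mul_le_mul_left _ h0
      constructor
      · rintro ⟨h1, h2⟩
        cases κ <;> simp at h2 h0
        omega
      · intro h
        omega
  refine ⟨v, e ++ carry κ, hl, key, ?_, (hr.seq (hp.seq hr')).congr ?_ ?_⟩
  · intro h
    have := key.mpr h
    rw [List.append_eq_nil_iff, he] at this
    have h2 : κ = false := by cases κ <;> simp at this ⊢
    rw [this.1, h2] at hv
    simpa using hv
  · clear hr hp hr' he key hv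
    funext k
    simp only [update_apply, hd, hd', if_false, List.append_assoc]
    split_ifs <;> first | rfl | simp_all
  · simp [hd, hd']

end Cmd

/-! ### Reading, moving and comparing self-delimiting strings -/

theorem encodeStr_nil : encodeStr [] = [false] := rfl

theorem encodeStr_cons (b : Bool) (w : List Bool) : encodeStr (b :: w) = true :: b :: encodeStr w :=
  rfl

@[simp] theorem length_encodeStr (w : List Bool) : (encodeStr w).length = 2 * w.length + 1 := by
  induction w with
  | nil => rfl
  | cons b w ih => simp [encodeStr_cons, ih]; ring

namespace Cmd

variable {K : Type} {ora : Prop} [DecidableEq K] {kq : K} {A : List Bool → Prop}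

/-- Read the code of a string from stack `e`; the string is pushed onto `j`, and the end marker onto
`m`. -/
def readLoop (e j m : K) : Cmd K ora :=
  loop e (fun b => !b) fun b => bif b then pop e fun o => o.elim skip (push j) else push m true

theorem runs_readLoop {e j m : K} (hd : [e, j, m].Nodup) (w rest : List Bool) (s : K → List Bool)
    (hs : s e = encodeStr w ++ rest) :
    Runs kq A (readLoop e j m : Cmd K ora) s
      (update (update (update s e rest) j (w.reverse ++ s j)) m (true :: s m)) (w.length + 1) := by
  have hd' := List.nodup_reverse.mpr hd
  simp at hd hd'
  induction w generalizing s with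
  | nil =>
    rw [encodeStr_nil, List.singleton_append] at hs
    refine (Runs.loop_brk hs rfl (Runs.push m true (update s e rest))).congr ?_ (by simp)
    funext k
    simp only [update_apply, hd, hd', if_false]
    split_ifs <;> simp_all
  | cons b w ih =>
    rw [encodeStr_cons, List.cons_append, List.cons_append] at hs
    refine (Runs.loop_step hs rfl (.pop (s' := update (update s e (encodeStr w ++ rest)) j (b :: s j))
      (t := 0) ?_) (ih (update (update s e (encodeStr w ++ rest)) j (b :: s j))
        (by simp [hd]))).congr ?_ ?_
    · simp only [update_self, List.head?_cons, List.tail_cons, update_idem, Option.elim_some]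
      exact (Runs.push _ _ _).congr (by simp [hd, hd']) le_rfl
    · clear ih
      funext k
      simp only [update_apply, hd, hd', if_false]
      split_ifs <;> simp_all
    · simp

/-- The marker on `m` is written only when `false` occurs in a marker position. Without a code word
at the front, the stack runs empty before that happens. The recursion removes a marker together with
its bit. -/
theorem runs_readLoop_bad {e j m : K} (hd : [e, j, m].Nodup) (l : List Bool) (s : K → List Bool)
    (hs : s e = l) (h : ∀ w rest, l ≠ encodeStr w ++ rest) (hm : s m = []) :
    ∃ s', s' m = [] ∧ Runs kq A (readLoop e j m : Cmd K ora) s s' l.length := by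
  have hd' := List.nodup_reverse.mpr hd
  simp at hd hd'
  match l, hs, h with
  | [], hs, _ => exact ⟨s, hm, .loop_nil _ _ hs⟩
  | false :: l, _, h => exact absurd rfl (h [] l)
  | [true], hs, _ =>
    refine ⟨update s e [], by simp [hd', hm], ?_⟩
    refine (Runs.loop_step hs rfl (.pop (s' := update s e []) (t := 0) ?_)
      (.loop_nil _ _ (by simp))).congr rfl (by simp)
    simpa using Runs.skip _
  | true :: b :: l, hs, h =>
    obtain ⟨s', h₁, h₂⟩ := runs_readLoop_bad (e := e) (j := j) (m := m)
      (by simp [hd]) l (update (update s e l) j (b :: s j)) (by simp [hd])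
      (fun w rest hl => h (b :: w) rest (by rw [hl]; rfl)) (by simp [hd', hm])
    refine ⟨s', h₁, (Runs.loop_step hs rfl (.pop (t := 0) ?_) h₂).congr rfl (by simp)⟩
    simp only [update_self, List.head?_cons, List.tail_cons, update_idem, Option.elim_some]
    exact (Runs.push _ _ _).congr (by simp [hd']) le_rfl
termination_by l.length

/-- Read the code of a string from stack `e`; the string is pushed onto `j`. If there is no code of
a string, an element is pushed onto `err`. -/
def readStr (e j m err : K) : Cmd K ora :=
  (readLoop e j m).seq <| pop m fun o => pushIf o.isNone err true

theorem runs_readStr {e j m : K} (err : K) (hd : [e, j, m].Nodup) {w rest : List Bool}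
    {s : K → List Bool} (hs : s e = encodeStr w ++ rest) (hm : s m = []) :
    Runs kq A (readStr e j m err : Cmd K ora) s
      (update (update s e rest) j (w.reverse ++ s j)) (w.length + 1) := by
  refine ((runs_readLoop hd w rest s hs).seq (.pop (.pushIf _ _ _ _))).congr ?_ (by simp)
  have hd' := List.nodup_reverse.mpr hd
  simp at hd hd'
  funext k
  simp only [update_apply, hd, hd', if_false]
  simp
  by_cases hk : k = m
  · simp [hk, hd', hm]
  · simp [hk]
    split_ifs <;> simp_all

theorem runs_readStr_bad {e j m err : K} (hd : [e, j, m].Nodup) {s : K → List Bool}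
    (h : ∀ w rest, s e ≠ encodeStr w ++ rest) (hm : s m = []) :
    ∃ s' t, s' err ≠ [] ∧ Runs kq A (readStr e j m err : Cmd K ora) s s' t := by
  obtain ⟨s', h₁, h₂⟩ := runs_readLoop_bad (kq := kq) (A := A) (ora := ora) hd _ s rfl h hm
  refine ⟨_, _, ?_, h₂.seq (.pop (.pushIf _ _ _ _))⟩
  simp [h₁]

/-- Move stack `a` to stack `e` while removing as many elements from `r`; if there are too few, an
element is pushed onto `err`. -/
def moveBounded (a e r err : K) : Cmd K ora :=
  loop a (fun _ => false) fun x => (push e x).seq <| pop r fun o => pushIf o.isNone err true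

theorem runs_moveBounded {a e r err : K} (hd : [a, e, r, err].Nodup) (s : K → List Bool) :
    ∃ er, (er = [] ↔ (s a).length ≤ (s r).length) ∧
      Runs kq A (moveBounded a e r err : Cmd K ora) s
        (update (update (update (update s a []) e ((s a).reverse ++ s e)) r
          ((s r).drop (s a).length)) err (er ++ s err)) (s a).length := by
  have hd' := List.nodup_reverse.mpr hd
  simp at hd hd'
  generalize hw : s a = w
  induction w generalizing s with
  | nil =>
    refine ⟨[], by simp, (Runs.loop_nil _ _ hw).congr ?_ le_rfl⟩
    funext k
    simp only [update_apply]
    split_ifs <;> simp_all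
  | cons x w ih =>
    obtain ⟨er, he, hr⟩ := ih (update (update (update (update s a w) e (x :: s e)) r (s r).tail)
      err (carry (s r).isEmpty ++ s err)) (by simp [hd])
    have hb : Runs kq A ((push e x : Cmd K ora).seq <| pop r fun o =>
        pushIf o.isNone err true) (update s a w)
        (update (update (update (update s a w) e (x :: s e)) r (s r).tail)
          err (carry (s r).isEmpty ++ s err)) 0 := by
      refine (Runs.seq (.push _ _ _) (.pop (.pushIf _ _ _ _))).congr ?_ le_rfl
      clear ih hr
      rcases hr' : s r with _ | ⟨b, l⟩
      · simp [hd, hd', hr']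
      · simp [hd, hd', hr']
    refine ⟨er ++ carry (s r).isEmpty, ?_, (Runs.loop_step hw rfl hb hr).congr ?_ (by simp)⟩
    · simp [hd, hd'] at he
      rcases hr' : s r with _ | ⟨b, l⟩
      · simp
      · simp [he, hr']
    · clear ih hr hb he
      funext k
      simp only [update_apply, hd, hd', if_false]
      simp only [List.reverse_cons, List.append_assoc, List.singleton_append, List.length_cons]
      split_ifs <;> first | rfl | simp

/-- Compare the string coded on `l` with `i`: the code is moved to `l'`, and `i` to `i'` as far as
it has been read; differences are recorded on `ne`. -/
def cmpLoop (l l' i i' ne : K) : Cmd K ora :=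
  loop l (fun b => !b) fun b => (push l' b).seq <| bif b then
    pop l fun o => o.elim skip fun x => (push l' x).seq <|
      pop i fun o => o.elim (push ne true) fun y => (push i' y).seq (pushIf (x ^^ y) ne true)
    else skip

/-- The loop ends with the code word and does not look at the rest of `i`, so it tests only for a
prefix; `cmp` adds the test that nothing of `i` remains and restores `i`. -/
theorem runs_cmpLoop {l l' i i' ne : K} (hd : [l, l', i, i', ne].Nodup) (w rest : List Bool)
    (s : K → List Bool) (hs : s l = encodeStr w ++ rest) :
    ∃ er, (er = [] ↔ w <+: s i) ∧ er.length ≤ w.length ∧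
      Runs kq A (cmpLoop l l' i i' ne : Cmd K ora) s
        (update (update (update (update (update s l rest) l' ((encodeStr w).reverse ++ s l')) i
          ((s i).drop w.length)) i' (((s i).take w.length).reverse ++ s i')) ne (er ++ s ne))
        (w.length + 1) := by
  have hd' := List.nodup_reverse.mpr hd
  simp at hd hd'
  induction w generalizing s with
  | nil =>
    refine ⟨[], by simp, le_rfl, (Runs.loop_brk hs rfl (.seq (.push _ _ _) (.skip _))).congr ?_
      (by simp)⟩
    funext k
    simp only [update_apply, hd, hd', if_false]
    split_ifs <;> simp_all [encodeStr_nil]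
  | cons x w ih =>
    rw [encodeStr_cons, List.cons_append, List.cons_append] at hs
    rcases hi : s i with _ | ⟨y, c⟩
    · obtain ⟨er, he, hl, hr⟩ := ih (update (update (update s l (encodeStr w ++ rest)) l'
        (x :: true :: s l')) ne (true :: s ne)) (by simp [hd])
      refine ⟨er ++ [true], by simp, by simp [hl], (Runs.loop_step hs rfl (.seq (.push _ _ _)
        (.pop (t := 0) ?_)) hr).congr ?_ (by simp)⟩
      · simp [hd, hd']
        refine (Runs.seq (.push _ _ _) (.pop (t := 0) (s' := update (update (update s l
          (encodeStr w ++ rest)) l' (x :: true :: s l')) ne (true :: s ne)) ?_)).congr rfl le_rfl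
        simp [hd, hd', hi]
        refine (Runs.push _ _ _).congr ?_ le_rfl
        clear ih hr
        funext k
        simp only [update_apply, hd, hd', if_false]
        split_ifs <;> simp_all
      · clear ih hr
        funext k
        simp only [update_apply, hd, hd', if_false]
        simp [encodeStr_cons, hi]
        split_ifs <;> simp_all
    · obtain ⟨er, he, hl, hr⟩ := ih (update (update (update (update (update s l
        (encodeStr w ++ rest)) l' (x :: true :: s l')) i c) i' (y :: s i')) ne
          (carry (x ^^ y) ++ s ne)) (by simp [hd])
      simp [hd, hd'] at he
      refine ⟨er ++ carry (x ^^ y), ?_, ?_, (Runs.loop_step hs rfl (.seq (.push _ _ _)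
        (.pop (t := 0) ?_)) hr).congr ?_ (by simp)⟩
      · rw [List.cons_prefix_cons, ← he]
        cases x <;> cases y <;> simp
      · cases x <;> cases y <;> simp <;> omega
      · simp [hd, hd']
        refine (Runs.seq (.push _ _ _) (.pop (t := 0) (s' := (update (update (update (update
          (update s l (encodeStr w ++ rest)) l' (x :: true :: s l')) i c) i' (y :: s i')) ne
          (carry (x ^^ y) ++ s ne))) ?_)).congr rfl le_rfl
        simp [hd, hd', hi]
        refine (Runs.seq (.push _ _ _) (.pushIf _ _ _ _)).congr ?_ le_rfl
        clear ih hr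
        funext k
        cases x <;> cases y <;> simp [update_apply, hd, hd'] <;> split_ifs <;> simp_all
      · clear ih hr
        funext k
        simp only [update_apply, hd, hd', if_false]
        simp [encodeStr_cons]
        split_ifs <;> simp_all

/-- Compare the string coded on `l` with `i`: the code is moved to `l'`, and `ne` becomes nonempty
if the strings differ. -/
def cmp (l l' i i' ne : K) : Cmd K ora :=
  (cmpLoop l l' i i' ne).seq <|
  (pop i fun o => o.elim skip fun y => (push i y).seq (push ne true)).seq (move i' i)

theorem runs_cmp {l l' i i' ne : K} (hd : [l, l', i, i', ne].Nodup) (w rest : List Bool)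
    (s : K → List Bool) (hs : s l = encodeStr w ++ rest) (hi' : s i' = []) (hne : s ne = []) :
    ∃ er, (er = [] ↔ w = s i) ∧ er.length ≤ w.length + 1 ∧
      Runs kq A (cmp l l' i i' ne : Cmd K ora) s
        (update (update (update s l rest) l' ((encodeStr w).reverse ++ s l')) ne er)
        (2 * w.length + 1) := by
  obtain ⟨er, he, hl, hr⟩ := runs_cmpLoop (kq := kq) (A := A) (ora := ora) hd w rest s hs
  have hd' := List.nodup_reverse.mpr hd
  simp at hd hd'
  rcases hc : (s i).drop w.length with _ | ⟨y, c⟩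
  · refine ⟨er, ?_, by omega, (hr.seq (.seq (.pop (t := 0) (s' := update (update (update (update
      (update s l rest) l' ((encodeStr w).reverse ++ s l')) i []) i'
        (((s i).take w.length).reverse)) ne er) ?_) (.move ?_ _))).congr ?_ ?_⟩
    · rw [he]
      constructor
      · intro h
        have := h.length_le
        exact h.eq_of_length_le (by simpa using hc)
      · rintro rfl; exact List.prefix_rfl
    · simp [hd, hd', hc, hi', hne]
      refine (Runs.skip _).congr ?_ le_rfl
      funext k
      simp only [update_apply, hd, hd', if_false]
      split_ifs <;> first | rfl | simp_all
    · exact hd'.2.1.1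
    · have : (s i).take w.length = s i := List.take_of_length_le (by simpa using hc)
      clear hr he
      funext k
      simp only [update_apply, hd, hd', if_false, if_true, this]
      simp
      split_ifs <;> simp_all
    · simp [hd, hd']
      omega
  · refine ⟨true :: er, ?_, by simp; omega, (hr.seq (.seq (.pop (t := 0) (s' := update (update
      (update (update (update s l rest) l' ((encodeStr w).reverse ++ s l')) i (y :: c)) i'
        (((s i).take w.length).reverse)) ne (true :: er)) ?_) (.move ?_ _))).congr ?_ ?_⟩
    · simp
      rintro rfl
      simp at hc
    · simp [hd, hd', hc, hi', hne]
      refine (Runs.seq (.push _ _ _) (.push _ _ _)).congr ?_ le_rfl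
      clear hr he
      funext k
      simp only [update_apply, hd, hd', if_false]
      split_ifs <;> first | rfl | simp_all
    · exact hd'.2.1.1
    · have : (s i).take w.length ++ y :: c = s i := by rw [← hc, List.take_append_drop]
      clear hr he
      funext k
      simp only [update_apply, hd, hd', if_false, if_true]
      simp [this]
      split_ifs <;> simp_all
    · simp [hd, hd']
      omega

end Cmd

/-! ### The registers of the verifier -/

/-- The stacks of the verifier. -/
inductive VReg
  | z | y | f | n | d | b | e | r | l | l2 | i | i2 | p | q | u | p2 | a2 | acc | s | cy | m | ne | fo | err | x | w
  deriving DecidableEq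

instance : Fintype VReg :=
  ⟨⟨([.z, .y, .f, .n, .d, .b, .e, .r, .l, .l2, .i, .i2, .p, .q, .u, .p2, .a2, .acc, .s, .cy, .m, .ne, .fo, .err, .x, .w] : List VReg), by decide⟩, fun k => by cases k <;> decide⟩

/-- The contents of the stacks of the verifier. -/
structure VState where
  z : List Bool := []
  y : List Bool := []
  f : List Bool := []
  n : List Bool := []
  d : List Bool := []
  b : List Bool := []
  e : List Bool := []
  r : List Bool := []
  l : List Bool := []
  l2 : List Bool := []
  i : List Bool := []
  i2 : List Bool := []
  p : List Bool := []
  q : List Bool := []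
  u : List Bool := []
  p2 : List Bool := []
  a2 : List Bool := []
  acc : List Bool := []
  s : List Bool := []
  cy : List Bool := []
  m : List Bool := []
  ne : List Bool := []
  fo : List Bool := []
  err : List Bool := []
  x : List Bool := []
  w : List Bool := []

namespace VState

/-- The content of a stack. -/
def store (v : VState) : VReg → List Bool
  | .z => v.z
  | .y => v.y
  | .f => v.f
  | .n => v.n
  | .d => v.d
  | .b => v.b
  | .e => v.e
  | .r => v.r
  | .l => v.l
  | .l2 => v.l2
  | .i => v.i
  | .i2 => v.i2
  | .p => v.p
  | .q => v.q
  | .u => v.u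
  | .p2 => v.p2
  | .a2 => v.a2
  | .acc => v.acc
  | .s => v.s
  | .cy => v.cy
  | .m => v.m
  | .ne => v.ne
  | .fo => v.fo
  | .err => v.err
  | .x => v.x
  | .w => v.w

/-- Replace the content of a stack. -/
def set (v : VState) (k : VReg) (l : List Bool) : VState :=
  match k with
  | .z => { v with z := l }
  | .y => { v with y := l }
  | .f => { v with f := l }
  | .n => { v with n := l }
  | .d => { v with d := l }
  | .b => { v with b := l }
  | .e => { v with e := l }
  | .r => { v with r := l }
  | .l => { v with l := l }
  | .l2 => { v with l2 := l }
  | .i => { v with i := l }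
  | .i2 => { v with i2 := l }
  | .p => { v with p := l }
  | .q => { v with q := l }
  | .u => { v with u := l }
  | .p2 => { v with p2 := l }
  | .a2 => { v with a2 := l }
  | .acc => { v with acc := l }
  | .s => { v with s := l }
  | .cy => { v with cy := l }
  | .m => { v with m := l }
  | .ne => { v with ne := l }
  | .fo => { v with fo := l }
  | .err => { v with err := l }
  | .x => { v with x := l }
  | .w => { v with w := l }

theorem update_store (v : VState) (k : VReg) (l : List Bool) :
    update v.store k l = (v.set k l).store := by
  funext j
  by_cases h : j = k
  · subst h
    rw [update_self]
    cases j <;> rfl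
  · rw [update_of_ne h]
    cases k <;> cases j <;> first | rfl | exact absurd rfl h

end VState

/-- Programs of the verifier. -/
abbrev VCmd : Type := Cmd VReg False

/-- `c` leads from `v` to `v'` with at most `t` iterations of loops. -/
def VRuns (c : VCmd) (v v' : VState) (t : ℕ) : Prop :=
  Cmd.Runs VReg.z (fun _ => False) c v.store v'.store t

namespace VRuns

theorem of_runs {c : VCmd} {v v' : VState} {s t t'}
    (h : Cmd.Runs VReg.z (fun _ => False) c v.store s t) (hs : v'.store = s) (ht : t ≤ t') :
    VRuns c v v' t' := h.congr hs ht

theorem mono {c : VCmd} {v v' : VState} {t t'} (h : VRuns c v v' t) (ht : t ≤ t') :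
    VRuns c v v' t' := Cmd.Runs.mono h ht

theorem skip (v : VState) : VRuns .skip v v 0 := Cmd.Runs.skip _

theorem push (k : VReg) (b : Bool) (v : VState) :
    VRuns (.push k b) v (v.set k (b :: v.store k)) 0 :=
  of_runs (.push k b _) (by rw [VState.update_store]) le_rfl

theorem seq {c d : VCmd} {v v₁ v₂ : VState} {t₁ t₂} (h₁ : VRuns c v v₁ t₁)
    (h₂ : VRuns d v₁ v₂ t₂) : VRuns (c.seq d) v v₂ (t₁ + t₂) := Cmd.Runs.seq h₁ h₂

theorem push_seq {k : VReg} {b : Bool} {d : VCmd} {v v' : VState} {t}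
    (h : VRuns d (v.set k (b :: v.store k)) v' t) : VRuns ((Cmd.push k b).seq d) v v' t :=
  ((push k b v).seq h).mono (by simp)

theorem pop {k : VReg} {f : Option Bool → VCmd} {v v' : VState} {t}
    (h : VRuns (f (v.store k).head?) (v.set k (v.store k).tail) v' t) :
    VRuns (.pop k f) v v' t := by
  refine Cmd.Runs.pop ?_
  rw [VState.update_store]
  exact h

theorem loop_nil {k : VReg} (brk) (f : Bool → VCmd) {v : VState} (hk : v.store k = []) :
    VRuns (.loop k brk f) v v 0 := Cmd.Runs.loop_nil _ _ hk

theorem loop_brk {k : VReg} {brk} {f : Bool → VCmd} {v : VState} {b l v' t} (hk : v.store k = b :: l)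
    (hb : brk b = true) (h : VRuns (f b) (v.set k l) v' t) :
    VRuns (.loop k brk f) v v' (t + 1) :=
  Cmd.Runs.loop_brk hk hb (by rw [VState.update_store]; exact h)

theorem loop_step {k : VReg} {brk} {f : Bool → VCmd} {v v₁ v₂ : VState} {b l t₁ t₂}
    (hk : v.store k = b :: l) (hb : brk b = false) (h₁ : VRuns (f b) (v.set k l) v₁ t₁)
    (h₂ : VRuns (.loop k brk f) v₁ v₂ t₂) :
    VRuns (.loop k brk f) v v₂ (t₁ + t₂ + 1) :=
  Cmd.Runs.loop_step hk hb (by rw [VState.update_store]; exact h₁) h₂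

end VRuns

/-! ### The literals of a formula -/

/-- An occurrence of a literal: the index of the variable, whether no value of the variable has been
seen, whether the occurrence is selected, and the sign. -/
structure Lit where
  idx : ℕ
  alive : Bool
  sel : Bool
  sign : Bool

/-- The code of an occurrence of a literal. -/
def Lit.code (ρ : Lit) : List Bool :=
  encodeStr (Computability.encodeNat ρ.idx).reverse ++ [ρ.alive, ρ.sel, ρ.sign]

/-- The code of a list of occurrences of literals. -/
def litCode (L : List Lit) : List Bool := L.flatMap Lit.code

/-- The size of the encoding of an assignment to the literals in `L`. -/
def ruler (L : List Lit) : ℕ :=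
  (L.map fun ρ => 7 + 2 * (Computability.encodeNat ρ.idx).length).sum

/-- The state of the selection of a monomial of a formula: the choices to be made, the literals met
so far, and whether the constant `0` has not been selected. -/
structure Walk where
  choices : List Bool
  lits : List Lit
  ok : Bool

/-- Traverse a formula, selecting one argument of each selected disjunction, if the formula is
selected. -/
def walk : NNF ℕ → Bool → Walk → Walk
  | .bot, g, σ => { σ with ok := !g && σ.ok }
  | .top, _, σ => σ
  | .pos i, g, σ => { σ with lits := ⟨i, true, g, true⟩ :: σ.lits }
  | .neg i, g, σ => { σ with lits := ⟨i, true, g, false⟩ :: σ.lits }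
  | .or α β, true, σ => walk β (!σ.choices.head?.getD false)
      (walk α (σ.choices.head?.getD false) { σ with choices := σ.choices.tail })
  | .or α β, false, σ => walk β false (walk α false σ)
  | .and α β, g, σ => walk β g (walk α g σ)

namespace Cmd

/-- Push `n` times `true` onto `r`. -/
def pushTrue {K : Type} {ora : Prop} (r : K) : ℕ → Cmd K ora
  | 0 => skip
  | n + 1 => (push r true).seq (pushTrue r n)

/-- Read the index of a variable. -/
def readIndex : VCmd :=
  loop .z (fun b => !b) fun b => bif b then
    pop .z fun o => (push .l (o.getD false)).seq <| (push .l true).seq (pushTrue .r 2) else skip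

/-- Read a node of the formula. -/
def readNode (g : Bool) : VCmd :=
  pop .z fun o => bif o.getD false then
    pop .z fun o => bif o.getD false then (push .f g).seq (push .f g)
      else bif g then pop .y fun o => (push .f (!o.getD false)).seq (push .f (o.getD false))
      else (push .f false).seq (push .f false)
  else
    pop .z fun o => bif o.getD false then
      pop .z fun o => (push .l (o.getD false)).seq <| (push .l g).seq <| (push .l true).seq <|
        (push .l false).seq <| readIndex.seq (pushTrue .r 7)
      else pop .z fun o => bif g && !o.getD false then erase .n else skip

/-- Read the formula and select a monomial. -/
def readFormula : VCmd := loop .f (fun _ => false) readNode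

end Cmd

/-- The state of the selection on the stacks. -/
def VState.withWalk (v : VState) (σ : Walk) : VState :=
  { v with y := σ.choices, l := litCode σ.lits, r := List.replicate (ruler σ.lits) true,
           n := carry σ.ok }

theorem runs_pushTrue_r (n : ℕ) (v : VState) :
    VRuns (Cmd.pushTrue .r n) v { v with r := List.replicate n true ++ v.r } 0 := by
  induction n generalizing v with
  | zero => exact .skip _
  | succ n ih =>
    refine VRuns.push_seq ?_
    have := ih (v.set .r (true :: v.store .r))
    rw [List.replicate_succ', List.append_assoc]
    exact this



/-- Copying by pushes reverses the index, which is why `Lit.code` contains the reversed numeral. The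
two units put on `r` for each digit build up the ruler along the way. The accumulator `w'` is what
the induction needs. -/
theorem runs_readIndex (w w' rest l : List Bool) (v : VState) :
    VRuns Cmd.readIndex { v with z := encodeStr w ++ rest, l := encodeStr w' ++ l }
      { v with z := rest, l := encodeStr (w.reverse ++ w') ++ l,
               r := List.replicate (2 * w.length) true ++ v.r } (w.length + 1) := by
  induction w generalizing v w' with
  | nil => exact VRuns.loop_brk (l := rest) rfl rfl (.skip _)
  | cons b w ih =>
    have hb : VRuns (Cmd.pop .z fun o => (Cmd.push .l (o.getD false)).seq <|
        (Cmd.push .l true).seq (Cmd.pushTrue .r 2))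
        { v with z := b :: (encodeStr w ++ rest), l := encodeStr w' ++ l }
        { v with z := encodeStr w ++ rest, l := encodeStr (b :: w') ++ l, r := true :: true :: v.r }
        0 := by
      refine VRuns.pop ?_
      refine VRuns.push_seq ?_
      refine VRuns.push_seq ?_
      exact runs_pushTrue_r 2 _
    have := (VRuns.loop_step (brk := fun b => !b) (l := b :: (encodeStr w ++ rest)) (b := true)
      (v := { v with z := encodeStr (b :: w) ++ rest, l := encodeStr w' ++ l })
      rfl rfl hb (ih (b :: w') { v with r := true :: true :: v.r })).mono
        (t' := (b :: w).length + 1) (by simp)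
    have e : List.replicate (2 * (b :: w).length) true ++ v.r =
        List.replicate (2 * w.length) true ++ true :: true :: v.r := by
      rw [List.length_cons, mul_add, List.replicate_add, List.append_assoc]
      rfl
    rw [e, List.reverse_cons, List.append_assoc]
    exact this

theorem runs_readNode_lit (g sg : Bool) (σ : Walk) (i : ℕ) (rest F : List Bool) (v : VState) :
    VRuns (Cmd.readNode g)
      { v.withWalk σ with z := [false, true, sg] ++ encodeBin i ++ rest, f := F }
      { v.withWalk { σ with lits := ⟨i, true, g, sg⟩ :: σ.lits } with z := rest, f := F }
      ((Computability.encodeNat i).length + 1) := by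
  have h := (runs_readIndex (Computability.encodeNat i) [] rest
    (true :: g :: sg :: litCode σ.lits) { v.withWalk σ with f := F }).seq (runs_pushTrue_r 7 _)
  have e : List.replicate (ruler (⟨i, true, g, sg⟩ :: σ.lits)) true =
      List.replicate 7 true ++ (List.replicate (2 * (Computability.encodeNat i).length) true ++
      List.replicate (ruler σ.lits) true) := by
    simp only [ruler, List.map_cons, List.sum_cons, List.replicate_add, List.append_assoc]
  have e' : litCode (⟨i, true, g, sg⟩ :: σ.lits) =
      encodeStr ((Computability.encodeNat i).reverse ++ []) ++
        (true :: g :: sg :: litCode σ.lits) := by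
    simp [litCode, Lit.code]
  unfold VState.withWalk
  rw [e, e']
  refine VRuns.pop ?_
  refine VRuns.pop ?_
  refine VRuns.pop ?_
  refine VRuns.push_seq ?_
  refine VRuns.push_seq ?_
  refine VRuns.push_seq ?_
  refine VRuns.push_seq ?_
  exact h

/-- The stack `f` replaces recursion: it holds one selection flag for every subformula that is still
to be read. Quantifying over the continuation of the run lets the hypotheses for the two subformulas
be chained directly. Every node costs at most the length of its own code. -/
theorem runs_walk (φ : NNF ℕ) : ∀ (g : Bool) (σ : Walk) (rest F : List Bool) (v v' : VState) (t : ℕ),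
    VRuns Cmd.readFormula { v.withWalk (walk φ g σ) with z := rest, f := F } v' t →
    VRuns Cmd.readFormula { v.withWalk σ with z := encodeNNF φ ++ rest, f := g :: F } v'
      (t + (encodeNNF φ).length) := by
  have step : ∀ {g : Bool} {v v₁ v' : VState} {t₁ t₂ : ℕ} {F : List Bool},
      v.f = g :: F → VRuns (Cmd.readNode g) { v with f := F } v₁ t₁ →
      VRuns Cmd.readFormula v₁ v' t₂ → VRuns Cmd.readFormula v v' (t₁ + t₂ + 1) :=
    fun hf h₁ h₂ => VRuns.loop_step hf rfl h₁ h₂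
  induction φ with
  | bot =>
    intro g σ rest F v v' t h
    have hb : VRuns (Cmd.readNode g) { v.withWalk σ with z := [false, false, false] ++ rest, f := F }
        { v.withWalk (walk .bot g σ) with z := rest, f := F } 1 := by
      refine VRuns.pop ?_
      refine VRuns.pop ?_
      refine VRuns.pop ?_
      cases g with
      | false => exact (VRuns.skip _).mono (Nat.zero_le _)
      | true =>
        refine .of_runs (Cmd.Runs.erase _ _) (by rw [VState.update_store]; rfl) ?_
        change (carry σ.ok).length ≤ 1
        cases σ.ok <;> simp
    exact (step rfl hb h).mono (by simp [encodeNNF]; omega)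
  | top =>
    intro g σ rest F v v' t h
    have hb : VRuns (Cmd.readNode g) { v.withWalk σ with z := [false, false, true] ++ rest, f := F }
        { v.withWalk σ with z := rest, f := F } 0 := by
      refine VRuns.pop ?_
      refine VRuns.pop ?_
      refine VRuns.pop ?_
      cases g <;> exact VRuns.skip _
    exact (step rfl hb h).mono (by simp [encodeNNF])
  | pos i =>
    intro g σ rest F v v' t h
    exact (step rfl (runs_readNode_lit g true σ i rest F v) h).mono
      (by simp [encodeNNF, encodeBin]; omega)
  | neg i =>
    intro g σ rest F v v' t h
    exact (step rfl (runs_readNode_lit g false σ i rest F v) h).mono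
      (by simp [encodeNNF, encodeBin]; omega)
  | or α β ihα ihβ =>
    intro g σ rest F v v' t h
    have e : encodeNNF (.or α β) ++ rest =
        [true, false] ++ (encodeNNF α ++ (encodeNNF β ++ rest)) := by simp [encodeNNF]
    rw [e]
    cases g with
    | false =>
      have hb : VRuns (Cmd.readNode false)
          { v.withWalk σ with z := [true, false] ++ (encodeNNF α ++ (encodeNNF β ++ rest)), f := F }
          { v.withWalk σ with z := encodeNNF α ++ (encodeNNF β ++ rest), f := false :: false :: F }
          0 := by
        refine VRuns.pop ?_
        refine VRuns.pop ?_
        refine VRuns.push_seq ?_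
        exact VRuns.push _ _ _
      exact (step rfl hb (ihα _ σ _ _ v v' _ (ihβ _ _ rest F v v' _ h))).mono
        (by simp [encodeNNF]; omega)
    | true =>
      have hb : VRuns (Cmd.readNode true)
          { v.withWalk σ with z := [true, false] ++ (encodeNNF α ++ (encodeNNF β ++ rest)), f := F }
          { v.withWalk { σ with choices := σ.choices.tail } with
              z := encodeNNF α ++ (encodeNNF β ++ rest),
              f := σ.choices.head?.getD false :: (!σ.choices.head?.getD false) :: F } 0 := by
        refine VRuns.pop ?_
        refine VRuns.pop ?_
        refine VRuns.pop ?_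
        refine VRuns.push_seq ?_
        exact VRuns.push _ _ _
      exact (step rfl hb (ihα _ _ _ _ v v' _ (ihβ _ _ rest F v v' _ h))).mono
        (by simp [encodeNNF]; omega)
  | and α β ihα ihβ =>
    intro g σ rest F v v' t h
    have e : encodeNNF (.and α β) ++ rest =
        [true, true] ++ (encodeNNF α ++ (encodeNNF β ++ rest)) := by simp [encodeNNF]
    rw [e]
    have hb : VRuns (Cmd.readNode g)
        { v.withWalk σ with z := [true, true] ++ (encodeNNF α ++ (encodeNNF β ++ rest)), f := F }
        { v.withWalk σ with z := encodeNNF α ++ (encodeNNF β ++ rest), f := g :: g :: F } 0 := by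
      refine VRuns.pop ?_
      refine VRuns.pop ?_
      refine VRuns.push_seq ?_
      exact VRuns.push _ _ _
    exact (step rfl hb (ihα _ σ _ _ v v' _ (ihβ _ _ rest F v v' _ h))).mono
      (by simp [encodeNNF]; omega)

/-! ### Substituting a value for a variable -/

namespace Lit

/-- The occurrence `ρ` belongs to the variable with the code `I` and its value has not been seen. -/
def hit (I : List Bool) (ρ : Lit) : Bool :=
  ρ.alive && decide (Computability.encodeNat ρ.idx = I)

/-- Mark that the value of the variable with the code `I` has been seen. -/
def kill (I : List Bool) (ρ : Lit) : Lit := { ρ with alive := ρ.alive && !ρ.hit I }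

/-- The contribution of `ρ` to the numerator when the variable with the code `I` takes the value
`P / (P + U)`. -/
def num (I : List Bool) (P U : ℕ) (ρ : Lit) : ℕ :=
  bif ρ.hit I && ρ.sel then (bif ρ.sign then P else U) else 1

/-- The contribution of `ρ` to the denominator when the variable with the code `I` takes a value with
denominator `Q`. -/
def den (I : List Bool) (Q : ℕ) (ρ : Lit) : ℕ := bif ρ.hit I && ρ.sel then Q else 1

end Lit

/-- The number of occurrences without a value. -/
def aliveCount (L : List Lit) : ℕ := L.countP Lit.alive

namespace Cmd

/-- Multiply the numerator and the denominator by those of the value of a literal. -/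
def mulValue (sg : Bool) : VCmd :=
  (bif sg then mul .p .p2 .n .a2 .acc .s .cy else mul .u .p2 .n .a2 .acc .s .cy).seq
    (mul .q .p2 .d .a2 .acc .s .cy)

/-- Put an occurrence of a literal back; on a hit the value of the literal is taken into account. -/
def scanBranch (hit al se sg : Bool) : VCmd :=
  bif hit then
    (push .l2 false).seq <| (push .l2 se).seq <| (push .l2 sg).seq <|
    (push .fo true).seq <| bif se then mulValue sg else skip
  else
    (push .l2 al).seq <| (push .l2 se).seq <| (push .l2 sg).seq (erase .ne)

/-- Compare an occurrence of a literal with the variable on `i`. -/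
def scanStep (g : Bool) : VCmd :=
  (push .l g).seq <| (cmp .l .l2 .i .i2 .ne).seq <|
  pop .l fun al => pop .l fun se => pop .l fun sg => pop .ne fun o =>
    scanBranch (al.getD false && o.isNone) (al.getD false) (se.getD false) (sg.getD false)

/-- Compare all occurrences of literals with the variable on `i`. -/
def scan : VCmd := loop .l (fun _ => false) scanStep

end Cmd

/-- The auxiliary stacks are empty. -/
structure VState.Clean (v : VState) : Prop where
  i2 : v.i2 = []
  p2 : v.p2 = []
  a2 : v.a2 = []
  acc : v.acc = []
  s : v.s = []
  cy : v.cy = []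
  ne : v.ne = []
  x : v.x = []
  w : v.w = []
  m : v.m = []

theorem runs_mulValue (sg : Bool) (v : VState) (hv : v.Clean) (R M : ℕ) (hp : v.p.length ≤ R)
    (hu : v.u.length ≤ R) (hq : v.q.length ≤ R) (hn : v.n.length + 2 * R ≤ M)
    (hd : v.d.length + 2 * R ≤ M) :
    ∃ n' d', bval n' = bval v.n * (bif sg then bval v.p.reverse else bval v.u.reverse) ∧
      bval d' = bval v.d * bval v.q.reverse ∧ n'.length ≤ v.n.length + 2 * R ∧
      d'.length ≤ v.d.length + 2 * R ∧
      VRuns (Cmd.mulValue sg) v { v with n := n', d := d' } (2 * (R * (5 * M + 9) + 3 * M)) := by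
  have cost : ∀ a b : ℕ, a ≤ R → b + 2 * R ≤ M →
      a * (5 * (b + 2 * a) + 9) + 3 * b ≤ R * (5 * M + 9) + 3 * M := by
    intro a b ha hb
    have := Nat.mul_le_mul ha (show 5 * (b + 2 * a) + 9 ≤ 5 * M + 9 by omega)
    omega
  have h₁ : ∃ n', bval n' = bval v.n * (bif sg then bval v.p.reverse else bval v.u.reverse) ∧
      n'.length ≤ v.n.length + 2 * R ∧
      VRuns (bif sg then Cmd.mul .p .p2 .n .a2 .acc .s .cy else Cmd.mul .u .p2 .n .a2 .acc .s .cy) v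
        { v with n := n' } (R * (5 * M + 9) + 3 * M) := by
    cases sg with
    | true =>
      obtain ⟨n', h1, h2, h3⟩ := Cmd.Runs.mul (ora := False) (kq := VReg.z) (A := fun _ => False)
        (p := VReg.p) (p' := .p2) (a := .n) (a' := .a2) (acc := .acc) (r := .s) (cy := .cy)
        (by decide) v.store hv.p2 hv.a2 hv.acc hv.s hv.cy
      exact ⟨n', h1.trans (mul_comm _ _), h2.trans (by simp only [VState.store]; omega),
        .of_runs h3 (by rw [VState.update_store]; rfl) (cost _ _ hp hn)⟩
    | false =>
      obtain ⟨n', h1, h2, h3⟩ := Cmd.Runs.mul (ora := False) (kq := VReg.z) (A := fun _ => False)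
        (p := VReg.u) (p' := .p2) (a := .n) (a' := .a2) (acc := .acc) (r := .s) (cy := .cy)
        (by decide) v.store hv.p2 hv.a2 hv.acc hv.s hv.cy
      exact ⟨n', h1.trans (mul_comm _ _), h2.trans (by simp only [VState.store]; omega),
        .of_runs h3 (by rw [VState.update_store]; rfl) (cost _ _ hu hn)⟩
  obtain ⟨n', h1, h2, h3⟩ := h₁
  obtain ⟨d', h4, h5, h6⟩ := Cmd.Runs.mul (ora := False) (kq := VReg.z) (A := fun _ => False)
    (p := VReg.q) (p' := .p2) (a := .d) (a' := .a2) (acc := .acc) (r := .s) (cy := .cy)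
    (by decide) (VState.store { v with n := n' }) hv.p2 hv.a2 hv.acc hv.s hv.cy
  refine ⟨n', d', h1, h4.trans (mul_comm _ _), h2, h5.trans (by simp only [VState.store]; omega),
    (h3.seq (.of_runs h6 (by rw [VState.update_store]; rfl) (cost _ _ hq hd))).mono (by omega)⟩

/-- A bound for the cost of one step of the scan. -/
def scanCost (R M : ℕ) : ℕ := 2 * (R * (5 * M + 9) + 3 * M) + 3 * R + 3

/-- The quantity length plus `2 * R` times the number of alive occurrences is a potential: a
multiplication lengthens numerator and denominator by at most `2 * R`, and it happens only when an
alive occurrence dies. The lengths thus stay bounded over all entries of an assignment together. -/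
theorem runs_scanStep (I : List Bool) (ρ : Lit) (l : List Bool) (v : VState) (hv : v.Clean)
    (hI : v.i = I.reverse) (R M : ℕ) (hp : v.p.length ≤ R)
    (hu : v.u.length ≤ R) (hq : v.q.length ≤ R) (hρ : (Computability.encodeNat ρ.idx).length ≤ R)
    (hn : v.n.length + 2 * R * (aliveCount [ρ]) ≤ M)
    (hd : v.d.length + 2 * R * (aliveCount [ρ]) ≤ M) {g : Bool} {tl : List Bool}
    (htl : ρ.code ++ l = g :: tl) :
    ∃ n' d', bval n' = bval v.n * ρ.num I (bval v.p.reverse) (bval v.u.reverse) ∧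
      bval d' = bval v.d * ρ.den I (bval v.q.reverse) ∧
      n'.length + 2 * R * aliveCount [ρ.kill I] ≤ v.n.length + 2 * R * aliveCount [ρ] ∧
      d'.length + 2 * R * aliveCount [ρ.kill I] ≤ v.d.length + 2 * R * aliveCount [ρ] ∧
      VRuns (Cmd.scanStep g) { v with l := tl }
        { v with l := l, l2 := (ρ.kill I).code.reverse ++ v.l2, n := n', d := d',
                 fo := carry (ρ.hit I) ++ v.fo } (scanCost R M - 1) := by
  obtain ⟨ne, h1, h2, h3⟩ := Cmd.runs_cmp (ora := False) (kq := VReg.z) (A := fun _ => False)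
    (l := VReg.l) (l' := .l2) (i := .i) (i' := .i2) (ne := .ne) (by decide)
    (Computability.encodeNat ρ.idx).reverse ([ρ.alive, ρ.sel, ρ.sign] ++ l)
    (VState.store { v with l := ρ.code ++ l })
    (show ρ.code ++ l = _ by simp [Lit.code]) hv.i2 hv.ne
  have h3' : VRuns (Cmd.cmp .l .l2 .i .i2 .ne) { v with l := ρ.code ++ l }
      { v with l := ρ.alive :: ρ.sel :: ρ.sign :: l,
               l2 := (encodeStr (Computability.encodeNat ρ.idx).reverse).reverse ++ v.l2, ne := ne }
      (2 * R + 1) :=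
    .of_runs h3 (by simp only [VState.update_store]; rfl) (by simp; omega)
  have h1' : ne = [] ↔ Computability.encodeNat ρ.idx = I := by
    rw [h1]
    change _ = v.i ↔ _
    rw [hI, List.reverse_inj]
  have key : ∃ n' d', bval n' = bval v.n * ρ.num I (bval v.p.reverse) (bval v.u.reverse) ∧
      bval d' = bval v.d * ρ.den I (bval v.q.reverse) ∧
      n'.length + 2 * R * aliveCount [ρ.kill I] ≤ v.n.length + 2 * R * aliveCount [ρ] ∧
      d'.length + 2 * R * aliveCount [ρ.kill I] ≤ v.d.length + 2 * R * aliveCount [ρ] ∧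
      VRuns (Cmd.scanBranch (ρ.alive && ne.head?.isNone) ρ.alive ρ.sel ρ.sign)
        { v with
          l := l
          l2 := (encodeStr (Computability.encodeNat ρ.idx).reverse).reverse ++ v.l2
          ne := ne.tail }
        { v with
          l := l
          l2 := (ρ.kill I).code.reverse ++ v.l2
          n := n'
          d := d'
          fo := carry (ρ.hit I) ++ v.fo } (2 * (R * (5 * M + 9) + 3 * M) + R + 1) := by
    have hcode : (ρ.kill I).code.reverse ++ v.l2 = ρ.sign :: ρ.sel :: (ρ.alive && !ρ.hit I) ::
        ((encodeStr (Computability.encodeNat ρ.idx).reverse).reverse ++ v.l2) := by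
      simp [Lit.code, Lit.kill]
    rw [hcode]
    have hne : ne.head?.isNone = decide (Computability.encodeNat ρ.idx = I) := by
      rw [← decide_eq_decide.mpr h1']
      cases ne <;> rfl
    have hnone : v.ne = [] := hv.ne
    rw [hne]
    change ∃ n' d', _ ∧ _ ∧ _ ∧ _ ∧ VRuns (Cmd.scanBranch (ρ.hit I) _ _ _) _ _ _
    rcases hh : ρ.hit I with _ | _
    · refine ⟨v.n, v.d, by simp [Lit.num, hh], by simp [Lit.den, hh], ?_, ?_, ?_⟩
      · simp [Lit.kill, hh]
      · simp [Lit.kill, hh]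
      · rw [Bool.not_false, Bool.and_true]
        refine VRuns.push_seq ?_
        refine VRuns.push_seq ?_
        refine VRuns.push_seq ?_
        refine .of_runs (Cmd.Runs.erase _ _)
          (by rw [VState.update_store]; simp only [VState.set, VState.store, carry_false, List.nil_append, hnone]) ?_
        simp only [VState.set, VState.store, List.length_tail]
        simp at h2
        omega
    · have hal : ρ.alive = true := by
        unfold Lit.hit at hh
        exact (Bool.and_eq_true_iff.mp hh).1
      have hnil : ne = [] := h1'.mpr (by simpa [Lit.hit, hal] using hh)
      have c1 : aliveCount [ρ] = 1 := by simp [aliveCount, hal]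
      have c2 : aliveCount [ρ.kill I] = 0 := by simp [aliveCount, Lit.kill, hh]
      rw [c1, mul_one] at hn hd
      rw [c1, c2]
      simp only [mul_one, mul_zero, add_zero]
      rw [hnil]
      rcases hsel : ρ.sel with _ | _
      · refine ⟨v.n, v.d, by simp [Lit.num, hsel], by simp [Lit.den, hsel], by omega, by omega, ?_⟩
        rw [Bool.not_true, Bool.and_false]
        refine VRuns.push_seq ?_
        refine VRuns.push_seq ?_
        refine VRuns.push_seq ?_
        refine VRuns.push_seq ?_
        refine .of_runs (Cmd.Runs.skip _) ?_ (Nat.zero_le _)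
        simp only [VState.set, VState.store, carry_true, List.singleton_append, hnone, List.tail_nil]
      · obtain ⟨n', d', m1, m2, m3, m4, m5⟩ := runs_mulValue ρ.sign { v with
          l := l
          l2 := ρ.sign :: true :: false ::
            ((encodeStr (Computability.encodeNat ρ.idx).reverse).reverse ++ v.l2)
          ne := []
          fo := true :: v.fo } ⟨hv.1, hv.2, hv.3, hv.4, hv.5, hv.6, rfl, hv.8, hv.9, hv.10⟩
          R M hp hu hq hn hd
        refine ⟨n', d', by simpa [Lit.num, hh, hsel] using m1, by simpa [Lit.den, hh, hsel] using m2,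
          m3, m4, ?_⟩
        rw [Bool.not_true, Bool.and_false]
        refine VRuns.push_seq ?_
        refine VRuns.push_seq ?_
        refine VRuns.push_seq ?_
        refine VRuns.push_seq ?_
        refine .of_runs m5 ?_ (by omega)
        simp only [VState.set, VState.store, carry_true, List.singleton_append, hnone, List.tail_nil]
  obtain ⟨n', d', k1, k2, k3, k4, k5⟩ := key
  refine ⟨n', d', k1, k2, k3, k4, ?_⟩
  refine VRuns.push_seq ?_
  -- The enclosing loop has popped the first bit of the code in order to test for emptiness; it is
  -- put back before the comparison.
  have e : VState.set { v with l := tl } .l (g :: tl) = { v with l := ρ.code ++ l } := by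
    rw [htl]; rfl
  change VRuns _ (VState.set { v with l := tl } .l (g :: tl)) _ _
  rw [e]
  refine (h3'.seq ?_).mono (t := 2 * R + 1 + (2 * (R * (5 * M + 9) + 3 * M) + R + 1)) ?_
  · refine VRuns.pop ?_
    refine VRuns.pop ?_
    refine VRuns.pop ?_
    refine VRuns.pop ?_
    exact k5
  · unfold scanCost
    omega

theorem runs_scan (I : List Bool) (L : List Lit) (v : VState) (hv : v.Clean)
    (hI : v.i = I.reverse) (hl : v.l = litCode L) (R M : ℕ) (hp : v.p.length ≤ R)
    (hu : v.u.length ≤ R) (hq : v.q.length ≤ R)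
    (hL : ∀ ρ ∈ L, (Computability.encodeNat ρ.idx).length ≤ R)
    (hn : v.n.length + 2 * R * aliveCount L ≤ M) (hd : v.d.length + 2 * R * aliveCount L ≤ M) :
    ∃ n' d' fo', bval n' = bval v.n * (L.map (Lit.num I (bval v.p.reverse) (bval v.u.reverse))).prod ∧
      bval d' = bval v.d * (L.map (Lit.den I (bval v.q.reverse))).prod ∧
      n'.length + 2 * R * aliveCount (L.map (Lit.kill I)) ≤ v.n.length + 2 * R * aliveCount L ∧
      d'.length + 2 * R * aliveCount (L.map (Lit.kill I)) ≤ v.d.length + 2 * R * aliveCount L ∧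
      (fo' = [] ↔ v.fo = [] ∧ ∀ ρ ∈ L, ρ.hit I = false) ∧ fo'.length ≤ v.fo.length + L.length ∧
      VRuns Cmd.scan v
        { v with
          l := []
          l2 := (litCode (L.map (Lit.kill I))).reverse ++ v.l2
          n := n'
          d := d'
          fo := fo' } (L.length * scanCost R M) := by
  induction L generalizing v with
  | nil =>
    refine ⟨v.n, v.d, v.fo, by simp, by simp, by simp, by simp, by simp, by simp, ?_⟩
    refine .of_runs (Cmd.Runs.loop_nil _ _ hl) ?_ (by simp)
    congr 1
    rw [← show v.l = [] from hl]
    rfl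
  | cons ρ L ih =>
    have e : ∀ ρ L, aliveCount (ρ :: L) = aliveCount [ρ] + aliveCount L := fun ρ L => by
      simp only [aliveCount, List.countP_cons, List.countP_nil]; omega
    have hc : litCode (ρ :: L) = ρ.code ++ litCode L := rfl
    rw [e, mul_add] at hn hd
    obtain ⟨g, tl, htl⟩ : ∃ g tl, ρ.code ++ litCode L = g :: tl := by
      rcases h : ρ.code ++ litCode L with _ | ⟨g, tl⟩
      · simp [Lit.code] at h
      · exact ⟨g, tl, rfl⟩
    obtain ⟨n₁, d₁, a1, a2, a3, a4, a5⟩ := runs_scanStep I ρ (litCode L) v hv hI R M hp hu hq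
      (hL ρ (by simp)) (by omega) (by omega) htl
    obtain ⟨n₂, d₂, fo₂, b1, b2, b3, b4, b5, b6, b7⟩ := ih
      { v with
        l := litCode L
        l2 := (ρ.kill I).code.reverse ++ v.l2
        n := n₁
        d := d₁
        fo := carry (ρ.hit I) ++ v.fo }
      ⟨hv.1, hv.2, hv.3, hv.4, hv.5, hv.6, hv.7, hv.8, hv.9, hv.10⟩ hI rfl hp hu hq
      (fun ρ h => hL ρ (by simp [h])) (show n₁.length + _ ≤ _ by omega)
      (show d₁.length + _ ≤ _ by omega)
    refine ⟨n₂, d₂, fo₂, ?_, ?_, ?_, ?_, ?_, ?_, ?_⟩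
    · rw [b1, a1, List.map_cons, List.prod_cons, mul_assoc]
    · rw [b2, a2, List.map_cons, List.prod_cons, mul_assoc]
    · rw [List.map_cons, e (ρ.kill I) (L.map _), e ρ L, mul_add, mul_add]
      change _ ≤ n₁.length + _ at b3
      omega
    · rw [List.map_cons, e (ρ.kill I) (L.map _), e ρ L, mul_add, mul_add]
      change _ ≤ d₁.length + _ at b4
      omega
    · rw [b5]
      cases h : ρ.hit I <;> simp [h]
    · refine b6.trans ?_
      cases h : ρ.hit I <;> simp <;> omega
    · refine .of_runs (VRuns.loop_step (b := g) (l := tl) (by rw [← htl, ← hc, ← hl]; rfl) rfl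
        a5 b7) ?_ ?_
      · simp [litCode]
      · rw [List.length_cons, add_mul]
        have : 1 ≤ scanCost R M := by unfold scanCost; omega
        omega

/-! ### Binary numerals -/

theorem bval_encodePosNum (n : PosNum) : bval (Computability.encodePosNum n) = n := by
  induction n with
  | one => rfl
  | bit0 n ih => simp [Computability.encodePosNum, ih]; ring
  | bit1 n ih => simp [Computability.encodePosNum, ih]; ring

@[simp] theorem bval_encodeNat (n : ℕ) : bval (Computability.encodeNat n) = n := by
  unfold Computability.encodeNat
  rcases h : (n : Num) with _ | m
  · have := congrArg (Nat.cast (R := ℕ)) (rfl : n = n)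
    have h' : ((n : Num) : ℕ) = ((0 : Num) : ℕ) := by rw [h]; rfl
    simpa [Computability.encodeNum] using h'.symm
  · have h' : ((n : Num) : ℕ) = ((Num.pos m : Num) : ℕ) := by rw [h]
    rw [Num.to_of_nat] at h'
    rw [Computability.encodeNum, bval_encodePosNum, h']
    rfl

theorem getLast?_encodePosNum (n : PosNum) :
    (Computability.encodePosNum n).getLast? = some true := by
  induction n with
  | one => rfl
  | bit0 n ih => simp [Computability.encodePosNum, List.getLast?_cons, ih]
  | bit1 n ih => simp [Computability.encodePosNum, List.getLast?_cons, ih]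

theorem getLast?_encodeNat (n : ℕ) : (Computability.encodeNat n).getLast? ≠ some false := by
  unfold Computability.encodeNat
  rcases (n : Num) with _ | m
  · simp [Computability.encodeNum]
  · simp [Computability.encodeNum, getLast?_encodePosNum]

/-- Numerals without a leading zero, which here would be the last entry of the list, are unique: a
nonempty one has positive value, so two with equal value must end at the same place. -/
theorem eq_of_bval_eq {v w : List Bool} (hv : v.getLast? ≠ some false) (hw : w.getLast? ≠ some false)
    (h : bval v = bval w) : v = w := by
  have pos : ∀ w : List Bool, w ≠ [] → w.getLast? ≠ some false → 0 < bval w := by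
    intro w
    induction w with
    | nil => simp
    | cons b w ih =>
      intro _ hw
      rcases w with _ | ⟨c, w⟩
      · cases b <;> simp at hw ⊢
      · have := ih (by simp) (by simpa [List.getLast?_cons] using hw)
        simp only [bval_cons] at this ⊢
        omega
  induction v generalizing w with
  | nil =>
    rcases w with _ | ⟨c, w⟩
    · rfl
    · have := pos (c :: w) (by simp) hw
      simp [← h] at this
  | cons b v ih =>
    rcases w with _ | ⟨c, w⟩
    · have := pos (b :: v) (by simp) hv
      simp [h] at this
    · have tail : ∀ (b : Bool) (v : List Bool), (b :: v).getLast? ≠ some false →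
          v.getLast? ≠ some false := by
        intro b v h
        rcases v with _ | ⟨c, v⟩
        · simp
        · simpa [List.getLast?_cons] using h
      simp only [bval_cons] at h
      obtain rfl : b = c := by cases b <;> cases c <;> simp at h ⊢ <;> omega
      rw [ih (tail b v hv) (tail b w hw) (by omega)]

/-- A digit string that survives `checkTop` is therefore the canonical numeral of its value, so that
accepted strings are literally encodings of assignments. -/
theorem encodeNat_bval {w : List Bool} (hw : w.getLast? ≠ some false) :
    Computability.encodeNat (bval w) = w :=
  eq_of_bval_eq (getLast?_encodeNat _) hw (bval_encodeNat _)

theorem encodeNat_injective : Injective Computability.encodeNat :=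
  LeftInverse.injective bval_encodeNat

theorem encodeNat_eq_nil {n : ℕ} : Computability.encodeNat n = [] ↔ n = 0 := by
  rw [← encodeNat_injective.eq_iff (a := n) (b := 0)]
  rfl

/-! ### Reading an assignment -/

namespace Cmd

/-- Check that the top element of stack `k` is `true`; the flag `z` forbids the empty stack. -/
def checkTop (k : VReg) (z : Bool) : VCmd :=
  pop k fun o => o.elim (pushIf z .err true) fun b => (push k b).seq (pushIf (!b) .err true)

/-- Compute on `u` the difference of the numbers on `q` and `p`. -/
def difference : VCmd :=
  (move₂ .q .x .a2).seq <| (move .a2 .q).seq <| (move₂ .p .w .a2).seq <| (move .a2 .p).seq <|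
  sub .x .w .u .cy .err

/-- Check the value `p / q` and substitute it for the variable on `i`. -/
def substitute : VCmd :=
  (checkTop .p false).seq <| (checkTop .q true).seq <| difference.seq <| scan.seq <|
  (move .l2 .l).seq <| (pop .fo fun o => pushIf o.isNone .err true).seq <|
  (erase .fo).seq <| (erase .i).seq <| (erase .p).seq <| (erase .q).seq (erase .u)

/-- Read a variable and its value, and substitute the value. -/
def readEntry (g : Bool) : VCmd :=
  (push .e g).seq <| (readStr .e .i .m .err).seq <| (readStr .e .p .m .err).seq <|
  (readStr .e .q .m .err).seq substitute

/-- Read an assignment. -/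
def readEntries : VCmd := loop .e (fun _ => false) readEntry

end Cmd

/-- Whether `checkTop` complains. -/
def badTop (z : Bool) (l : List Bool) : Bool := l.head?.elim z (!·)

theorem runs_checkTop (k : VReg) (z : Bool) (s : VReg → List Bool) :
    Cmd.Runs VReg.z (fun _ => False) (Cmd.checkTop k z) s
      (update s .err (carry (badTop z (s k)) ++ s .err)) 0 := by
  refine Cmd.Runs.pop ?_
  rcases h : s k with _ | ⟨b, l⟩
  · have e : update s k [] = s := by rw [← h, update_eq_self]
    refine (Cmd.Runs.pushIf z VReg.err true _).congr ?_ le_rfl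
    rw [List.tail_nil, e]
    cases z <;> simp [badTop]
  · have e : update (update s k l) k (b :: l) = s := by rw [← h, update_idem, update_eq_self]
    refine ((Cmd.Runs.push k b _).seq (Cmd.Runs.pushIf (!b) .err true _)).congr ?_ le_rfl
    rw [List.tail_cons, update_self, e]
    cases b <;> simp [badTop]

theorem badTop_reverse (z : Bool) (w : List Bool) :
    badTop z w.reverse = false ↔ w.getLast? ≠ some false ∧ (z = true → w ≠ []) := by
  unfold badTop
  rw [List.head?_reverse]
  rcases h : w.getLast? with _ | _ | _
  · have : w = [] := by simpa using h
    cases z <;> simp [this]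
  · simp
  · have : w ≠ [] := by rintro rfl; simp at h
    simp [this]

/-- The state of the verifier while the assignment is read. -/
def entryState (Y B R E l n d err : List Bool) : VState :=
  { y := Y, b := B, r := R, e := E, l := l, n := n, d := d, err := err }

/-- Subtraction destroys its arguments, so `p` and `q` are first duplicated. The complement `q - p`
is the numerator contributed by a negated variable with value `p / q`. -/
theorem runs_difference (p q : List Bool) (Y B R E l n d err i : List Bool) :
    ∃ v er, v.length = q.length ∧ (er = [] ↔ bval p ≤ bval q) ∧
      (bval p ≤ bval q → bval v + bval p = bval q) ∧
      VRuns Cmd.difference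
        { entryState Y B R E l n d err with i := i, p := p.reverse, q := q.reverse }
        { entryState Y B R E l n d (er ++ err) with
          i := i, p := p.reverse, q := q.reverse, u := v.reverse } (3 * q.length + 3 * p.length) := by
  obtain ⟨v, er, h1, h2, h3, h4⟩ := Cmd.Runs.sub (ora := False) (kq := VReg.z) (A := fun _ => False)
    (x := VReg.x) (w := .w) (u := .u) (cy := .cy) (err := .err) (by decide)
    (VState.store { entryState Y B R E l n d err with
      i := i, p := p.reverse, q := q.reverse, x := q, w := p }) rfl
  refine ⟨v, er, h1, h2, h3, ?_⟩
  have m₁ : VRuns (Cmd.move₂ .q .x .a2)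
      { entryState Y B R E l n d err with i := i, p := p.reverse, q := q.reverse }
      { entryState Y B R E l n d err with i := i, p := p.reverse, x := q, a2 := q } q.length := by
    refine .of_runs (Cmd.Runs.move₂ (by decide) (by decide) (by decide) _) ?_ ?_
    · simp only [VState.update_store]
      simp [VState.set, VState.store, entryState]
    · simp [VState.store]
  have m₂ : VRuns (Cmd.move .a2 .q)
      { entryState Y B R E l n d err with i := i, p := p.reverse, x := q, a2 := q }
      { entryState Y B R E l n d err with i := i, p := p.reverse, x := q, q := q.reverse }
      q.length := by
    refine .of_runs (Cmd.Runs.move (by decide) _) ?_ le_rfl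
    simp only [VState.update_store]
    simp [VState.set, VState.store, entryState]
  have m₃ : VRuns (Cmd.move₂ .p .w .a2)
      { entryState Y B R E l n d err with i := i, p := p.reverse, x := q, q := q.reverse }
      { entryState Y B R E l n d err with i := i, x := q, q := q.reverse, w := p, a2 := p }
      p.length := by
    refine .of_runs (Cmd.Runs.move₂ (by decide) (by decide) (by decide) _) ?_ ?_
    · simp only [VState.update_store]
      simp [VState.set, VState.store, entryState]
    · simp [VState.store]
  have m₄ : VRuns (Cmd.move .a2 .p)
      { entryState Y B R E l n d err with i := i, x := q, q := q.reverse, w := p, a2 := p }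
      { entryState Y B R E l n d err with
        i := i, p := p.reverse, q := q.reverse, x := q, w := p } p.length := by
    refine .of_runs (Cmd.Runs.move (by decide) _) ?_ le_rfl
    simp only [VState.update_store]
    simp [VState.set, VState.store, entryState]
  have m₅ : VRuns (Cmd.sub .x .w .u .cy .err)
      { entryState Y B R E l n d err with
        i := i, p := p.reverse, q := q.reverse, x := q, w := p }
      { entryState Y B R E l n d (er ++ err) with
        i := i, p := p.reverse, q := q.reverse, u := v.reverse } (q.length + p.length) := by
    refine .of_runs h4 ?_ le_rfl
    simp only [VState.update_store]
    simp [VState.set, VState.store, entryState]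
  exact (m₁.seq (m₂.seq (m₃.seq (m₄.seq m₅)))).mono (by omega)

/-- A bound for the cost of reading an entry. -/
def entryCost (R M N : ℕ) : ℕ := 13 * R + 3 + N * (scanCost R M + 2 * R + 5)

theorem length_litCode_le {R : ℕ} (L : List Lit)
    (hL : ∀ ρ ∈ L, (Computability.encodeNat ρ.idx).length ≤ R) :
    (litCode L).length ≤ L.length * (2 * R + 4) := by
  induction L with
  | nil => simp [litCode]
  | cons ρ L ih =>
    have h₁ := ih fun ρ h => hL ρ (by simp [h])
    have h₂ := hL ρ (by simp)
    have : litCode (ρ :: L) = ρ.code ++ litCode L := rfl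
    rw [this, List.length_append, List.length_cons, add_mul]
    simp [Lit.code]
    omega

/-- The pieces of `er` are the separate reasons for rejecting an entry: a noncanonical numeral, an
empty denominator, a value above 1, or a variable with no alive occurrence. The last covers
variables foreign to the formula as well as repeated ones. The numerator is described only for `bval
p ≤ bval q`, since otherwise `u` does not hold a difference. -/
theorem runs_substitute (I p q : List Bool) (L : List Lit) (Y B R' E n d err : List Bool)
    (R M : ℕ) (hI : I.length ≤ R) (hp : p.length ≤ R) (hq : q.length ≤ R)
    (hL : ∀ ρ ∈ L, (Computability.encodeNat ρ.idx).length ≤ R)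
    (hn : n.length + 2 * R * aliveCount L ≤ M) (hd : d.length + 2 * R * aliveCount L ≤ M) :
    ∃ n' d' er,
      (er = [] ↔ p.getLast? ≠ some false ∧ q.getLast? ≠ some false ∧ q ≠ [] ∧ bval p ≤ bval q ∧
        ∃ ρ ∈ L, ρ.hit I = true) ∧
      (bval p ≤ bval q →
        bval n' = bval n * (L.map (Lit.num I (bval p) (bval q - bval p))).prod) ∧
      bval d' = bval d * (L.map (Lit.den I (bval q))).prod ∧
      n'.length + 2 * R * aliveCount (L.map (Lit.kill I)) ≤ n.length + 2 * R * aliveCount L ∧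
      d'.length + 2 * R * aliveCount (L.map (Lit.kill I)) ≤ d.length + 2 * R * aliveCount L ∧
      VRuns Cmd.substitute
        { entryState Y B R' E (litCode L) n d err with
          i := I.reverse, p := p.reverse, q := q.reverse }
        (entryState Y B R' E (litCode (L.map (Lit.kill I))) n' d' (er ++ err))
        (10 * R + L.length * (scanCost R M + 2 * R + 5)) := by
  set err₁ := carry (badTop true q.reverse) ++ (carry (badTop false p.reverse) ++ err) with herr₁
  obtain ⟨u, e₁, u1, u2, u3, u4⟩ := runs_difference p q Y B R' E (litCode L) n d err₁ I.reverse
  obtain ⟨n', d', fo, s1, s2, s3, s4, s5, s6, s7⟩ := runs_scan I L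
    { entryState Y B R' E (litCode L) n d (e₁ ++ err₁) with
      i := I.reverse, p := p.reverse, q := q.reverse, u := u.reverse }
    ⟨rfl, rfl, rfl, rfl, rfl, rfl, rfl, rfl, rfl, rfl⟩ rfl rfl R M (by simpa using hp)
    (by simpa [u1] using hq) (by simpa using hq) hL hn hd
  have c₁ : VRuns (Cmd.checkTop .p false)
      { entryState Y B R' E (litCode L) n d err with
        i := I.reverse, p := p.reverse, q := q.reverse }
      { entryState Y B R' E (litCode L) n d (carry (badTop false p.reverse) ++ err) with
        i := I.reverse, p := p.reverse, q := q.reverse } 0 :=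
    .of_runs (runs_checkTop _ _ _) (by simp only [VState.update_store]; rfl) le_rfl
  have c₂ : VRuns (Cmd.checkTop .q true)
      { entryState Y B R' E (litCode L) n d (carry (badTop false p.reverse) ++ err) with
        i := I.reverse, p := p.reverse, q := q.reverse }
      { entryState Y B R' E (litCode L) n d err₁ with
        i := I.reverse, p := p.reverse, q := q.reverse } 0 :=
    .of_runs (runs_checkTop _ _ _) (by simp only [VState.update_store]; rfl) le_rfl
  set L' := L.map (Lit.kill I) with hL'
  have hlen : (litCode L').length ≤ L.length * (2 * R + 4) := by
    refine (length_litCode_le (R := R) L' ?_).trans (by simp [hL'])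
    intro ρ hρ
    obtain ⟨ρ', h', rfl⟩ := List.mem_map.mp hρ
    exact hL ρ' h'
  have c₃ : VRuns (Cmd.move .l2 .l)
      { entryState Y B R' E [] n' d' (e₁ ++ err₁) with
        i := I.reverse, p := p.reverse, q := q.reverse, u := u.reverse, fo := fo
        l2 := (litCode L').reverse ++ [] }
      { entryState Y B R' E (litCode L') n' d' (e₁ ++ err₁) with
        i := I.reverse, p := p.reverse, q := q.reverse, u := u.reverse, fo := fo }
      (L.length * (2 * R + 4)) := by
    refine .of_runs (Cmd.Runs.move (by decide) _) ?_ (by simpa [VState.store] using hlen)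
    simp only [VState.update_store]
    simp [VState.set, VState.store, entryState]
  have c₄ : VRuns (Cmd.pop .fo fun o => Cmd.pushIf o.isNone .err true)
      { entryState Y B R' E (litCode L') n' d' (e₁ ++ err₁) with
        i := I.reverse, p := p.reverse, q := q.reverse, u := u.reverse, fo := fo }
      { entryState Y B R' E (litCode L') n' d' (carry fo.head?.isNone ++ (e₁ ++ err₁)) with
        i := I.reverse, p := p.reverse, q := q.reverse, u := u.reverse, fo := fo.tail } 0 := by
    refine VRuns.pop ?_
    change VRuns (Cmd.pushIf fo.head?.isNone .err true) _ _ _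
    cases fo.head?.isNone
    · exact .skip _
    · exact .push _ _ _
  set err₂ := carry fo.head?.isNone ++ (e₁ ++ err₁) with herr₂
  have c₅ : VRuns ((Cmd.erase .fo).seq <| (Cmd.erase .i).seq <| (Cmd.erase .p).seq <|
      (Cmd.erase .q).seq (Cmd.erase .u))
      { entryState Y B R' E (litCode L') n' d' err₂ with
        i := I.reverse, p := p.reverse, q := q.reverse, u := u.reverse, fo := fo.tail }
      (entryState Y B R' E (litCode L') n' d' err₂)
      (fo.tail.length + (I.length + (p.length + (q.length + u.length)))) := by
    refine .of_runs (.seq (.erase _ _) (.seq (.erase _ _) (.seq (.erase _ _) (.seq (.erase _ _)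
      (.erase _ _))))) ?_ ?_
    · simp only [VState.update_store]
      rfl
    · simp only [VState.update_store]
      simp [VState.set, VState.store]
  refine ⟨n', d', carry fo.head?.isNone ++ (e₁ ++ (carry (badTop true q.reverse) ++
    carry (badTop false p.reverse))), ?_, ?_, ?_, s3, s4, ?_⟩
  · have ce : ∀ b, carry b = [] ↔ b = false := by intro b; cases b <;> simp
    rw [List.append_eq_nil_iff, List.append_eq_nil_iff, List.append_eq_nil_iff, ce, ce, ce,
      badTop_reverse, badTop_reverse, u2]
    have hf : fo.head?.isNone = false ↔ ∃ ρ ∈ L, ρ.hit I = true := by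
      have : fo.head?.isNone = false ↔ fo ≠ [] := by cases fo <;> simp
      rw [this, ne_eq, s5]
      simp [entryState]
    rw [hf]
    simp
    tauto
  · intro h
    have := u3 h
    simp only [List.reverse_reverse] at s1
    rw [s1, ← this, Nat.add_sub_cancel]
    rfl
  · simp only [List.reverse_reverse] at s2
    exact s2
  · refine .of_runs (c₁.seq (c₂.seq (u4.seq (s7.seq (c₃.seq (c₄.seq c₅)))))) ?_ ?_
    · rw [herr₂, herr₁]
      simp
    · have : fo.tail.length ≤ L.length := by
        change fo.length ≤ 0 + L.length at s6
        rw [List.length_tail]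
        omega
      have e : L.length * (scanCost R M + 2 * R + 5) = L.length * scanCost R M +
        L.length * (2 * R + 4) + L.length := by ring
      omega

/-! ### Rejecting runs -/

/-- Every run of `c` that does not exhaust the clock reports an error. -/
def Rejects (c : VCmd) (v : VState) : Prop :=
  ∀ n s' n', Cmd.Exec VReg.z (fun _ => False) c v.store n s' n' → 0 < n' → s' VReg.err ≠ []

namespace Rejects

theorem of_runs {c : VCmd} {v : VState} {s t} (h : Cmd.Runs VReg.z (fun _ => False) c v.store s t)
    (hs : s VReg.err ≠ []) : Rejects c v := by
  intro n s' n' he hn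
  rwa [h.eq_of_exec he hn]

theorem seq_left {c d : VCmd} {v : VState} (h : Rejects c v) (hd : d.Keeps .err) :
    Rejects (c.seq d) v := by
  intro n s' n' he hn
  cases he with
  | seq h₁ h₂ => exact h₂.keeps (by decide) hd (h _ _ _ h₁ (hn.trans_le h₂.clock_le))

theorem seq_right {c d : VCmd} {v v₁ : VState} {t} (h : VRuns c v v₁ t) (hd : Rejects d v₁) :
    Rejects (c.seq d) v := by
  intro n s' n' he hn
  cases he with
  | seq h₁ h₂ =>
    rw [Cmd.Runs.eq_of_exec h h₁ (hn.trans_le h₂.clock_le)] at h₂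
    exact hd _ _ _ h₂ hn

theorem loop_left {k : VReg} {f : Bool → VCmd} {v : VState} {b l} (hk : v.store k = b :: l)
    (h : Rejects (f b) (v.set k l)) (hf : (Cmd.loop k (fun _ => false) f).Keeps .err) :
    Rejects (.loop k (fun _ => false) f) v := by
  intro n s' n' he hn
  cases he with
  | loop_nil _ _ _ hk' => simp [hk] at hk'
  | loop_dead _ _ _ => simp at hn
  | loop_brk _ hb _ => simp at hb
  | loop_step hk' _ h₁ h₂ =>
    obtain ⟨rfl, rfl⟩ : _ = _ ∧ _ = _ := by simpa using hk.symm.trans hk'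
    rw [VState.update_store] at h₁
    exact h₂.keeps (by decide) hf (h _ _ _ h₁ (hn.trans_le h₂.clock_le))

theorem loop_right {k : VReg} {f : Bool → VCmd} {v v₁ : VState} {b l t} (hk : v.store k = b :: l)
    (h : VRuns (f b) (v.set k l) v₁ t) (hf : Rejects (.loop k (fun _ => false) f) v₁) :
    Rejects (.loop k (fun _ => false) f) v := by
  intro n s' n' he hn
  cases he with
  | loop_nil _ _ _ hk' => simp [hk] at hk'
  | loop_dead _ _ _ => simp at hn
  | loop_brk _ hb _ => simp at hb
  | loop_step hk' _ h₁ h₂ =>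
    obtain ⟨rfl, rfl⟩ : _ = _ ∧ _ = _ := by simpa using hk.symm.trans hk'
    rw [VState.update_store] at h₁
    rw [Cmd.Runs.eq_of_exec h h₁ (hn.trans_le h₂.clock_le)] at h₂
    exact hf _ _ _ h₂ hn

theorem of_keeps {c : VCmd} {v : VState} (hc : c.Keeps .err) (h : v.err ≠ []) : Rejects c v :=
  fun _ _ _ he _ => he.keeps (by decide) hc h

end Rejects

namespace Cmd

theorem keeps_readEntries : readEntries.Keeps .err := by
  simp [readEntries, readEntry, readStr, readLoop, substitute, checkTop, difference, scan, move,
    erase, move₂, Keeps, scanStep, cmp, cmpLoop, scanBranch, mulValue, mul, mulLoop, mulStep, add,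
    addLoop, addStep, carryLoop, carryStep, popCarry, pushIf, sub, subLoop, subStep, checkZero,
    Option.forall, Bool.forall_bool]

theorem keeps_readEntry (g : Bool) : (readEntry g).Keeps .err := keeps_readEntries.2 g

end Cmd

/-! ### Reading an assignment -/

/-- The variables of the assignment `a` are marked in `L`. -/
def killAll (a : List (ℕ × ℕ × ℕ)) (L : List Lit) : List Lit :=
  a.foldl (fun L t => L.map (Lit.kill (Computability.encodeNat t.1))) L

/-- The assignment `a` gives at most one value, which is in `[0, 1]`, to the variables that occur
alive in `L` and no value to other variables. -/
def Fits : List (ℕ × ℕ × ℕ) → List Lit → Prop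
  | [], _ => True
  | t :: a, L => 0 < t.2.2 ∧ t.2.1 ≤ t.2.2 ∧
      (∃ ρ ∈ L, ρ.hit (Computability.encodeNat t.1) = true) ∧
      Fits a (L.map (Lit.kill (Computability.encodeNat t.1)))

theorem entry_reads {j : VReg} (hd : [VReg.e, j, .m].Nodup) {w rest : List Bool} {v : VState}
    (he : v.e = encodeStr w ++ rest) (hm : v.m = []) :
    Cmd.Runs VReg.z (fun _ => False) (Cmd.readStr .e j .m .err : VCmd) v.store
      (VState.store ((v.set .e rest).set j (w.reverse ++ v.store j))) (w.length + 1) :=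
  (Cmd.runs_readStr .err hd he hm).congr (by simp only [VState.update_store]) le_rfl

theorem runs_readEntry_reads (I p q rest Y B R' l n d err : List Bool) {g : Bool} {tl : List Bool}
    (h : encodeStr I ++ (encodeStr p ++ (encodeStr q ++ rest)) = g :: tl) {v' : VState} {t : ℕ}
    (hs : VRuns Cmd.substitute { entryState Y B R' rest l n d err with
      i := I.reverse, p := p.reverse, q := q.reverse } v' t) :
    VRuns (Cmd.readEntry g) (entryState Y B R' tl l n d err) v'
      (I.length + p.length + q.length + 3 + t) := by
  have h₁ : VRuns (.readStr .e .i .m .err)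
      (entryState Y B R' (encodeStr I ++ (encodeStr p ++ (encodeStr q ++ rest))) l n d err)
      { entryState Y B R' (encodeStr p ++ (encodeStr q ++ rest)) l n d err with i := I.reverse }
      (I.length + 1) := by
    refine .of_runs (entry_reads (by decide) rfl rfl) ?_ le_rfl
    simp [VState.set, VState.store, entryState]
  have h₂ : VRuns (.readStr .e .p .m .err)
      { entryState Y B R' (encodeStr p ++ (encodeStr q ++ rest)) l n d err with i := I.reverse }
      { entryState Y B R' (encodeStr q ++ rest) l n d err with
        i := I.reverse, p := p.reverse } (p.length + 1) := by
    refine .of_runs (entry_reads (by decide) rfl rfl) ?_ le_rfl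
    simp [VState.set, VState.store, entryState]
  have h₃ : VRuns (.readStr .e .q .m .err)
      { entryState Y B R' (encodeStr q ++ rest) l n d err with i := I.reverse, p := p.reverse }
      { entryState Y B R' rest l n d err with
        i := I.reverse, p := p.reverse, q := q.reverse } (q.length + 1) := by
    refine .of_runs (entry_reads (by decide) rfl rfl) ?_ le_rfl
    simp [VState.set, VState.store, entryState]
  refine VRuns.push_seq ?_
  change VRuns _ (entryState Y B R' (g :: tl) l n d err) _ _
  rw [← h]
  exact (h₁.seq (h₂.seq (h₃.seq hs))).mono (by omega)

theorem rejects_readEntry_reads (Y B R' l n d err : List Bool) {g : Bool} {tl : List Bool}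
    (h : ∀ I p q rest, g :: tl ≠ encodeStr I ++ (encodeStr p ++ (encodeStr q ++ rest))) :
    Rejects (Cmd.readEntry g) (entryState Y B R' tl l n d err) := by
  have hk := Cmd.keeps_readEntry g
  refine .seq_right (v₁ := entryState Y B R' (g :: tl) l n d err) (.push _ _ _) ?_
  by_cases h₁ : ∃ I rest, g :: tl = encodeStr I ++ rest
  · obtain ⟨I, r₁, h₁⟩ := h₁
    refine .seq_right (v₁ := { entryState Y B R' r₁ l n d err with i := I.reverse })
      (.of_runs (entry_reads (by decide) h₁ rfl) (by simp [VState.set, VState.store, entryState])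
        le_rfl) ?_
    by_cases h₂ : ∃ p rest, r₁ = encodeStr p ++ rest
    · obtain ⟨p, r₂, rfl⟩ := h₂
      refine .seq_right (v₁ := { entryState Y B R' r₂ l n d err with
        i := I.reverse, p := p.reverse }) (.of_runs (entry_reads (by decide) rfl rfl)
          (by simp [VState.set, VState.store, entryState]) le_rfl) ?_
      have h₃ : ∀ q rest, r₂ ≠ encodeStr q ++ rest := by
        rintro q rest rfl
        exact h I p q rest h₁
      obtain ⟨s', t, h₄, h₅⟩ := Cmd.runs_readStr_bad (ora := False) (kq := VReg.z)
        (A := fun _ => False) (e := VReg.e) (j := .q) (m := .m) (err := .err) (by decide)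
        (s := VState.store { entryState Y B R' r₂ l n d err with i := I.reverse, p := p.reverse })
        h₃ rfl
      exact .seq_left (.of_runs h₅ h₄) hk.2.2.2.2
    · push Not at h₂
      obtain ⟨s', t, h₄, h₅⟩ := Cmd.runs_readStr_bad (ora := False) (kq := VReg.z)
        (A := fun _ => False) (e := VReg.e) (j := .p) (m := .m) (err := .err) (by decide)
        (s := VState.store { entryState Y B R' r₁ l n d err with i := I.reverse })
        h₂ rfl
      exact .seq_left (.of_runs h₅ h₄) hk.2.2.2
  · push Not at h₁
    obtain ⟨s', t, h₄, h₅⟩ := Cmd.runs_readStr_bad (ora := False) (kq := VReg.z)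
      (A := fun _ => False) (e := VReg.e) (j := .i) (m := .m) (err := .err) (by decide)
      (s := VState.store (entryState Y B R' (g :: tl) l n d err)) h₁ rfl
    exact .seq_left (.of_runs h₅ h₄) hk.2.2

/-- The value of a literal under a real interpretation. -/
def Lit.value (π : ℕ → ℝ) (ρ : Lit) : ℝ := bif ρ.sign then π ρ.idx else 1 - π ρ.idx

/-- The product of the values of the selected literals without a value. -/
noncomputable def aliveProd (π : ℕ → ℝ) (L : List Lit) : ℝ :=
  (L.map fun ρ => bif ρ.alive && ρ.sel then ρ.value π else 1).prod

/-- Literal by literal: a selected hit leaves the product of the open literals, and its value is the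
fraction of its two contributions; every other literal contributes 1 to both and is otherwise
unaffected. -/
theorem prod_num_mul (π : ℕ → ℝ) (i p q : ℕ) (hq : 0 < q) (hpq : p ≤ q) (hπ : π i = p / q)
    (L : List Lit) :
    ((L.map (Lit.num (Computability.encodeNat i) p (q - p))).prod : ℝ) *
        aliveProd π (L.map (Lit.kill (Computability.encodeNat i))) =
      ((L.map (Lit.den (Computability.encodeNat i) q)).prod : ℝ) * aliveProd π L := by
  induction L with
  | nil => simp [aliveProd]
  | cons ρ L ih =>
    have key : (ρ.num (Computability.encodeNat i) p (q - p) : ℝ) *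
        (bif (ρ.kill (Computability.encodeNat i)).alive && ρ.sel then ρ.value π else 1) =
        (ρ.den (Computability.encodeNat i) q : ℝ) * (bif ρ.alive && ρ.sel then ρ.value π else 1) := by
      rcases hh : ρ.hit (Computability.encodeNat i) with _ | _
      · simp [Lit.num, Lit.den, Lit.kill, hh]
      · have ⟨hal, hi⟩ : ρ.alive = true ∧ ρ.idx = i := by
          simpa [Lit.hit, encodeNat_injective.eq_iff] using hh
        rcases hs : ρ.sel with _ | _
        · simp [Lit.num, Lit.den, hs]
        · have hq' : (q : ℝ) ≠ 0 := by exact_mod_cast hq.ne'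
          rcases hg : ρ.sign with _ | _
          · simp [Lit.num, Lit.den, Lit.kill, Lit.value, hh, hs, hg, hal, hi, hπ, Nat.cast_sub hpq]
            field_simp
          · simp [Lit.num, Lit.den, Lit.kill, Lit.value, hh, hs, hg, hal, hi, hπ]
            field_simp
    unfold aliveProd at ih ⊢
    simp only [List.map_cons, List.prod_cons, Nat.cast_mul]
    rw [mul_mul_mul_comm, ih]
    exact (congrArg (· * _) key).trans (mul_mul_mul_comm _ _ _ _)


theorem length_le_ruler {L : List Lit} {ρ : Lit} (h : ρ ∈ L) :
    (Computability.encodeNat ρ.idx).length ≤ ruler L := by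
  have := List.single_le_sum (l := L.map fun ρ => 7 + 2 * (Computability.encodeNat ρ.idx).length)
    (by simp) _ (List.mem_map_of_mem h)
  unfold ruler
  omega

theorem encodeAssignment_cons (t : ℕ × ℕ × ℕ) (a : List (ℕ × ℕ × ℕ)) :
    encodeAssignment (t :: a) = encodeStr (Computability.encodeNat t.1) ++
      (encodeStr (Computability.encodeNat t.2.1) ++ (encodeStr (Computability.encodeNat t.2.2) ++
        encodeAssignment a)) := by
  simp [encodeAssignment, encodeBin]

/-- The invariant is the fraction of numerator and denominator times the product of the literals
still open. It is stated in cross-multiplied form, and positivity of the denominators lets the steps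
be combined. -/
theorem runs_readEntries (π : ℕ → ℝ) (Y B R' err : List Bool) (R M : ℕ) (a : List (ℕ × ℕ × ℕ))
    (L : List Lit) (n d : List Bool) (ha : Fits a L)
    (hπ : ∀ t ∈ a, π t.1 = (t.2.1 : ℝ) / t.2.2) (he : (encodeAssignment a).length ≤ R)
    (hL : ∀ ρ ∈ L, (Computability.encodeNat ρ.idx).length ≤ R)
    (hn : n.length + 2 * R * aliveCount L ≤ M) (hd : d.length + 2 * R * aliveCount L ≤ M)
    (hpos : 0 < bval d) :
    ∃ n' d', 0 < bval d' ∧ n'.length ≤ M ∧ d'.length ≤ M ∧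
      (bval n' : ℝ) * aliveProd π (killAll a L) * bval d = bval n * aliveProd π L * bval d' ∧
      VRuns Cmd.readEntries (entryState Y B R' (encodeAssignment a) (litCode L) n d err)
        (entryState Y B R' [] (litCode (killAll a L)) n' d' err)
        (a.length * entryCost R M L.length) := by
  induction a generalizing L n d with
  | nil =>
    exact ⟨n, d, hpos, by omega, by omega, rfl, (VRuns.loop_nil _ _ rfl).mono (Nat.zero_le _)⟩
  | cons t a ih =>
    obtain ⟨i, p, q⟩ := t
    obtain ⟨hq, hpq, hhit, ha⟩ := ha
    simp only at hq hpq hhit ha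
    have hlen : (Computability.encodeNat i).length + (Computability.encodeNat p).length +
        (Computability.encodeNat q).length + 3 ≤ R ∧ (encodeAssignment a).length ≤ R := by
      rw [encodeAssignment_cons] at he
      simp at he
      omega
    obtain ⟨n₁, d₁, er, s1, s2, s3, s4, s5, s6⟩ := runs_substitute (Computability.encodeNat i)
      (Computability.encodeNat p) (Computability.encodeNat q) L Y B R' (encodeAssignment a) n d err
      R M (by omega) (by omega) (by omega) hL hn hd
    simp only [bval_encodeNat] at s1 s2 s3
    have her : er = [] := s1.mpr ⟨getLast?_encodeNat _, getLast?_encodeNat _,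
      encodeNat_eq_nil.not.mpr hq.ne', hpq, hhit⟩
    subst her
    have hpos₁ : 0 < bval d₁ := by
      rw [s3]
      refine Nat.mul_pos hpos (List.prod_pos fun x hx => ?_)
      obtain ⟨ρ, -, rfl⟩ := List.mem_map.mp hx
      unfold Lit.den
      cases ρ.hit (Computability.encodeNat i) && ρ.sel
      · exact Nat.one_pos
      · exact hq
    obtain ⟨n', d', t1, t2, t3, t4, t5⟩ := ih (L.map (Lit.kill (Computability.encodeNat i))) n₁ d₁ ha
      (fun t ht => hπ t (by simp [ht])) hlen.2 (by
        intro ρ hρ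
        obtain ⟨ρ', h', rfl⟩ := List.mem_map.mp hρ
        exact hL ρ' h') (by omega) (by omega) hpos₁
    refine ⟨n', d', t1, t2, t3, ?_, ?_⟩
    · have hprod := prod_num_mul π i p q hq hpq (hπ (i, p, q) (by simp)) L
      have hd₁ : (bval d₁ : ℝ) ≠ 0 := by exact_mod_cast hpos₁.ne'
      rw [s2 hpq] at t4
      have h3 : (bval d₁ : ℝ) =
          bval d * ((L.map (Lit.den (Computability.encodeNat i) q)).prod : ℕ) := by
        rw [s3]; exact Nat.cast_mul _ _
      rw [Nat.cast_mul] at t4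
      refine mul_right_cancel₀ hd₁ ?_
      change (bval n' : ℝ) * aliveProd π (killAll a _) * _ * _ = _
      rw [mul_right_comm, t4]
      rw [h3]
      -- With the denominator after the first entry expanded, the claim is a multiple of the
      -- one-variable identity `hprod`.
      linear_combination (bval n : ℝ) * bval d' * bval d * hprod
    · obtain ⟨g, tl, hg⟩ : ∃ g tl, encodeAssignment ((i, p, q) :: a) = g :: tl := by
        rcases h : encodeAssignment ((i, p, q) :: a) with _ | ⟨g, tl⟩
        · rw [encodeAssignment_cons] at h
          have := congrArg List.length h
          simp at this
        · exact ⟨g, tl, rfl⟩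
      have hstep := runs_readEntry_reads _ _ _ (encodeAssignment a) _ _ _ _ _ _ _
        ((encodeAssignment_cons _ _).symm.trans hg) s6
      refine VRuns.mono (VRuns.loop_step (k := .e) (v := entryState Y B R'
        (encodeAssignment ((i, p, q) :: a)) (litCode L) n d err) hg rfl hstep t5) ?_
      have hcost : entryCost R M L.length =
        13 * R + 3 + L.length * (scanCost R M + 2 * R + 5) := rfl
      rw [List.length_map, List.length_cons, add_mul]
      simp only at hlen ⊢
      omega

/-- Soundness of the reader on arbitrary strings: whatever is not the encoding of a fitting
assignment is rejected. The induction is on the length, since every entry consumes bits. -/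
theorem rejects_readEntries (Y B R' : List Bool) (e : List Bool) (L : List Lit)
    (n d err : List Bool) : (∃ a, e = encodeAssignment a ∧ Fits a L) ∨
      Rejects Cmd.readEntries (entryState Y B R' e (litCode L) n d err) := by
  induction hN : e.length using Nat.strong_induction_on generalizing e L n d err with
  | _ N ih =>
    rcases e with _ | ⟨g, tl⟩
    · exact .inl ⟨[], rfl, trivial⟩
    by_cases h : ∃ I p q rest, g :: tl = encodeStr I ++ (encodeStr p ++ (encodeStr q ++ rest))
    · obtain ⟨I, p, q, rest, h⟩ := h
      -- Any bounds serve here: only the existence of the run matters, because `Rejects` does not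
      -- mention its cost.
      set R := I.length + p.length + q.length + ruler L with hR
      obtain ⟨n₁, d₁, er, s1, s2, s3, s4, s5, s6⟩ := runs_substitute I p q L Y B R' rest n d err R
        (n.length + d.length + 2 * R * aliveCount L) (by omega) (by omega) (by omega)
        (fun ρ hρ => (length_le_ruler hρ).trans (by omega)) (by omega) (by omega)
      have hr := runs_readEntry_reads I p q rest Y B R' (litCode L) n d err h.symm s6
      by_cases her : er = []
      · obtain ⟨hp, hq, hq', hpq, hhit⟩ := s1.mp her
        -- The index needs no canonicity check of its own: it equals the numeral of an occurrence
        -- that it has hit.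
        obtain ⟨i, rfl⟩ : ∃ i, I = Computability.encodeNat i := by
          obtain ⟨ρ, -, hρ⟩ := hhit
          refine ⟨ρ.idx, ?_⟩
          simp [Lit.hit] at hρ
          exact hρ.2.symm
        subst her
        have hlt : rest.length < N := by
          rw [← hN, h]
          simp
          omega
        rcases ih _ hlt rest (L.map (Lit.kill (Computability.encodeNat i))) n₁ d₁ err rfl with
          ⟨a, rfl, ha⟩ | hrej
        · refine .inl ⟨(i, bval p, bval q) :: a, ?_, ?_, hpq, hhit, ha⟩
          · rw [h, encodeAssignment_cons]
            simp only [encodeNat_bval hp, encodeNat_bval hq]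
          · rw [Nat.pos_iff_ne_zero, ne_eq, ← encodeNat_eq_nil, encodeNat_bval hq]
            exact hq'
        · exact .inr (.loop_right rfl hr hrej)
      · exact .inr (.loop_right rfl hr (.of_keeps Cmd.keeps_readEntries (by
          change er ++ err ≠ []
          simp [her])))
    · push Not at h
      exact .inr (.loop_left rfl (rejects_readEntry_reads _ _ _ _ _ _ _ h) Cmd.keeps_readEntries)

/-! ### The final checks: no open literal, and comparison with the required confidence -/

namespace Cmd

/-- Check that no element of `l` is alive. -/
def checkDead : VCmd :=
  loop .l (fun _ => false) fun b => bif b then pop .l fun _ => skip else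
    pop .l fun al => (pushIf (al.getD false) .err true).seq <| pop .l fun _ => pop .l fun _ => skip

/-- Compare the number on `b` with the value of the monomial. -/
def compare : VCmd :=
  (mul .b .p2 .d .a2 .acc .s .cy).seq <| (pushLength .b .p2 .n false).seq (sub .n .d .u .cy .err)

/-- Read the assignment and check that it is good enough. -/
def checkAssignment : VCmd := readEntries.seq <| checkDead.seq compare

/-- The verifier. -/
def verifier : VCmd :=
  (push .f true).seq <| (push .n true).seq <| (push .d true).seq <| readFormula.seq <|
  (readStr .z .b .m .err).seq <| (readStr .y .x .m .err).seq <|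
  (moveBounded .x .e .r .err).seq <| (moveBounded .z .e .r .err).seq checkAssignment

theorem keeps_checkAssignment : checkAssignment.Keeps .err := by
  refine ⟨keeps_readEntries, ?_⟩
  simp [checkDead, compare, pushLength, move, erase, Keeps, mul, mulLoop, mulStep, add,
    addLoop, addStep, carryLoop, carryStep, popCarry, pushIf, sub, subLoop, subStep, checkZero,
    Option.forall, Bool.forall_bool]

theorem keeps_moveBounded {a e r : VReg} (ha : a ≠ .err) (hr : r ≠ .err) :
    (moveBounded a e r .err : VCmd).Keeps .err := by
  simp [moveBounded, Keeps, ha, hr, pushIf, Option.forall]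

end Cmd

theorem runs_checkDead_index (w l : List Bool) (v v' : VState) {t : ℕ}
    (h : VRuns Cmd.checkDead { v with l := false :: l } v' t) :
    VRuns Cmd.checkDead { v with l := encodeStr w ++ l } v' (w.length + t) := by
  induction w with
  | nil => exact h.mono (by simp)
  | cons b w ih =>
    refine VRuns.mono (VRuns.loop_step (k := .l) (b := true) (l := b :: (encodeStr w ++ l)) rfl rfl
      (t₁ := 0) ?_ ih) (by simp [Nat.add_right_comm])
    exact VRuns.pop (VRuns.skip _)

theorem runs_checkDead (L : List Lit) (v : VState) :
    ∃ er, (er = [] ↔ ∀ ρ ∈ L, ρ.alive = false) ∧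
      VRuns Cmd.checkDead { v with l := litCode L } { v with l := [], err := er ++ v.err }
        (litCode L).length := by
  induction L generalizing v with
  | nil => exact ⟨[], by simp, VRuns.loop_nil _ _ rfl⟩
  | cons ρ L ih =>
    obtain ⟨er, he, hr⟩ := ih { v with err := carry ρ.alive ++ v.err }
    refine ⟨er ++ carry ρ.alive, ?_, ?_⟩
    · rw [List.append_eq_nil_iff, he, List.forall_mem_cons, and_comm]
      cases ρ.alive <;> simp
    · have hc : litCode (ρ :: L) = encodeStr (Computability.encodeNat ρ.idx).reverse ++
          (ρ.alive :: ρ.sel :: ρ.sign :: litCode L) := by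
        simp [litCode, Lit.code]
      rw [hc, List.append_assoc]
      refine (runs_checkDead_index _ _ v _ (VRuns.loop_step (k := .l) (b := false)
        (l := ρ.alive :: ρ.sel :: ρ.sign :: litCode L) rfl rfl (t₁ := 0) ?_ hr)).mono ?_
      · refine VRuns.pop ?_
        refine VRuns.mono (VRuns.seq (t₁ := 0) (t₂ := 0)
          (v₁ := { v with l := ρ.sel :: ρ.sign :: litCode L, err := carry ρ.alive ++ v.err })
          ?_ ?_) (le_refl 0)
        · change VRuns (Cmd.pushIf ρ.alive .err true) _ _ _
          cases ρ.alive
          · exact .skip _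
          · exact .push _ _ _
        · refine VRuns.pop ?_
          refine VRuns.pop ?_
          exact .skip _
      · simp
        omega

/-- The fraction 0.B is at most n/d exactly when B times d is at most 2^|B| times n. The power of
two is realised by putting |B| zeros below the digits of the numerator. -/
theorem runs_compare (Y R' n d err B : List Bool) (M : ℕ) (hn : n.length ≤ M) (hd : d.length ≤ M) :
    ∃ v', (v'.err = [] ↔ err = [] ∧ bval B * bval d ≤ 2 ^ B.length * bval n) ∧
      VRuns Cmd.compare (entryState Y B.reverse R' [] [] n d err) v'
        (B.length * (5 * (M + 2 * B.length) + 9) + 5 * M + 4 * B.length) := by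
  obtain ⟨d', h1, h2, h3⟩ := Cmd.Runs.mul (ora := False) (kq := VReg.z) (A := fun _ => False)
    (p := VReg.b) (p' := .p2) (a := .d) (a' := .a2) (acc := .acc) (r := .s) (cy := .cy)
    (by decide) (VState.store (entryState Y B.reverse R' [] [] n d err)) rfl rfl rfl rfl rfl
  have m₁ : VRuns (Cmd.mul .b .p2 .d .a2 .acc .s .cy) (entryState Y B.reverse R' [] [] n d err)
      (entryState Y B.reverse R' [] [] n d' err)
      (B.length * (5 * (M + 2 * B.length) + 9) + 3 * M) := by
    refine .of_runs h3 (by simp only [VState.update_store]; rfl) ?_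
    simp only [VState.store, entryState, List.length_reverse]
    have := Nat.mul_le_mul_left B.length
      (show 5 * (d.length + 2 * B.length) + 9 ≤ 5 * (M + 2 * B.length) + 9 by omega)
    omega
  have m₂ : VRuns (Cmd.pushLength .b .p2 .n false) (entryState Y B.reverse R' [] [] n d' err)
      { entryState Y [] R' [] [] (List.replicate B.length false ++ n) d' err with p2 := B }
      B.length := by
    refine .of_runs (Cmd.Runs.pushLength (by decide) (by decide) (by decide) _ _) ?_
      (by simp [VState.store, entryState])
    simp only [VState.update_store]
    simp [VState.set, VState.store, entryState]
  obtain ⟨u, er, s1, s2, s3, s4⟩ := Cmd.Runs.sub (ora := False) (kq := VReg.z) (A := fun _ => False)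
    (x := VReg.n) (w := .d) (u := .u) (cy := .cy) (err := .err) (by decide)
    (VState.store { entryState Y [] R' [] [] (List.replicate B.length false ++ n) d' err with
      p2 := B }) rfl
  refine ⟨VState.set (VState.set (VState.set (VState.set { entryState Y [] R' [] []
    (List.replicate B.length false ++ n) d' err with p2 := B } .n []) .d []) .u (u.reverse ++ []))
    .err (er ++ err), ?_, (m₁.seq (m₂.seq (.of_runs s4 ?_ le_rfl))).mono ?_⟩
  · have h0 : ∀ k, bval (List.replicate k false) = 0 := by
      intro k
      induction k with
      | zero => rfl
      | succ k ih => simp [List.replicate_succ, ih]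
    have e₁ : bval (List.replicate B.length false ++ n) = 2 ^ B.length * bval n := by
      rw [bval_append, h0, List.length_replicate, Nat.zero_add]
    change er ++ err = [] ↔ _
    rw [List.append_eq_nil_iff, s2, and_comm]
    change _ ∧ bval d' ≤ bval (List.replicate B.length false ++ n) ↔ _
    rw [e₁, h1]
    simp [VState.store, entryState]
  · simp only [VState.update_store]
    rfl
  · simp only [VState.store, entryState, List.length_append, List.length_replicate,
      List.length_reverse] at h2 ⊢
    omega

/-- The value of the selected monomial. -/
noncomputable def Walk.value (π : ℕ → ℝ) (σ : Walk) : ℝ :=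
  (bif σ.ok then 1 else 0) * aliveProd π σ.lits

/-- A real interpretation agrees with an assignment. -/
def Agrees (π : ℕ → ℝ) (a : List (ℕ × ℕ × ℕ)) : Prop := ∀ t ∈ a, π t.1 = (t.2.1 : ℝ) / t.2.2

/-- The assignment `a` gives values exactly to the variables in `L` and its encoding is not too
long. -/
structure Admissible (a : List (ℕ × ℕ × ℕ)) (L : List Lit) : Prop where
  fits : Fits a L
  dead : ∀ ρ ∈ killAll a L, ρ.alive = false
  length_le : (encodeAssignment a).length ≤ ruler L

/-! ### Fitting assignments described by their variables -/

theorem Lit.hit_encodeNat {i : ℕ} {ρ : Lit} :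
    ρ.hit (Computability.encodeNat i) = true ↔ ρ.alive = true ∧ ρ.idx = i := by
  simp [Lit.hit, encodeNat_injective.eq_iff]

theorem Lit.alive_kill {i : ℕ} {ρ : Lit} :
    (ρ.kill (Computability.encodeNat i)).alive = true ↔ ρ.alive = true ∧ ρ.idx ≠ i := by
  have := Lit.hit_encodeNat (i := i) (ρ := ρ)
  rcases h : ρ.hit (Computability.encodeNat i) <;> simp [Lit.kill, h] <;> simp [h] at this <;> tauto

/-- Killing the occurrences of a variable enforces two conditions at once: a later entry finds an
alive occurrence only if its variable was alive in the list at the outset and differs from all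
earlier ones. -/
theorem fits_iff {a : List (ℕ × ℕ × ℕ)} {L : List Lit} :
    Fits a L ↔ (a.map Prod.fst).Nodup ∧ ∀ t ∈ a, 0 < t.2.2 ∧ t.2.1 ≤ t.2.2 ∧
      ∃ ρ ∈ L, ρ.alive = true ∧ ρ.idx = t.1 := by
  induction a generalizing L with
  | nil => simp [Fits]
  | cons t a ih =>
    have h : ∀ j, (∃ ρ ∈ L.map (Lit.kill (Computability.encodeNat t.1)), ρ.alive = true ∧
        ρ.idx = j) ↔ j ≠ t.1 ∧ ∃ ρ ∈ L, ρ.alive = true ∧ ρ.idx = j := by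
      intro j
      simp only [List.mem_map, exists_exists_and_eq_and, Lit.alive_kill]
      constructor
      · rintro ⟨ρ, hρ, ⟨h1, h2⟩, h3⟩
        exact ⟨h3 ▸ h2, ρ, hρ, h1, h3⟩
      · rintro ⟨h2, ρ, hρ, h1, h3⟩
        exact ⟨ρ, hρ, ⟨h1, h3 ▸ h2⟩, h3⟩
    simp only [Fits, ih, h, Lit.hit_encodeNat, List.map_cons, List.nodup_cons, List.forall_mem_cons]
    constructor
    · rintro ⟨h1, h2, h3, h4, h5⟩
      refine ⟨⟨?_, h4⟩, ⟨h1, h2, h3⟩, fun s hs => ⟨(h5 s hs).1, (h5 s hs).2.1, (h5 s hs).2.2.2⟩⟩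
      intro hm
      obtain ⟨s, hs, he⟩ := List.mem_map.mp hm
      exact (h5 s hs).2.2.1 he
    · rintro ⟨⟨h0, h4⟩, ⟨h1, h2, h3⟩, h5⟩
      refine ⟨h1, h2, h3, h4, fun s hs => ⟨(h5 s hs).1, (h5 s hs).2.1, ?_, (h5 s hs).2.2⟩⟩
      intro he
      exact h0 (he ▸ List.mem_map_of_mem hs)

theorem dead_iff {a : List (ℕ × ℕ × ℕ)} {L : List Lit} :
    (∀ ρ ∈ killAll a L, ρ.alive = false) ↔
      ∀ ρ ∈ L, ρ.alive = true → ρ.idx ∈ a.map Prod.fst := by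
  induction a generalizing L with
  | nil => simp [killAll]
  | cons t a ih =>
    change (∀ ρ ∈ killAll a (L.map (Lit.kill (Computability.encodeNat t.1))), _) ↔ _
    simp only [ih, List.forall_mem_map, Lit.alive_kill, List.map_cons, List.mem_cons]
    refine forall₂_congr fun ρ _ => ?_
    change _ ∧ ρ.idx ≠ t.1 → ρ.idx ∈ _ ↔ _
    tauto

theorem exists_agrees {a : List (ℕ × ℕ × ℕ)} (ha : (a.map Prod.fst).Nodup) : ∃ π, Agrees π a := by
  induction a with
  | nil => exact ⟨0, by simp [Agrees]⟩
  | cons t a ih =>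
    rw [List.map_cons, List.nodup_cons] at ha
    obtain ⟨π, hπ⟩ := ih ha.2
    refine ⟨update π t.1 (t.2.1 / t.2.2), ?_⟩
    intro s hs
    rcases List.mem_cons.mp hs with rfl | hs
    · simp
    · rw [update_of_ne, hπ s hs]
      rintro he
      exact ha.1 (he ▸ List.mem_map_of_mem hs)

theorem aliveProd_of_dead (π : ℕ → ℝ) {L : List Lit} (h : ∀ ρ ∈ L, ρ.alive = false) :
    aliveProd π L = 1 := by
  refine List.prod_eq_one fun x hx => ?_
  obtain ⟨ρ, hρ, rfl⟩ := List.mem_map.mp hx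
  simp [h ρ hρ]

/-- A bound for the cost of `checkAssignment`. -/
def checkCost (R M N b : ℕ) : ℕ :=
  R * entryCost R M N + N * (2 * R + 4) + (b * (5 * (M + 2 * b) + 9) + 5 * M + 4 * b)

theorem length_le_length_encodeAssignment (a : List (ℕ × ℕ × ℕ)) :
    a.length ≤ (encodeAssignment a).length := by
  induction a with
  | nil => simp
  | cons t a ih =>
    rw [encodeAssignment_cons]
    simp
    omega

/-- The numerator starts as 1 or 0 according to `σ.ok` and the denominator as 1. Once no literal is
open, the remaining product is 1 and the invariant of `runs_readEntries` makes the final fraction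
the value of the monomial. -/
theorem runs_checkAssignment (π : ℕ → ℝ) (a : List (ℕ × ℕ × ℕ)) (σ : Walk) (Y R' B err : List Bool)
    (ha : Fits a σ.lits) (hπ : Agrees π a) (R : ℕ) (hR : (encodeAssignment a).length ≤ R)
    (hσ : ruler σ.lits ≤ R) :
    ∃ v', (v'.err = [] ↔ err = [] ∧ (∀ ρ ∈ killAll a σ.lits, ρ.alive = false) ∧
        (bval B : ℝ) * aliveProd π (killAll a σ.lits) ≤ 2 ^ B.length * σ.value π) ∧
      VRuns Cmd.checkAssignment
        (entryState Y B.reverse R' (encodeAssignment a) (litCode σ.lits) (carry σ.ok) [true] err) v'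
        (checkCost R (1 + 2 * R * σ.lits.length) σ.lits.length B.length) := by
  set L := σ.lits with hLdef
  have hL : ∀ ρ ∈ L, (Computability.encodeNat ρ.idx).length ≤ R :=
    fun ρ hρ => (length_le_ruler hρ).trans hσ
  have hM : 2 * R * aliveCount L ≤ 2 * R * L.length := Nat.mul_le_mul_left _ List.countP_le_length
  -- The bound on the lengths is one initial digit plus `2 * R` for each occurrence of a literal.
  obtain ⟨n', d', h1, h2, h3, h4, h5⟩ := runs_readEntries π Y B.reverse R' err R
    (1 + 2 * R * L.length) a L (carry σ.ok) [true] ha hπ hR hL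
    (by cases σ.ok <;> simp <;> omega) (by simp; omega) (by simp)
  obtain ⟨er, e1, e2⟩ := runs_checkDead (killAll a L)
    (entryState Y B.reverse R' [] [] n' d' err)
  obtain ⟨v', c1, c2⟩ := runs_compare Y R' n' d' (er ++ err) B _ h2 h3
  have hkill : ∀ (a : List (ℕ × ℕ × ℕ)) (L : List Lit),
      (∀ ρ ∈ L, (Computability.encodeNat ρ.idx).length ≤ R) → (killAll a L).length = L.length ∧
      ∀ ρ ∈ killAll a L, (Computability.encodeNat ρ.idx).length ≤ R := by
    intro a
    induction a with
    | nil => exact fun L hL => ⟨rfl, hL⟩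
    | cons t a ih =>
      intro L hL
      have := ih (L.map (Lit.kill (Computability.encodeNat t.1))) (by
        intro ρ hρ
        obtain ⟨ρ', h', rfl⟩ := List.mem_map.mp hρ
        exact hL ρ' h')
      rwa [List.length_map] at this
  refine ⟨v', ?_, (h5.seq (e2.seq c2)).mono ?_⟩
  · rw [c1, List.append_eq_nil_iff, e1]
    have hd : (0 : ℝ) < bval d' := by exact_mod_cast h1
    have key : ∀ h : ∀ ρ ∈ killAll a L, ρ.alive = false,
        (bval B * bval d' ≤ 2 ^ B.length * bval n' ↔
          (bval B : ℝ) * aliveProd π (killAll a L) ≤ 2 ^ B.length * σ.value π) := by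
      intro h
      rw [aliveProd_of_dead π h] at h4 ⊢
      have hn : (bval n' : ℝ) = σ.value π * bval d' := by
        rw [Walk.value, ← hLdef]
        have : (bval (carry σ.ok) : ℝ) = bif σ.ok then 1 else 0 := by
          cases σ.ok <;> simp
        rw [← this]
        simpa using h4
      rw [← Nat.cast_le (α := ℝ)]
      push_cast
      rw [hn, mul_one, ← mul_assoc, mul_le_mul_iff_left₀ hd]
    constructor
    · rintro ⟨⟨h, h'⟩, h''⟩
      exact ⟨h', h, (key h).mp h''⟩
    · rintro ⟨h', h, h''⟩
      exact ⟨⟨h, h'⟩, (key h).mpr h''⟩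
  · have l₁ := length_litCode_le _ (hkill a L hL).2
    rw [(hkill a L hL).1] at l₁
    have l₂ := Nat.mul_le_mul_right (entryCost R (1 + 2 * R * L.length) L.length)
      ((length_le_length_encodeAssignment a).trans hR)
    unfold checkCost
    omega

/-- The initial state of the walk. -/
def Walk.init (T : List Bool) : Walk := ⟨T, [], true⟩

/-! ### The verifier as a whole -/

section Verifier

variable (φ : NNF ℕ) (B E y : List Bool)

/-- The state of the verifier after reading the formula. -/
def formulaState (z : List Bool) : VState :=
  { VState.withWalk { d := [true] } (walk φ true (.init y)) with z := z }

theorem runs_readFormula (z : List Bool) :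
    VRuns Cmd.readFormula { z := encodeNNF φ ++ z, y := y, f := [true], n := [true], d := [true] }
      (formulaState φ y z) (encodeNNF φ).length :=
  (runs_walk φ true (.init y) z [] { d := [true] } (formulaState φ y z) 0
    (VRuns.loop_nil _ _ rfl)).mono (by simp)

theorem runs_readStr_z :
    VRuns (.readStr .z .b .m .err) (formulaState φ y (encodeStr B ++ E.reverse))
      { formulaState φ y E.reverse with b := B.reverse } (B.length + 1) := by
  refine .of_runs
    (Cmd.runs_readStr (e := VReg.z) (j := .b) (m := .m) .err (by decide) (w := B) (rest := E.reverse) rfl rfl) ?_ le_rfl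
  simp only [VState.update_store]
  simp [VState.set, VState.store, formulaState, VState.withWalk]

variable {φ y} {W pad : List Bool}

theorem runs_readStr_y (hW : (walk φ true (.init y)).choices = encodeStr W ++ pad) :
    VRuns (.readStr .y .x .m .err) { formulaState φ y E.reverse with b := B.reverse }
      { formulaState φ y E.reverse with b := B.reverse, y := pad, x := W.reverse }
      (W.length + 1) := by
  refine .of_runs
    (Cmd.runs_readStr (e := VReg.y) (j := .x) (m := .m) .err (by decide) (w := W) (rest := pad) hW rfl) ?_ le_rfl
  simp only [VState.update_store]
  simp [VState.set, VState.store, formulaState, VState.withWalk]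

theorem runs_moveBounded_xz (W pad : List Bool) : ∃ R' er,
    (er = [] ↔ (E ++ W).length ≤ ruler (walk φ true (.init y)).lits) ∧
    ∃ v, VRuns (.moveBounded .x .e .r .err)
      { formulaState φ y E.reverse with b := B.reverse, y := pad, x := W.reverse } v W.length ∧
    VRuns (.moveBounded .z .e .r .err) v (entryState pad B.reverse R' (E ++ W)
      (litCode (walk φ true (.init y)).lits) (carry (walk φ true (.init y)).ok) [true] er)
      E.length := by
  set σ := walk φ true (.init y) with hσ
  obtain ⟨e₁, h₁, h₂⟩ := Cmd.runs_moveBounded (ora := False) (kq := VReg.z) (A := fun _ => False)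
    (a := VReg.x) (e := .e) (r := .r) (err := .err) (by decide)
    (VState.store { formulaState φ y E.reverse with b := B.reverse, y := pad, x := W.reverse })
  set v : VState := { formulaState φ y E.reverse with
    b := B.reverse, y := pad, e := W, err := e₁
    r := (List.replicate (ruler σ.lits) true).drop W.length } with hv
  obtain ⟨e₂, h₃, h₄⟩ := Cmd.runs_moveBounded (ora := False) (kq := VReg.z) (A := fun _ => False)
    (a := VReg.z) (e := .e) (r := .r) (err := .err) (by decide) v.store
  refine ⟨((List.replicate (ruler σ.lits) true).drop W.length).drop E.length, e₂ ++ e₁, ?_, v,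
    .of_runs h₂ ?_ ?_, .of_runs h₄ ?_ ?_⟩
  · rw [List.append_eq_nil_iff, h₁, h₃]
    simp [hv, VState.store, formulaState, VState.withWalk, ← hσ]
    omega
  · simp only [VState.update_store]
    simp [VState.set, VState.store, formulaState, VState.withWalk, hv, ← hσ]
  · simp [VState.store]
  · simp only [VState.update_store]
    simp [VState.set, VState.store, formulaState, VState.withWalk, hv, ← hσ, entryState]
  · simp [VState.store, hv, formulaState]

/-- The run up to `checkAssignment` is determined by the data, so acceptance and rejection are both
transferred through it. The encoding is assembled from W, given by the certificate, and then E,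
given by the query; moving reverses, so E must arrive reversed to end up as a prefix. -/
theorem verifier_reaches (hW : (walk φ true (.init y)).choices = encodeStr W ++ pad) : ∃ R' er,
    (er = [] ↔ (E ++ W).length ≤ ruler (walk φ true (.init y)).lits) ∧
    (∀ v' t, VRuns Cmd.checkAssignment (entryState pad B.reverse R' (E ++ W)
        (litCode (walk φ true (.init y)).lits) (carry (walk φ true (.init y)).ok) [true] er) v' t →
      VRuns Cmd.verifier { z := encodeNNF φ ++ (encodeStr B ++ E.reverse), y := y } v'
        ((encodeNNF φ).length + B.length + 2 * W.length + E.length + 2 + t)) ∧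
    (Rejects Cmd.checkAssignment (entryState pad B.reverse R' (E ++ W)
        (litCode (walk φ true (.init y)).lits) (carry (walk φ true (.init y)).ok) [true] er) →
      Rejects Cmd.verifier { z := encodeNNF φ ++ (encodeStr B ++ E.reverse), y := y }) := by
  obtain ⟨R', er, h₁, v, h₂, h₃⟩ := runs_moveBounded_xz (φ := φ) B E (y := y) W pad
  have m₁ := runs_readFormula φ y (encodeStr B ++ E.reverse)
  have m₂ := runs_readStr_z φ B E y
  have m₃ := runs_readStr_y B E hW
  refine ⟨R', er, h₁, fun v' t h => ?_, fun h => ?_⟩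
  · refine VRuns.push_seq ?_
    refine VRuns.push_seq ?_
    refine VRuns.push_seq ?_
    exact (m₁.seq (m₂.seq (m₃.seq (h₂.seq (h₃.seq h))))).mono (by omega)
  · refine .seq_right (.push _ _ _) (.seq_right (.push _ _ _) (.seq_right (.push _ _ _) ?_))
    exact .seq_right m₁ (.seq_right m₂ (.seq_right m₃ (.seq_right h₂ (.seq_right h₃ h))))

theorem rejects_verifier (hW : ∀ W pad, (walk φ true (.init y)).choices ≠ encodeStr W ++ pad) :
    Rejects Cmd.verifier { z := encodeNNF φ ++ (encodeStr B ++ E.reverse), y := y } := by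
  have m₁ := runs_readFormula φ y (encodeStr B ++ E.reverse)
  have m₂ := runs_readStr_z φ B E y
  obtain ⟨s', t, h₄, h₅⟩ := Cmd.runs_readStr_bad (ora := False) (kq := VReg.z)
    (A := fun _ => False) (e := VReg.y) (j := .x) (m := .m) (err := .err) (by decide)
    (s := VState.store { formulaState φ y E.reverse with b := B.reverse }) hW rfl
  refine .seq_right (.push _ _ _) (.seq_right (.push _ _ _) (.seq_right (.push _ _ _) ?_))
  refine .seq_right m₁ (.seq_right m₂ (.seq_left (.of_runs h₅ h₄) ?_))
  exact ⟨Cmd.keeps_moveBounded (by decide) (by decide),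
    Cmd.keeps_moveBounded (by decide) (by decide), Cmd.keeps_checkAssignment⟩

end Verifier

theorem rejects_checkAssignment (Y B R' E l n d err : List Bool)
    (h : Rejects Cmd.readEntries (entryState Y B R' E l n d err)) :
    Rejects Cmd.checkAssignment (entryState Y B R' E l n d err) :=
  .seq_left h Cmd.keeps_checkAssignment.2

theorem verifierInit_eq (z y : List Bool) :
    Cmd.verifierInit VReg.z VReg.y z y = VState.store { z := z.reverse, y := y.reverse } := by
  funext k
  cases k <;> rfl

theorem Rejects.not_accepts {z y : List Bool}
    (h : Rejects Cmd.verifier { z := z.reverse, y := y.reverse }) :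
    ¬ Cmd.Accepts Cmd.verifier .z .y .err z y := by
  rintro ⟨s', n', he, hn, hs⟩
  rw [verifierInit_eq] at he
  exact h _ _ _ he hn hs

/-- What the verifier accepts. -/
theorem verifier_sound {φ : NNF ℕ} {B E z y : List Bool}
    (hz : z.reverse = encodeNNF φ ++ (encodeStr B ++ E.reverse))
    (h : Cmd.Accepts Cmd.verifier .z .y .err z y) :
    ∃ T a, E <+: encodeAssignment a ∧ Admissible a (walk φ true (.init T)).lits ∧
      ∀ π, Agrees π a → (bval B : ℝ) ≤ 2 ^ B.length * (walk φ true (.init T)).value π := by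
  have hrej : ¬ Rejects Cmd.verifier { z := z.reverse, y := y.reverse } := fun h' => h'.not_accepts h
  rw [hz] at hrej
  set σ := walk φ true (.init y.reverse) with hσ
  obtain ⟨W, pad, hW⟩ : ∃ W pad, σ.choices = encodeStr W ++ pad := by
    by_contra! h'
    exact hrej (rejects_verifier B E h')
  obtain ⟨R', er, h₁, -, h₂⟩ := verifier_reaches B E hW
  rw [← hσ] at h₁ h₂
  rcases rejects_readEntries pad B.reverse R' (E ++ W) σ.lits (carry σ.ok) [true] er with
    ⟨a, ha, hfit⟩ | h₃
  · have main : ∀ π, Agrees π a → er = [] ∧ (∀ ρ ∈ killAll a σ.lits, ρ.alive = false) ∧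
        (bval B : ℝ) * aliveProd π (killAll a σ.lits) ≤ 2 ^ B.length * σ.value π := by
      intro π hπ
      obtain ⟨v', c₁, c₂⟩ := runs_checkAssignment π a σ pad R' B er hfit hπ
        ((encodeAssignment a).length + ruler σ.lits) (by omega) (by omega)
      by_contra hc
      rw [← c₁] at hc
      rw [ha] at h₂
      exact hrej (h₂ (.of_runs c₂ hc))
    -- The first two conclusions of `main` do not involve π, but extracting them needs at least one
    -- agreeing interpretation.
    obtain ⟨π, hπ⟩ := exists_agrees (fits_iff.mp hfit).1
    obtain ⟨he, hdead, -⟩ := main π hπ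
    refine ⟨y.reverse, a, ha ▸ List.prefix_append _ _, ⟨hfit, hdead, ha ▸ h₁.mp he⟩, fun π hπ => ?_⟩
    have := (main π hπ).2.2
    rwa [aliveProd_of_dead π hdead, mul_one] at this
  · exact absurd (h₂ (rejects_checkAssignment _ _ _ _ _ _ _ _ h₃)) hrej

/-- A bound for the cost of the verifier. -/
def verifierCost (Z : ℕ) : ℕ :=
  2 * Z + 5 * Z + 2 + checkCost (2 * Z) (1 + 2 * (2 * Z) * Z) Z Z

/-- The certificate consists of the choices T, which the walk consumes exactly, the code of the
missing suffix W of the encoding, and padding; it is written backwards because loading reverses it.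
The padding pays for the clock, which counts the length of the certificate. -/
theorem verifier_complete {φ : NNF ℕ} {B E z : List Bool}
    (hz : z.reverse = encodeNNF φ ++ (encodeStr B ++ E.reverse)) {T : List Bool}
    {a : List (ℕ × ℕ × ℕ)} {σ : Walk} (hT : ∀ T', walk φ true (.init (T ++ T')) = { σ with choices := T' })
    (hTl : T.length ≤ z.length) (hE : E <+: encodeAssignment a) (ha : Admissible a σ.lits)
    (hr : ruler σ.lits ≤ 2 * z.length) (hl : σ.lits.length ≤ z.length)
    {π : ℕ → ℝ} (hπ : Agrees π a) (hB : (bval B : ℝ) ≤ 2 ^ B.length * σ.value π) :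
    ∃ y : List Bool, y.length ≤ 5 * z.length + 2 + verifierCost z.length ∧
      Cmd.Accepts Cmd.verifier .z .y .err z y := by
  obtain ⟨W, hW⟩ := hE
  -- One unit beyond the cost keeps the clock positive at the end, which acceptance demands.
  set pad := List.replicate (verifierCost z.length + 1) true with hpad
  set y := (T ++ (encodeStr W ++ pad)).reverse with hy
  have hσ : walk φ true (.init y.reverse) = { σ with choices := encodeStr W ++ pad } := by
    rw [hy, List.reverse_reverse, hT]
  obtain ⟨R', er, h₁, h₂, -⟩ := verifier_reaches (φ := φ) B E (y := y.reverse) (W := W) (pad := pad)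
    (by rw [hσ])
  rw [hσ] at h₁ h₂
  simp only at h₁ h₂
  have her : er = [] := h₁.mpr (hW ▸ ha.length_le)
  obtain ⟨v', c₁, c₂⟩ := runs_checkAssignment π a { σ with choices := encodeStr W ++ pad } pad R' B er
    ha.fits hπ (2 * z.length) (ha.length_le.trans hr) hr
  rw [hW] at h₂
  have h₃ := h₂ _ _ c₂
  have hlen := congrArg List.length hz
  have hlen' := congrArg List.length hW
  have hal := ha.length_le
  simp only [List.length_append, List.length_reverse, length_encodeStr] at hlen hlen'
  have cost : (encodeNNF φ).length + B.length + 2 * W.length + E.length + 2 +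
      checkCost (2 * z.length) (1 + 2 * (2 * z.length) * σ.lits.length) σ.lits.length B.length ≤
      verifierCost z.length := by
    have hcheck : checkCost (2 * z.length) (1 + 2 * (2 * z.length) * σ.lits.length) σ.lits.length
        B.length ≤ checkCost (2 * z.length) (1 + 2 * (2 * z.length) * z.length) z.length z.length := by
      have hb : B.length ≤ z.length := by omega
      unfold checkCost entryCost scanCost
      gcongr
    unfold verifierCost
    omega
  have hylen : y.length = T.length + (2 * W.length + 1 + (verifierCost z.length + 1)) := by
    simp [hy, hpad]
    omega
  obtain ⟨t', ht', hrun⟩ := h₃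
  simp only at ht'
  refine ⟨y, by omega, v'.store, z.length + y.length - t', ?_, by omega, ?_⟩
  · rw [verifierInit_eq, hz]
    have := hrun (z.length + y.length - t')
    rwa [Nat.sub_add_cancel (by omega)] at this
  · rw [show v'.store .err = v'.err from rfl, c₁]
    refine ⟨her, ha.dead, ?_⟩
    rw [aliveProd_of_dead π ha.dead, mul_one]
    exact hB

/-! ### The monomials of a formula -/

/-- The length bound for the encoding of an assignment to the variables of a formula. -/
def NNF.ruler : NNF ℕ → ℕ
  | .bot => 0
  | .top => 0
  | .pos i => 7 + 2 * (Computability.encodeNat i).length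
  | .neg i => 7 + 2 * (Computability.encodeNat i).length
  | .or α β => α.ruler + β.ruler
  | .and α β => α.ruler + β.ruler

theorem NNF.ruler_le (φ : NNF ℕ) : φ.ruler ≤ 2 * (encodeNNF φ).length := by
  induction φ with
  | bot => simp [NNF.ruler]
  | top => simp [NNF.ruler]
  | pos i => simp [NNF.ruler, encodeNNF, encodeBin]; omega
  | neg i => simp [NNF.ruler, encodeNNF, encodeBin]; omega
  | or α β hα hβ => simp [NNF.ruler, encodeNNF]; omega
  | and α β hα hβ => simp [NNF.ruler, encodeNNF]; omega

theorem ruler_walk (φ : NNF ℕ) (g : Bool) (σ : Walk) :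
    ruler (walk φ g σ).lits = φ.ruler + ruler σ.lits := by
  induction φ generalizing g σ with
  | bot => simp [walk, NNF.ruler]
  | top => simp [walk, NNF.ruler]
  | pos i => simp [walk, NNF.ruler, _root_.ruler]
  | neg i => simp [walk, NNF.ruler, _root_.ruler]
  | or α β hα hβ => cases g <;> simp [walk, NNF.ruler, hα, hβ] <;> omega
  | and α β hα hβ => simp [walk, NNF.ruler, hα, hβ]; omega

/-- Every literal occupies at least four symbols of the encoding. The factor 4 is what later keeps
products of two denominators below 2^(n²). -/
theorem length_lits_walk (φ : NNF ℕ) (g : Bool) (σ : Walk) :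
    4 * (walk φ g σ).lits.length ≤ (encodeNNF φ).length + 4 * σ.lits.length := by
  induction φ generalizing g σ with
  | bot => simp [walk]
  | top => simp [walk]
  | pos i => simp [walk, encodeNNF, encodeBin]; omega
  | neg i => simp [walk, encodeNNF, encodeBin]; omega
  | or α β hα hβ =>
    cases g <;> simp only [walk, encodeNNF, List.length_append]
    · have := hβ false (walk α false σ)
      have := hα false σ
      omega
    · have := hα (σ.choices.head?.getD false) { σ with choices := σ.choices.tail }
      refine (hβ _ _).trans ?_
      simp only at this
      omega
  | and α β hα hβ =>
    simp only [walk, encodeNNF, List.length_append]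
    have := hβ g (walk α g σ)
    have := hα g σ
    omega

theorem alive_walk (φ : NNF ℕ) (g : Bool) (σ : Walk) (h : ∀ ρ ∈ σ.lits, ρ.alive = true) :
    ∀ ρ ∈ (walk φ g σ).lits, ρ.alive = true := by
  induction φ generalizing g σ with
  | bot => exact h
  | top => exact h
  | pos i => simpa [walk] using h
  | neg i => simpa [walk] using h
  | or α β hα hβ =>
    cases g
    · exact hβ _ _ (hα _ _ h)
    · exact hβ _ _ (hα _ _ h)
  | and α β hα hβ => exact hβ _ _ (hα _ _ h)

/-- Unselected literals are recorded too, with `sel = false`. Hence the list mentions all variables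
of the formula, as an answer must, whichever monomial has been chosen. -/
theorem mem_idx_walk (φ : NNF ℕ) (g : Bool) (σ : Walk) (i : ℕ) :
    (∃ ρ ∈ (walk φ g σ).lits, ρ.idx = i) ↔ i ∈ φ.vars ∨ ∃ ρ ∈ σ.lits, ρ.idx = i := by
  induction φ generalizing g σ with
  | bot => simp [walk, NNF.vars]
  | top => simp [walk, NNF.vars]
  | pos j => simp [walk, NNF.vars, eq_comm]
  | neg j => simp [walk, NNF.vars, eq_comm]
  | or α β hα hβ => cases g <;> simp only [walk, hα, hβ, NNF.vars, Set.mem_union] <;> tauto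
  | and α β hα hβ => simp only [walk, hα, hβ, NNF.vars, Set.mem_union]; tauto

/-- The real number `π i`. -/
def realOf (π : ℕ → Viterbi) (i : ℕ) : ℝ := (π i).toReal

namespace Viterbi

theorem toReal_nonneg (x : Viterbi) : 0 ≤ x.toReal := Subtype.property x |>.1

theorem toReal_le_one (x : Viterbi) : x.toReal ≤ 1 := Subtype.property x |>.2

theorem toReal_add (x y : Viterbi) : (x + y).toReal = max x.toReal y.toReal := by
  rw [add_eq_max]
  rcases le_total x y with h | h
  · rw [max_eq_right h, max_eq_right ((le_iff x y).mp h)]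
  · rw [max_eq_left h, max_eq_left ((le_iff y x).mp h)]

end Viterbi

theorem Lit.value_mem (π : ℕ → Viterbi) (ρ : Lit) :
    0 ≤ ρ.value (realOf π) ∧ ρ.value (realOf π) ≤ 1 := by
  have h0 := (π ρ.idx).toReal_nonneg
  have h1 := (π ρ.idx).toReal_le_one
  unfold Lit.value realOf
  cases ρ.sign
  · constructor <;> simp <;> linarith
  · exact ⟨h0, h1⟩

theorem aliveProd_nonneg (π : ℕ → Viterbi) (L : List Lit) : 0 ≤ aliveProd (realOf π) L := by
  refine List.prod_nonneg fun x hx => ?_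
  obtain ⟨ρ, -, rfl⟩ := List.mem_map.mp hx
  cases ρ.alive && ρ.sel
  · exact zero_le_one
  · exact (ρ.value_mem π).1

theorem Walk.value_nonneg (π : ℕ → Viterbi) (σ : Walk) : 0 ≤ σ.value (realOf π) := by
  refine mul_nonneg ?_ (aliveProd_nonneg π _)
  cases σ.ok <;> simp

theorem aliveProd_cons (π : ℕ → ℝ) (ρ : Lit) (L : List Lit) :
    aliveProd π (ρ :: L) = (bif ρ.alive && ρ.sel then ρ.value π else 1) * aliveProd π L := rfl

theorem value_walk_false (π : ℕ → ℝ) (φ : NNF ℕ) (σ : Walk) :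
    (walk φ false σ).value π = σ.value π := by
  induction φ generalizing σ with
  | bot => simp [walk, Walk.value]
  | top => rfl
  | pos i => simp [walk, Walk.value, aliveProd_cons]
  | neg i => simp [walk, Walk.value, aliveProd_cons]
  | or α β hα hβ => simp only [walk, hα, hβ]
  | and α β hα hβ => simp only [walk, hα, hβ]

section Conf

variable (π : ℕ → Viterbi)

theorem toReal_conf_bot : (conf .bot π).toReal = 0 := rfl
theorem toReal_conf_top : (conf .top π).toReal = 1 := rfl
theorem toReal_conf_pos (i : ℕ) : (conf (.pos i) π).toReal = realOf π i := rfl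
theorem toReal_conf_neg (i : ℕ) : (conf (.neg i) π).toReal = 1 - realOf π i := rfl
theorem toReal_conf_and (α β : NNF ℕ) :
    (conf (.and α β) π).toReal = (conf α π).toReal * (conf β π).toReal := rfl
theorem toReal_conf_or (α β : NNF ℕ) :
    (conf (.or α β) π).toReal = max (conf α π).toReal (conf β π).toReal :=
  Viterbi.toReal_add _ _

/-- A single argument of a disjunction is at most the maximum, and all factors are nonnegative, so
no monomial exceeds the formula. -/
theorem value_walk_le (φ : NNF ℕ) (σ : Walk) :
    (walk φ true σ).value (realOf π) ≤ σ.value (realOf π) * (conf φ π).toReal := by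
  induction φ generalizing σ with
  | bot => simp [walk, Walk.value, toReal_conf_bot]
  | top => simp [walk, toReal_conf_top]
  | pos i =>
    simp only [walk, Walk.value, aliveProd_cons, toReal_conf_pos]
    simp [Lit.value]
    exact le_of_eq (by ring)
  | neg i =>
    simp only [walk, Walk.value, aliveProd_cons, toReal_conf_neg]
    simp [Lit.value]
    exact le_of_eq (by ring)
  | or α β hα hβ =>
    have hv : ∀ T, Walk.value (realOf π) { σ with choices := T } = σ.value (realOf π) := fun _ => rfl
    rw [toReal_conf_or]
    simp only [walk]
    cases σ.choices.head?.getD false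
    · refine (hβ _).trans ?_
      rw [value_walk_false, hv]
      exact mul_le_mul_of_nonneg_left (le_max_right _ _) (σ.value_nonneg π)
    · refine (value_walk_false _ _ _).trans_le ((hα _).trans ?_)
      rw [hv]
      exact mul_le_mul_of_nonneg_left (le_max_left _ _) (σ.value_nonneg π)
  | and α β hα hβ =>
    rw [toReal_conf_and, ← mul_assoc]
    exact (hβ _).trans (mul_le_mul_of_nonneg_right (hα σ) (Viterbi.toReal_nonneg _))

/-- The literals and the flag after a walk along an unselected formula do not depend on the
choices. -/
theorem walk_false_choices (φ : NNF ℕ) (σ : Walk) (T : List Bool) :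
    walk φ false { σ with choices := T } = { walk φ false σ with choices := T } := by
  induction φ generalizing σ T with
  | bot => rfl
  | top => rfl
  | pos i => rfl
  | neg i => rfl
  | or α β hα hβ => simp only [walk]; rw [hα, hβ]
  | and α β hα hβ => simp only [walk]; rw [hα, hβ]

/-- At each selected disjunction take the argument with the larger value. The suffix `T'` expresses
that exactly T is consumed, so that the walks through the two parts of a conjunction can be chained
and further data can follow in the certificate. -/
theorem exists_walk_eq (φ : NNF ℕ) (σ : Walk) : ∃ (T : List Bool) (τ : Walk),
    T.length ≤ (encodeNNF φ).length ∧
    (∀ T', walk φ true { σ with choices := T ++ T' } = { τ with choices := T' }) ∧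
    τ.value (realOf π) = σ.value (realOf π) * (conf φ π).toReal := by
  induction φ generalizing σ with
  | bot =>
    exact ⟨[], { σ with ok := false }, by simp, fun T' => rfl, by simp [Walk.value, toReal_conf_bot]⟩
  | top => exact ⟨[], σ, by simp, fun T' => rfl, by simp [toReal_conf_top]⟩
  | pos i =>
    refine ⟨[], { σ with lits := ⟨i, true, true, true⟩ :: σ.lits }, by simp, fun T' => rfl, ?_⟩
    simp only [Walk.value, aliveProd_cons, toReal_conf_pos]
    simp [Lit.value]
    ring
  | neg i =>
    refine ⟨[], { σ with lits := ⟨i, true, true, false⟩ :: σ.lits }, by simp, fun T' => rfl, ?_⟩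
    simp only [Walk.value, aliveProd_cons, toReal_conf_neg]
    simp [Lit.value]
    ring
  | or α β hα hβ =>
    have hv : ∀ (σ : Walk) (T : List Bool),
        Walk.value (realOf π) { σ with choices := T } = σ.value (realOf π) := fun _ _ => rfl
    rw [toReal_conf_or]
    rcases le_total (conf α π).toReal (conf β π).toReal with h | h
    · obtain ⟨T, τ, h₁, h₂, h₃⟩ := hβ (walk α false σ)
      refine ⟨false :: T, τ, by simp [encodeNNF]; omega, fun T' => ?_, ?_⟩
      · exact (congrArg (walk β true) (walk_false_choices α σ (T ++ T'))).trans (h₂ T')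
      · rw [h₃, value_walk_false, max_eq_right h]
    · obtain ⟨T, τ, h₁, h₂, h₃⟩ := hα σ
      refine ⟨true :: T, walk β false τ, by simp [encodeNNF]; omega, fun T' => ?_, ?_⟩
      · exact (congrArg (walk β false) (h₂ T')).trans (walk_false_choices β τ T')
      · rw [value_walk_false, h₃, max_eq_left h]
  | and α β hα hβ =>
    obtain ⟨T, τ, h₁, h₂, h₃⟩ := hα σ
    obtain ⟨T₂, τ₂, h₄, h₅, h₆⟩ := hβ τ
    refine ⟨T ++ T₂, τ₂, by simp [encodeNNF]; omega, fun T' => ?_, ?_⟩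
    · rw [← h₅, List.append_assoc]
      change walk β true (walk α true _) = _
      rw [h₂]
    · rw [h₆, h₃, toReal_conf_and, mul_assoc]

end Conf

/-! ### The oracle -/

/-- The assignment `a` gives values exactly to the variables of `φ`, and its encoding is not too
long. -/
structure AdmissibleFor (a : List (ℕ × ℕ × ℕ)) (φ : NNF ℕ) : Prop where
  nodup : (a.map Prod.fst).Nodup
  vars_eq : ∀ i, i ∈ a.map Prod.fst ↔ i ∈ φ.vars
  bounds : ∀ t ∈ a, 0 < t.2.2 ∧ t.2.1 ≤ t.2.2
  length_le : (encodeAssignment a).length ≤ φ.ruler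

/-- A walk meets every literal, alive, regardless of the choices. Only the selection flags depend on
T, and admissibility ignores them. -/
theorem admissible_walk_iff {a : List (ℕ × ℕ × ℕ)} {φ : NNF ℕ} {T : List Bool} :
    Admissible a (walk φ true (.init T)).lits ↔ AdmissibleFor a φ := by
  have hal := alive_walk φ true (.init T) (by simp [Walk.init])
  have hidx : ∀ i, (∃ ρ ∈ (walk φ true (.init T)).lits, ρ.idx = i) ↔ i ∈ φ.vars := fun i => by
    rw [mem_idx_walk]
    simp [Walk.init]
  have hidx' : ∀ i, (∃ ρ ∈ (walk φ true (.init T)).lits, ρ.alive = true ∧ ρ.idx = i) ↔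
      i ∈ φ.vars := by
    intro i
    rw [← hidx i]
    exact exists_congr fun ρ => and_congr_right fun h => by simp [hal ρ h]
  have hr : ruler (walk φ true (.init T)).lits = φ.ruler := by
    rw [ruler_walk]
    simp [Walk.init, ruler]
  constructor
  · rintro ⟨h₁, h₂, h₃⟩
    rw [fits_iff] at h₁
    rw [dead_iff] at h₂
    refine ⟨h₁.1, fun i => ⟨fun hi => ?_, fun hi => ?_⟩, fun t ht => ⟨(h₁.2 t ht).1, (h₁.2 t ht).2.1⟩,
      hr ▸ h₃⟩
    · obtain ⟨t, ht, rfl⟩ := List.mem_map.mp hi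
      exact (hidx' _).mp (h₁.2 t ht).2.2
    · obtain ⟨ρ, hρ, h, rfl⟩ := (hidx' i).mpr hi
      exact h₂ ρ hρ h
  · rintro ⟨h₁, h₂, h₃, h₄⟩
    refine ⟨fits_iff.mpr ⟨h₁, fun t ht => ⟨(h₃ t ht).1, (h₃ t ht).2, ?_⟩⟩, dead_iff.mpr ?_, hr ▸ h₄⟩
    · exact (hidx' _).mpr ((h₂ _).mp (List.mem_map_of_mem ht))
    · exact fun ρ hρ _ => (h₂ _).mpr ((hidx _).mp ⟨ρ, hρ, rfl⟩)

/-- The queries of the verifier that have a certificate. -/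
def optConfOracle : Language Bool :=
  { z | ∃ y : List Bool, y.length ≤ 5 * z.length + 2 + verifierCost z.length ∧
      Cmd.Accepts Cmd.verifier .z .y .err z y }

open Classical in
theorem inNP_optConfOracle : InNP optConfOracle := by
  -- The polynomial is the length bound in `optConfOracle` with `verifierCost` unfolded, so that
  -- after evaluation the two sides agree by `rfl`.
  refine ⟨_, 5 * .X + 2 + (2 * .X + 5 * .X + 2 + (2 * .X * (13 * (2 * .X) + 3 + .X * (2 * (2 * .X *
    (5 * (1 + 2 * (2 * .X) * .X) + 9) + 3 * (1 + 2 * (2 * .X) * .X)) + 3 * (2 * .X) + 3 +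
    2 * (2 * .X) + 5)) + .X * (2 * (2 * .X) + 4) + (.X * (5 * (1 + 2 * (2 * .X) * .X + 2 * .X) + 9) +
    5 * (1 + 2 * (2 * .X) * .X) + 4 * .X))),
    Cmd.verifier_polyTime Cmd.verifier .err (show VReg.z ≠ .y by decide), fun z => ?_⟩
  simp only [decide_eq_true_eq]
  simp only [Polynomial.eval_add, Polynomial.eval_mul, Polynomial.eval_X, Polynomial.eval_ofNat,
    Polynomial.eval_one]
  rfl

/-- Some admissible assignment has an encoding that extends `E`, and the confidence that it yields is
at least the binary fraction `0.B`. -/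
def Attains (φ : NNF ℕ) (B E : List Bool) : Prop :=
  ∃ (a : List (ℕ × ℕ × ℕ)) (π : ℕ → Viterbi), AdmissibleFor a φ ∧ E <+: encodeAssignment a ∧
    Agrees (realOf π) a ∧ (bval B : ℝ) ≤ 2 ^ B.length * (conf φ π).toReal

/-- Clamping to the unit interval does not disturb the assigned values, which already lie in it. -/
theorem exists_agrees_viterbi {a : List (ℕ × ℕ × ℕ)} (ha : (a.map Prod.fst).Nodup)
    (h : ∀ t ∈ a, 0 < t.2.2 ∧ t.2.1 ≤ t.2.2) : ∃ π : ℕ → Viterbi, Agrees (realOf π) a := by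
  obtain ⟨π, hπ⟩ := exists_agrees ha
  refine ⟨fun i => Set.projIcc (0 : ℝ) 1 zero_le_one (π i), fun t ht => ?_⟩
  obtain ⟨h1, h2⟩ := h t ht
  have h1' : (0 : ℝ) < t.2.2 := by exact_mod_cast h1
  have h2' : (t.2.1 : ℝ) ≤ t.2.2 := by exact_mod_cast h2
  have : π t.1 ∈ Set.Icc (0 : ℝ) 1 := by
    rw [hπ t ht]
    exact ⟨by positivity, (div_le_one h1').mpr h2'⟩
  change (Set.projIcc (0 : ℝ) 1 zero_le_one (π t.1) : ℝ) = _
  rw [congrArg Subtype.val (Set.projIcc_of_mem zero_le_one this)]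
  exact hπ t ht

/-- A monomial never overestimates the confidence and a suitable one attains it, so guessing a
monomial is as good as evaluating the maxima. -/
theorem mem_optConfOracle {φ : NNF ℕ} {B E z : List Bool}
    (hz : z.reverse = encodeNNF φ ++ (encodeStr B ++ E.reverse)) :
    z ∈ optConfOracle ↔ Attains φ B E := by
  constructor
  · rintro ⟨y, -, hy⟩
    obtain ⟨T, a, hE, ha, h⟩ := verifier_sound hz hy
    rw [admissible_walk_iff] at ha
    obtain ⟨π, hπ⟩ := exists_agrees_viterbi ha.nodup ha.bounds
    refine ⟨a, π, ha, hE, hπ, (h _ hπ).trans (mul_le_mul_of_nonneg_left ?_ (by positivity))⟩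
    refine (value_walk_le π φ (.init T)).trans (le_of_eq ?_)
    simp [Walk.value, Walk.init, aliveProd]
  · rintro ⟨a, π, ha, hE, hπ, hB⟩
    obtain ⟨T, τ, h₁, h₂, h₃⟩ := exists_walk_eq π φ (.init [])
    have hlen := congrArg List.length hz
    simp only [List.length_append, List.length_reverse] at hlen
    have hτ : ∀ T', walk φ true (.init (T ++ T')) = { τ with choices := T' } := h₂
    have hτ' : τ.lits = (walk φ true (.init (T ++ []))).lits := by rw [hτ]
    refine verifier_complete hz (σ := τ) hτ (by omega) hE ?_ ?_ ?_ hπ ?_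
    · rw [hτ', admissible_walk_iff]
      exact ha
    · rw [hτ', ruler_walk]
      have := φ.ruler_le
      simp only [Walk.init, ruler, List.map_nil, List.sum_nil]
      omega
    · rw [hτ']
      have := length_lits_walk φ true (.init (T ++ []))
      simp only [Walk.init, List.length_nil] at this ⊢
      omega
    · rw [h₃]
      simpa [Walk.value, Walk.init, aliveProd] using hB

/-! ### Optimal interpretations -/

theorem length_encodeNat_le (n : ℕ) : (Computability.encodeNat n).length ≤ n := by
  have h : ∀ m : PosNum, (Computability.encodePosNum m).length ≤ (m : ℕ) ∧ 1 ≤ (m : ℕ) := by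
    intro m
    induction m with
    | one => simp [Computability.encodePosNum]
    | bit0 m ih => simp [Computability.encodePosNum]; omega
    | bit1 m ih => simp [Computability.encodePosNum]; omega
  unfold Computability.encodeNat
  rcases hn : (n : Num) with _ | m
  · simp [Computability.encodeNum]
  · have h' : ((n : Num) : ℕ) = ((Num.pos m : Num) : ℕ) := by rw [hn]
    rw [Num.to_of_nat] at h'
    rw [Computability.encodeNum, h']
    exact (h m).1

/-- The number of selected occurrences of the literal with variable `i` and sign `s`. -/
def litCount (s : Bool) (i : ℕ) (L : List Lit) : ℕ :=
  L.countP fun ρ => ρ.alive && ρ.sel && (ρ.sign == s) && decide (ρ.idx = i)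

theorem litCount_cons (s : Bool) (i : ℕ) (ρ : Lit) (L : List Lit) :
    litCount s i (ρ :: L) = litCount s i L +
      if (ρ.alive && ρ.sel && (ρ.sign == s) && decide (ρ.idx = i)) = true then 1 else 0 :=
  List.countP_cons

theorem litCount_add_le (i : ℕ) (L : List Lit) :
    litCount true i L + litCount false i L ≤ (L.map Lit.idx).count i := by
  induction L with
  | nil => simp [litCount]
  | cons ρ L ih =>
    simp only [litCount_cons, List.map_cons, List.count_cons]
    cases ρ.alive <;> cases ρ.sel <;> cases ρ.sign <;> by_cases h : ρ.idx = i <;> simp [h] <;> omega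

/-- Grouping the literals by variable separates the optimisation into problems in one variable. -/
theorem aliveProd_eq_prod (π : ℕ → ℝ) (L : List Lit) (S : Finset ℕ) (hS : ∀ ρ ∈ L, ρ.idx ∈ S) :
    aliveProd π L = ∏ i ∈ S, π i ^ litCount true i L * (1 - π i) ^ litCount false i L := by
  induction L with
  | nil => simp [aliveProd, litCount]
  | cons ρ L ih =>
    have key : ∀ i, π i ^ litCount true i (ρ :: L) * (1 - π i) ^ litCount false i (ρ :: L) =
        (if i = ρ.idx then bif ρ.alive && ρ.sel then ρ.value π else 1 else 1) *
          (π i ^ litCount true i L * (1 - π i) ^ litCount false i L) := by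
      intro i
      simp only [litCount_cons, Lit.value, pow_add]
      by_cases h : i = ρ.idx
      · subst h
        cases ρ.alive <;> cases ρ.sel <;> cases ρ.sign <;> simp <;> ring
      · simp [h, Ne.symm h]
    rw [Finset.prod_congr rfl fun i _ => key i, Finset.prod_mul_distrib, Finset.prod_ite_eq',
      if_pos (hS ρ (by simp)), aliveProd_cons, ih fun ρ h => hS ρ (by simp [h])]

/-- For positive a and b put p = a/(a+b) and bound x/p and (1-x)/(1-p) by 1 + t ≤ exp t. The
exponents then sum to a(x/p - 1) + b((1-x)/(1-p) - 1) = 0, because a/p and b/(1-p) both equal a+b.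
The `max 1` only avoids a zero denominator when a = b = 0. -/
theorem pow_mul_pow_le (a b : ℕ) {x : ℝ} (h0 : 0 ≤ x) (h1 : x ≤ 1) :
    x ^ a * (1 - x) ^ b ≤
      ((a : ℝ) / (max 1 (a + b) : ℕ)) ^ a * (1 - (a : ℝ) / (max 1 (a + b) : ℕ)) ^ b := by
  have h1' : 0 ≤ 1 - x := by linarith
  rcases Nat.eq_zero_or_pos a with rfl | ha
  · simpa using pow_le_one₀ h1' (by linarith)
  rcases Nat.eq_zero_or_pos b with rfl | hb
  · have : (a : ℝ) ≠ 0 := by exact_mod_cast ha.ne'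
    simp [max_eq_right (show 1 ≤ a from ha), this]
    exact pow_le_one₀ h0 h1
  have ha' : (0 : ℝ) < a := by exact_mod_cast ha
  have hb' : (0 : ℝ) < b := by exact_mod_cast hb
  rw [max_eq_right (show 1 ≤ a + b by omega)]
  push_cast
  set p : ℝ := a / (a + b) with hp
  have hp0 : 0 < p := by positivity
  have hq : 1 - p = b / (a + b) := by rw [hp]; field_simp; ring
  have hq0 : 0 < 1 - p := by rw [hq]; positivity
  have key : (x / p) ^ a * ((1 - x) / (1 - p)) ^ b ≤ 1 := by
    have e₁ : x / p ≤ Real.exp (x / p - 1) := by linarith [Real.add_one_le_exp (x / p - 1)]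
    have e₂ : (1 - x) / (1 - p) ≤ Real.exp ((1 - x) / (1 - p) - 1) := by
      linarith [Real.add_one_le_exp ((1 - x) / (1 - p) - 1)]
    calc (x / p) ^ a * ((1 - x) / (1 - p)) ^ b
        ≤ Real.exp (x / p - 1) ^ a * Real.exp ((1 - x) / (1 - p) - 1) ^ b := by gcongr
      _ = Real.exp (a * (x / p - 1) + b * ((1 - x) / (1 - p) - 1)) := by
        rw [Real.exp_add, ← Real.exp_nat_mul, ← Real.exp_nat_mul]
      _ = 1 := by
        rw [Real.exp_eq_one_iff, hq, hp]
        field_simp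
        ring
  rwa [div_pow x, div_pow (1 - x), div_mul_div_comm, div_le_one (by positivity)] at key

/-- The best values for the selected literals in `L`. -/
noncomputable def bestAssignment (L : List Lit) : List (ℕ × ℕ × ℕ) :=
  (L.map Lit.idx).toFinset.toList.map fun i =>
    (i, litCount true i L, max 1 (litCount true i L + litCount false i L))

theorem map_fst_bestAssignment (L : List Lit) :
    (bestAssignment L).map Prod.fst = (L.map Lit.idx).toFinset.toList := by
  simp [bestAssignment, comp_def]

theorem bounds_bestAssignment (L : List Lit) :
    ∀ t ∈ bestAssignment L, 0 < t.2.2 ∧ t.2.1 ≤ t.2.2 := by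
  intro t ht
  obtain ⟨i, -, rfl⟩ := List.mem_map.mp ht
  simp only
  omega

/-- With c occurrences of a variable, numerator and denominator are at most c and need at most c
digits each. An entry then takes at most 3 + 2|i| + 4c ≤ c(7 + 2|i|) symbols, which explains the
constant 7 in `ruler`. -/
theorem length_bestAssignment (L : List Lit) :
    (encodeAssignment (bestAssignment L)).length ≤ ruler L := by
  have e₁ : (encodeAssignment (bestAssignment L)).length = ∑ i ∈ (L.map Lit.idx).toFinset,
      (encodeBin i ++ encodeBin (litCount true i L) ++
        encodeBin (max 1 (litCount true i L + litCount false i L))).length := by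
    rw [encodeAssignment, bestAssignment, List.length_flatMap, List.map_map, ← Finset.sum_map_toList]
    rfl
  have e₂ : ruler L = ∑ i ∈ (L.map Lit.idx).toFinset,
      (L.map Lit.idx).count i • (7 + 2 * (Computability.encodeNat i).length) := by
    rw [← Finset.sum_list_map_count, List.map_map]
    rfl
  rw [e₁, e₂]
  refine Finset.sum_le_sum fun i hi => ?_
  have hc : 1 ≤ (L.map Lit.idx).count i := List.count_pos_iff.mpr (List.mem_toFinset.mp hi)
  have h₁ := litCount_add_le i L
  have h₂ := length_encodeNat_le (litCount true i L)
  have h₃ := length_encodeNat_le (max 1 (litCount true i L + litCount false i L))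
  have h₄ := Nat.mul_le_mul_right (3 + 2 * (Computability.encodeNat i).length) hc
  simp only [encodeBin, List.length_append, length_encodeStr, smul_eq_mul]
  have : (L.map Lit.idx).count i * (7 + 2 * (Computability.encodeNat i).length) =
    (L.map Lit.idx).count i * (3 + 2 * (Computability.encodeNat i).length) +
      4 * (L.map Lit.idx).count i := by ring
  omega

theorem aliveProd_le_of_agrees {L : List Lit} {π : ℕ → Viterbi}
    (hπ : Agrees (realOf π) (bestAssignment L)) (π' : ℕ → Viterbi) :
    aliveProd (realOf π') L ≤ aliveProd (realOf π) L := by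
  have hS : ∀ ρ ∈ L, ρ.idx ∈ (L.map Lit.idx).toFinset := fun ρ hρ =>
    List.mem_toFinset.mpr (List.mem_map_of_mem hρ)
  rw [aliveProd_eq_prod _ L _ hS, aliveProd_eq_prod _ L _ hS]
  refine Finset.prod_le_prod (fun i _ => ?_) fun i hi => ?_
  · have h0 := (π' i).toReal_nonneg
    have h1 : 0 ≤ 1 - realOf π' i := by have := (π' i).toReal_le_one; unfold realOf; linarith
    exact mul_nonneg (pow_nonneg h0 _) (pow_nonneg h1 _)
  · have : realOf π i = _ :=
      hπ (i, litCount true i L, max 1 (litCount true i L + litCount false i L))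
        (List.mem_map.mpr ⟨i, Finset.mem_toList.mpr hi, rfl⟩)
    rw [this]
    exact pow_mul_pow_le _ _ (π' i).toReal_nonneg (π' i).toReal_le_one

theorem admissibleFor_bestAssignment (φ : NNF ℕ) (T : List Bool) :
    AdmissibleFor (bestAssignment (walk φ true (.init T)).lits) φ where
  nodup := by rw [map_fst_bestAssignment]; exact Finset.nodup_toList _
  vars_eq i := by
    rw [map_fst_bestAssignment, Finset.mem_toList, List.mem_toFinset, List.mem_map, mem_idx_walk]
    simp [Walk.init]
  bounds := bounds_bestAssignment _
  length_le := by
    refine (length_bestAssignment _).trans ?_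
    rw [ruler_walk]
    simp [Walk.init, ruler]

/-- Finitely many choice strings suffice. Optimise the monomial of each one, and keep the resulting
interpretation of largest confidence. Any π' has the confidence of some monomial under π'; passing
to the optimal values of that monomial does not decrease it, and the result is at most the
confidence of the corresponding candidate. -/
theorem exists_optimum (φ : NNF ℕ) : ∃ (a : List (ℕ × ℕ × ℕ)) (π : ℕ → Viterbi),
    AdmissibleFor a φ ∧ Agrees (realOf π) a ∧ ∀ π', conf φ π' ≤ conf φ π := by
  have h : ∀ T, ∃ π : ℕ → Viterbi,
      Agrees (realOf π) (bestAssignment (walk φ true (.init T)).lits) := fun T =>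
    exists_agrees_viterbi (admissibleFor_bestAssignment φ T).nodup (bounds_bestAssignment _)
  choose π hπ using h
  obtain ⟨T, -, hT⟩ := Set.exists_max_image {T : List Bool | T.length ≤ (encodeNNF φ).length}
    (fun T => conf φ (π T)) (List.finite_length_le Bool _) ⟨[], by simp⟩
  refine ⟨_, π T, admissibleFor_bestAssignment φ T, hπ T, fun π' => ?_⟩
  obtain ⟨T', τ, h₁, h₂, h₃⟩ := exists_walk_eq π' φ (.init [])
  have hτ : walk φ true (.init T') = { τ with choices := [] } := by
    have := h₂ []
    rwa [List.append_nil] at this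
  refine le_trans ?_ (hT T' h₁)
  rw [Viterbi.le_iff]
  have one : ∀ π T, (Walk.init T).value π = 1 := by simp [Walk.value, Walk.init, aliveProd]
  have hle := value_walk_le (π T') φ (.init T')
  rw [one, one_mul] at h₃
  rw [one, one_mul] at hle
  refine le_trans (le_of_eq h₃.symm) (le_trans ?_ hle)
  have : τ.value (realOf π') = (walk φ true (.init T')).value (realOf π') := by rw [hτ]; rfl
  rw [this]
  refine mul_le_mul_of_nonneg_left (aliveProd_le_of_agrees (hπ T') π') ?_
  cases (walk φ true (.init T')).ok <;> simp

/-! ### Denominators -/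

theorem exists_aliveProd_eq_div (π : ℕ → ℝ) (Q : ℕ) (hQ : 0 < Q) (L : List Lit)
    (h : ∀ ρ ∈ L, ∃ k d : ℕ, 0 < d ∧ d ≤ Q ∧ ρ.value π = k / d) :
    ∃ k d : ℕ, 0 < d ∧ d ≤ Q ^ L.length ∧ aliveProd π L = k / d := by
  induction L with
  | nil => exact ⟨1, 1, one_pos, by simp, by simp [aliveProd]⟩
  | cons ρ L ih =>
    obtain ⟨k, d, h1, h2, h3⟩ := ih fun ρ hρ => h ρ (by simp [hρ])
    obtain ⟨k', d', h4, h5, h6⟩ := h ρ (by simp)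
    rw [aliveProd_cons, h3]
    cases ρ.alive && ρ.sel
    · exact ⟨k, d, h1, h2.trans (Nat.pow_le_pow_right hQ (by simp)), by simp⟩
    · refine ⟨k' * k, d' * d, Nat.mul_pos h4 h1, ?_, ?_⟩
      · rw [List.length_cons, pow_succ']
        exact Nat.mul_le_mul h5 h2
      · rw [cond_true, h6]
        push_cast
        rw [div_mul_div_comm]

/-- The confidence equals the value of one monomial with m literals, and each literal has a
denominator of at most 2^n. -/
theorem exists_conf_eq_div {φ : NNF ℕ} {a : List (ℕ × ℕ × ℕ)} {π : ℕ → Viterbi}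
    (ha : AdmissibleFor a φ) (hπ : Agrees (realOf π) a) :
    ∃ k d m : ℕ, 0 < d ∧ d ≤ 2 ^ ((encodeNNF φ).length * m) ∧ 4 * m ≤ (encodeNNF φ).length ∧
      (conf φ π).toReal = k / d := by
  obtain ⟨T, τ, h₁, h₂, h₃⟩ := exists_walk_eq π φ (.init [])
  have hτ : walk φ true (.init T) = { τ with choices := [] } := by
    have := h₂ []
    rwa [List.append_nil] at this
  have hτ' : τ.lits = (walk φ true (.init T)).lits := by rw [hτ]
  have hm : 4 * τ.lits.length ≤ (encodeNNF φ).length := by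
    rw [hτ']
    simpa [Walk.init] using length_lits_walk φ true (.init T)
  have one : (Walk.init []).value (realOf π) = 1 := by simp [Walk.value, Walk.init, aliveProd]
  rw [one, one_mul] at h₃
  obtain ⟨k, d, h4, h5, h6⟩ := exists_aliveProd_eq_div (realOf π) (2 ^ (encodeNNF φ).length)
    (by positivity) τ.lits (by
      intro ρ hρ
      have hi : ρ.idx ∈ a.map Prod.fst := by
        rw [ha.vars_eq]
        have := (mem_idx_walk φ true (.init T) ρ.idx).mp ⟨ρ, hτ' ▸ hρ, rfl⟩
        simpa [Walk.init] using this
      obtain ⟨t, ht, hti⟩ := List.mem_map.mp hi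
      have hb := ha.bounds t ht
      -- The self-delimiting code doubles the number of digits, which cancels the factor 2 in
      -- `NNF.ruler_le` and leaves at most n digits.
      have hq : t.2.2 ≤ 2 ^ (encodeNNF φ).length := by
        have h1 := bval_lt (Computability.encodeNat t.2.2)
        rw [bval_encodeNat] at h1
        refine h1.le.trans (Nat.pow_le_pow_right two_pos ?_)
        have h2 : (encodeBin t.1 ++ encodeBin t.2.1 ++ encodeBin t.2.2).length ≤
            (encodeAssignment a).length := by
          unfold encodeAssignment
          rw [List.length_flatMap]
          exact List.single_le_sum (by simp) _ (List.mem_map_of_mem ht)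
        have h3 := ha.length_le.trans φ.ruler_le
        simp only [encodeBin, List.length_append, length_encodeStr] at h2
        omega
      have hv := hπ t ht
      rw [hti] at hv
      have hq0 : (t.2.2 : ℝ) ≠ 0 := by exact_mod_cast hb.1.ne'
      unfold Lit.value
      rw [hv]
      cases ρ.sign
      · refine ⟨t.2.2 - t.2.1, t.2.2, hb.1, hq, ?_⟩
        rw [Nat.cast_sub hb.2, cond_false]
        field_simp
      · exact ⟨t.2.1, t.2.2, hb.1, hq, rfl⟩)
  refine ⟨(bif τ.ok then 1 else 0) * k, d, τ.lits.length, h4, by rwa [pow_mul], hm, ?_⟩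
  rw [← h₃, Walk.value, h6]
  cases τ.ok <;> simp

theorem exists_bval_eq (N m : ℕ) (h : m < 2 ^ N) : ∃ B : List Bool, B.length = N ∧ bval B = m := by
  induction N generalizing m with
  | zero => exact ⟨[], rfl, by simp at h; simp [h]⟩
  | succ N ih =>
    obtain ⟨B, h1, h2⟩ := ih (m / 2) (by rw [pow_succ] at h; omega)
    refine ⟨decide (m % 2 = 1) :: B, by simp [h1], ?_⟩
    rw [bval_cons, h2]
    rcases Nat.mod_two_eq_zero_or_one m with h | h <;> simp [h] <;> omega

theorem three_le_length_encodeNNF (φ : NNF ℕ) : 3 ≤ (encodeNNF φ).length := by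
  induction φ <;> simp [encodeNNF] <;> omega

/-- An assignment that attains the largest binary fraction with `n²` digits is optimal, `n` being the
length of the encoding of the formula. -/
theorem isOptConf_of_maximal {φ : NNF ℕ} {B : List Bool} {a : List (ℕ × ℕ × ℕ)} {π : ℕ → Viterbi}
    (hB : B.length = (encodeNNF φ).length ^ 2) (ha : AdmissibleFor a φ) (hπ : Agrees (realOf π) a)
    (hle : (bval B : ℝ) ≤ 2 ^ B.length * (conf φ π).toReal)
    (hmax : ∀ B', B'.length = B.length → Attains φ B' [] → bval B' ≤ bval B) : IsOptConf φ π := by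
  obtain ⟨a', π', ha', hπ', hopt⟩ := exists_optimum φ
  set n := (encodeNNF φ).length with hn
  have hn3 : 3 ≤ n := three_le_length_encodeNNF φ
  obtain ⟨k₁, d₁, m₁, a1, a2, a3, a4⟩ := exists_conf_eq_div ha hπ
  obtain ⟨k₂, d₂, m₂, b1, b2, b3, b4⟩ := exists_conf_eq_div ha' hπ'
  rw [← hn] at a2 a3 b2 b3
  set v := (conf φ π).toReal with hv
  set v' := (conf φ π').toReal with hv'
  have hv'1 : v' ≤ 1 := Viterbi.toReal_le_one _
  have hv'0 : 0 ≤ v' := Viterbi.toReal_nonneg _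
  have hvv : v ≤ v' := (Viterbi.le_iff _ _).mp (hopt π)
  -- The exponent n(m₁ + m₂) is at most n²/2, as both 4 m₁ and 4 m₂ are at most n.
  have hD : d₁ * d₂ < 2 ^ B.length := by
    refine (Nat.mul_le_mul a2 b2).trans_lt ?_
    rw [← pow_add, hB]
    refine Nat.pow_lt_pow_right one_lt_two ?_
    rw [← mul_add, sq]
    exact Nat.mul_lt_mul_of_pos_left (by omega) (by omega)
  -- The optimum v' rounded down to n² digits is attained, hence at most 0.B. The minimum with
  -- 2^(n²) - 1 covers v' = 1, where the rounded value would need one more digit.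
  have hclose : 2 ^ B.length * v' - 1 ≤ 2 ^ B.length * v := by
    have hpow : (0 : ℝ) < 2 ^ B.length := by positivity
    have hfl := Nat.floor_le (show 0 ≤ 2 ^ B.length * v' by positivity)
    have hfl' := Nat.lt_floor_add_one (2 ^ B.length * v')
    have hpos : 0 < 2 ^ B.length := by positivity
    obtain ⟨B', c1, c2⟩ := exists_bval_eq B.length (min ⌊2 ^ B.length * v'⌋₊ (2 ^ B.length - 1))
      (by omega)
    have h1 := hmax B' c1 ⟨a', π', ha', List.nil_prefix, hπ', by
      rw [c1, c2]
      refine le_trans ?_ hfl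
      exact_mod_cast min_le_left _ _⟩
    rw [c2] at h1
    have h2 : ((min ⌊2 ^ B.length * v'⌋₊ (2 ^ B.length - 1) : ℕ) : ℝ) ≤ bval B := by
      exact_mod_cast h1
    refine le_trans ?_ (h2.trans hle)
    rcases min_choice ⌊2 ^ B.length * v'⌋₊ (2 ^ B.length - 1) with h | h
    · rw [h]
      linarith
    · rw [h, Nat.cast_sub hpos]
      push_cast
      nlinarith
  -- Distinct fractions with denominators d₁ and d₂ differ by at least 1/(d₁ d₂), which exceeds the
  -- remaining gap 2^(-n²).
  have heq : v' ≤ v := by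
    by_contra! hlt
    have h1 : (0 : ℝ) < d₁ := by exact_mod_cast a1
    have h2 : (0 : ℝ) < d₂ := by exact_mod_cast b1
    have h3 : (1 : ℝ) ≤ (v' - v) * (d₁ * d₂) := by
      have e : (v' - v) * (d₁ * d₂) = ((k₂ * d₁ : ℕ) : ℝ) - ((k₁ * d₂ : ℕ) : ℝ) := by
        rw [a4, b4]
        push_cast
        field_simp
      have : (0 : ℝ) < (v' - v) * (d₁ * d₂) := mul_pos (by linarith) (by positivity)
      rw [e] at this ⊢
      have h4 : k₁ * d₂ < k₂ * d₁ := by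
        rw [sub_pos] at this
        exact_mod_cast this
      have h5 : ((k₁ * d₂ : ℕ) : ℝ) + 1 ≤ ((k₂ * d₁ : ℕ) : ℝ) := by exact_mod_cast h4
      linarith
    have h4 : ((d₁ : ℝ) * d₂) < 2 ^ B.length := by exact_mod_cast hD
    have : (v' - v) * (d₁ * d₂) < (v' - v) * 2 ^ B.length :=
      mul_lt_mul_of_pos_left h4 (by linarith)
    nlinarith
  refine ⟨⟨π, rfl⟩, ?_⟩
  rintro _ ⟨π'', rfl⟩
  exact (hopt π'').trans ((Viterbi.le_iff _ _).mpr heq)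

/-! ### The registers of the oracle machine -/

/-- The stacks of the oracle machine. -/
inductive OReg
  | x | x1 | q | b | b1 | e | e1 | c1 | c2 | t | out
  deriving DecidableEq

instance : Fintype OReg :=
  ⟨⟨([.x, .x1, .q, .b, .b1, .e, .e1, .c1, .c2, .t, .out] : List OReg), by decide⟩, fun k => by cases k <;> decide⟩

/-- The contents of the stacks of the oracle machine. -/
structure OState where
  x : List Bool := []
  x1 : List Bool := []
  q : List Bool := []
  b : List Bool := []
  b1 : List Bool := []
  e : List Bool := []
  e1 : List Bool := []
  c1 : List Bool := []
  c2 : List Bool := []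
  t : List Bool := []
  out : List Bool := []

namespace OState

/-- The content of a stack. -/
def store (v : OState) : OReg → List Bool
  | .x => v.x
  | .x1 => v.x1
  | .q => v.q
  | .b => v.b
  | .b1 => v.b1
  | .e => v.e
  | .e1 => v.e1
  | .c1 => v.c1
  | .c2 => v.c2
  | .t => v.t
  | .out => v.out

/-- Replace the content of a stack. -/
def set (v : OState) (k : OReg) (l : List Bool) : OState :=
  match k with
  | .x => { v with x := l }
  | .x1 => { v with x1 := l }
  | .q => { v with q := l }
  | .b => { v with b := l }
  | .b1 => { v with b1 := l }
  | .e => { v with e := l }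
  | .e1 => { v with e1 := l }
  | .c1 => { v with c1 := l }
  | .c2 => { v with c2 := l }
  | .t => { v with t := l }
  | .out => { v with out := l }

theorem update_store (v : OState) (k : OReg) (l : List Bool) :
    update v.store k l = (v.set k l).store := by
  funext j
  by_cases h : j = k
  · subst h
    rw [update_self]
    cases j <;> rfl
  · rw [update_of_ne h]
    cases k <;> cases j <;> first | rfl | exact absurd rfl h

end OState

/-- Programs of the oracle machine. -/
abbrev OCmd : Type := Cmd OReg True

/-- `c` leads from `v` to `v'` with at most `t` iterations of loops. -/
def ORuns (A : Language Bool) (c : OCmd) (v v' : OState) (t : ℕ) : Prop :=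
  Cmd.Runs OReg.q (· ∈ A) c v.store v'.store t

namespace ORuns

variable {A : Language Bool}

theorem of_runs {c : OCmd} {v v' : OState} {s t t'}
    (h : Cmd.Runs OReg.q (· ∈ A) c v.store s t) (hs : v'.store = s) (ht : t ≤ t') :
    ORuns A c v v' t' := h.congr hs ht

theorem mono {c : OCmd} {v v' : OState} {t t'} (h : ORuns A c v v' t) (ht : t ≤ t') :
    ORuns A c v v' t' := Cmd.Runs.mono h ht

theorem skip (v : OState) : ORuns A .skip v v 0 := Cmd.Runs.skip _

theorem push (k : OReg) (b : Bool) (v : OState) :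
    ORuns A (.push k b) v (v.set k (b :: v.store k)) 0 :=
  of_runs (.push k b _) (by rw [OState.update_store]) le_rfl

theorem seq {c d : OCmd} {v v₁ v₂ : OState} {t₁ t₂} (h₁ : ORuns A c v v₁ t₁)
    (h₂ : ORuns A d v₁ v₂ t₂) : ORuns A (c.seq d) v v₂ (t₁ + t₂) := Cmd.Runs.seq h₁ h₂

theorem pop {k : OReg} {f : Option Bool → OCmd} {v v' : OState} {t}
    (h : ORuns A (f (v.store k).head?) (v.set k (v.store k).tail) v' t) :
    ORuns A (.pop k f) v v' t := by
  refine Cmd.Runs.pop ?_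
  rw [OState.update_store]
  exact h

theorem loop_nil {k : OReg} (brk) (f : Bool → OCmd) {v : OState} (hk : v.store k = []) :
    ORuns A (.loop k brk f) v v 0 := Cmd.Runs.loop_nil _ _ hk

theorem loop_step {k : OReg} {brk} {f : Bool → OCmd} {v v₁ v₂ : OState} {b l t₁ t₂}
    (hk : v.store k = b :: l) (hb : brk b = false) (h₁ : ORuns A (f b) (v.set k l) v₁ t₁)
    (h₂ : ORuns A (.loop k brk f) v₁ v₂ t₂) :
    ORuns A (.loop k brk f) v v₂ (t₁ + t₂ + 1) :=
  Cmd.Runs.loop_step hk hb (by rw [OState.update_store]; exact h₁) h₂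

open Classical in
theorem ask {f : Bool → OCmd} {v v' : OState} {t}
    (h : ORuns A (f (decide (v.q ∈ A))) { v with q := [] } v' t) :
    ORuns A (.ask trivial f) v v' t := by
  refine Cmd.Runs.ask ?_
  rw [OState.update_store]
  exact h

end ORuns

namespace Cmd

/-- Push `n ^ 2` elements onto each of the stacks `c1` and `c2`, where `n` is the length of the
input. -/
def initClocks : OCmd :=
  (move₂ .x .x1 .t).seq <|
  (loop .t (fun _ => false) fun _ => (pushLength .x1 .x .c1 true).seq (pushLength .x .x1 .c2 true)).seq
  (move .x1 .x)

/-- Write the code of the string on `b` onto the query stack. -/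
def emitLoop : OCmd :=
  loop .b (fun _ => false) fun g => (push .q true).seq <| (push .q g).seq (push .b1 g)

/-- Write the query. -/
def emit : OCmd :=
  (move₂ .x .q .x1).seq <| (move .x1 .x).seq <| emitLoop.seq <| (push .q false).seq <|
  (move .b1 .b).seq <| (move₂ .e .q .e1).seq (move .e1 .e)

/-- Append a digit to the confidence. -/
def stepDigit : OCmd :=
  (push .b true).seq <| emit.seq <| ask trivial fun r => bif r then skip else
    pop .b fun _ => push .b false

/-- Extend the encoding of the assignment. -/
def stepAssignment : OCmd :=
  (push .e true).seq <| emit.seq <| ask trivial fun r => bif r then skip else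
    pop .e fun _ => (push .e false).seq <| emit.seq <| ask trivial fun r => bif r then skip else
      pop .e fun _ => skip

/-- The program of the oracle machine. -/
def search : OCmd :=
  initClocks.seq <| (loop .c1 (fun _ => false) fun _ => stepDigit).seq <|
  (loop .c2 (fun _ => false) fun _ => stepAssignment).seq (move .e .out)

end Cmd

/-- The query about the digits `B` and the prefix `e.reverse`. -/
def query (x B e : List Bool) : List Bool := e.reverse ++ ((encodeStr B).reverse ++ x.reverse)

/-! ### Execution of the search program -/

section Search

variable (A : Language Bool)

theorem runs_emitLoop (v : OState) :
    ORuns A Cmd.emitLoop v { v with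
      b := []
      b1 := v.b.reverse ++ v.b1
      q := (v.b.flatMap fun b => [true, b]).reverse ++ v.q } v.b.length := by
  generalize hb : v.b = l
  induction l generalizing v with
  | nil =>
    cases v
    simp only at hb
    subst hb
    exact ORuns.loop_nil _ _ rfl
  | cons g l ih =>
    have h := ih { v with b := l, q := g :: true :: v.q, b1 := g :: v.b1 } rfl
    refine ORuns.mono (.of_runs (t' := 0 + l.length + 1) (ORuns.loop_step (k := .b) (b := g) (l := l) hb rfl
      ((ORuns.push _ _ _).seq ((ORuns.push _ _ _).seq (ORuns.push _ _ _))) h) ?_ le_rfl) (by simp)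
    simp

theorem runs_emit (x b e c1 c2 : List Bool) :
    ORuns A Cmd.emit { x := x, b := b, e := e, c1 := c1, c2 := c2 }
      { x := x, b := b, e := e, c1 := c1, c2 := c2, q := query x b e }
      (2 * x.length + 2 * b.length + 2 * e.length) := by
  have m₁ : ORuns A (Cmd.move₂ .x .q .x1) { x := x, b := b, e := e, c1 := c1, c2 := c2 }
      { x1 := x.reverse, b := b, e := e, c1 := c1, c2 := c2, q := x.reverse } x.length := by
    refine .of_runs (Cmd.Runs.move₂ (by decide) (by decide) (by decide) _) ?_ le_rfl
    simp only [OState.update_store]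
    simp [OState.set, OState.store]
  have m₂ : ORuns A (Cmd.move .x1 .x)
      { x1 := x.reverse, b := b, e := e, c1 := c1, c2 := c2, q := x.reverse }
      { x := x, b := b, e := e, c1 := c1, c2 := c2, q := x.reverse } x.length := by
    refine .of_runs (Cmd.Runs.move (by decide) _) ?_ (by simp [OState.store])
    simp only [OState.update_store]
    simp [OState.set, OState.store]
  have m₃ := runs_emitLoop A { x := x, b := b, e := e, c1 := c1, c2 := c2, q := x.reverse }
  have m₄ : ORuns A (.push .q false)
      { x := x, b1 := b.reverse ++ [], e := e, c1 := c1, c2 := c2,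
        q := (b.flatMap fun b => [true, b]).reverse ++ x.reverse }
      { x := x, b1 := b.reverse, e := e, c1 := c1, c2 := c2,
        q := (encodeStr b).reverse ++ x.reverse } 0 := by
    refine .of_runs (Cmd.Runs.push _ _ _) ?_ le_rfl
    simp only [OState.update_store]
    simp [OState.set, OState.store, encodeStr]
  have m₅ : ORuns A (Cmd.move .b1 .b)
      { x := x, b1 := b.reverse, e := e, c1 := c1, c2 := c2,
        q := (encodeStr b).reverse ++ x.reverse }
      { x := x, b := b, e := e, c1 := c1, c2 := c2, q := (encodeStr b).reverse ++ x.reverse }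
      b.length := by
    refine .of_runs (Cmd.Runs.move (by decide) _) ?_ (by simp [OState.store])
    simp only [OState.update_store]
    simp [OState.set, OState.store]
  have m₆ : ORuns A (Cmd.move₂ .e .q .e1)
      { x := x, b := b, e := e, c1 := c1, c2 := c2, q := (encodeStr b).reverse ++ x.reverse }
      { x := x, b := b, e1 := e.reverse, c1 := c1, c2 := c2, q := query x b e } e.length := by
    refine .of_runs (Cmd.Runs.move₂ (by decide) (by decide) (by decide) _) ?_ le_rfl
    simp only [OState.update_store]
    simp [OState.set, OState.store, query]
  have m₇ : ORuns A (Cmd.move .e1 .e)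
      { x := x, b := b, e1 := e.reverse, c1 := c1, c2 := c2, q := query x b e }
      { x := x, b := b, e := e, c1 := c1, c2 := c2, q := query x b e } e.length := by
    refine .of_runs (Cmd.Runs.move (by decide) _) ?_ (by simp [OState.store])
    simp only [OState.update_store]
    simp [OState.set, OState.store]
  exact (m₁.seq (m₂.seq (m₃.seq (m₄.seq (m₅.seq (m₆.seq m₇)))))).mono (by simp; omega)

open Classical in
/-- The next digit. -/
noncomputable def nextDigit (x B : List Bool) : List Bool :=
  decide (query x (true :: B) [] ∈ A) :: B

open Classical in
/-- The next prefix of an assignment, reversed. -/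
noncomputable def nextPrefix (x B e : List Bool) : List Bool :=
  if query x B (true :: e) ∈ A then true :: e
  else if query x B (false :: e) ∈ A then false :: e else e

theorem runs_stepDigit (x b c1 c2 : List Bool) :
    ORuns A Cmd.stepDigit { x := x, b := b, c1 := c1, c2 := c2 }
      { x := x, b := nextDigit A x b, c1 := c1, c2 := c2 } (2 * x.length + 2 * b.length + 2) := by
  refine ((ORuns.push _ _ _).seq ((runs_emit A x (true :: b) [] c1 c2).seq
    (ORuns.ask (t := 0) ?_))).mono (by simp; omega)
  unfold nextDigit
  simp only
  by_cases h : query x (true :: b) [] ∈ A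
  · simp only [h, decide_true, cond_true]
    exact .skip _
  · simp only [h, decide_false, cond_false]
    refine ORuns.pop ?_
    exact ORuns.push _ _ _

theorem runs_stepAssignment (x b e c2 : List Bool) :
    ORuns A Cmd.stepAssignment { x := x, b := b, e := e, c2 := c2 }
      { x := x, b := b, e := nextPrefix A x b e, c2 := c2 }
      (4 * x.length + 4 * b.length + 4 * e.length + 4) := by
  refine ((ORuns.push _ _ _).seq ((runs_emit A x b (true :: e) [] c2).seq
    (ORuns.ask (t := 2 * x.length + 2 * b.length + 2 * e.length + 2) ?_))).mono (by simp; omega)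
  unfold nextPrefix
  simp only
  by_cases h : query x b (true :: e) ∈ A
  · simp only [h, decide_true, cond_true, if_true]
    exact (ORuns.skip _).mono (Nat.zero_le _)
  · simp only [h, decide_false, cond_false, if_false]
    refine ORuns.pop ?_
    refine ((ORuns.push _ _ _).seq ((runs_emit A x b (false :: e) [] c2).seq
      (ORuns.ask (t := 0) ?_))).mono (by simp; omega)
    simp only
    by_cases h' : query x b (false :: e) ∈ A
    · simp only [h', decide_true, cond_true, if_true]
      exact .skip _
    · simp only [h', decide_false, cond_false, if_false]
      refine ORuns.pop ?_
      exact .skip _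

theorem length_nextDigit (x B : List Bool) : (nextDigit A x B).length = B.length + 1 := rfl

theorem length_nextPrefix_le (x B e : List Bool) : (nextPrefix A x B e).length ≤ e.length + 1 := by
  unfold nextPrefix
  split_ifs <;> simp

theorem runs_digits (x c2 : List Bool) (N : ℕ) (c1 b : List Bool) (h : c1.length + b.length ≤ N) :
    ORuns A (.loop .c1 (fun _ => false) fun _ => Cmd.stepDigit) { x := x, b := b, c1 := c1, c2 := c2 }
      { x := x, b := (nextDigit A x)^[c1.length] b, c2 := c2 }
      (c1.length * (2 * x.length + 2 * N + 3)) := by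
  induction c1 generalizing b with
  | nil => exact (ORuns.loop_nil _ _ rfl).mono (Nat.zero_le _)
  | cons g c1 ih =>
    simp only [List.length_cons] at h
    refine (ORuns.loop_step (k := .c1) (b := g) (l := c1) rfl rfl (runs_stepDigit A x b c1 c2)
      (ih (nextDigit A x b) (by rw [length_nextDigit]; omega))).mono ?_
    rw [List.length_cons, add_mul]
    omega

theorem runs_prefixes (x b : List Bool) (N : ℕ) (c2 e : List Bool) (h : c2.length + e.length ≤ N) :
    ORuns A (.loop .c2 (fun _ => false) fun _ => Cmd.stepAssignment) { x := x, b := b, e := e, c2 := c2 }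
      { x := x, b := b, e := (nextPrefix A x b)^[c2.length] e }
      (c2.length * (4 * x.length + 4 * b.length + 4 * N + 5)) := by
  induction c2 generalizing e with
  | nil => exact (ORuns.loop_nil _ _ rfl).mono (Nat.zero_le _)
  | cons g c2 ih =>
    simp only [List.length_cons] at h
    refine (ORuns.loop_step (k := .c2) (b := g) (l := c2) rfl rfl (runs_stepAssignment A x b e c2)
      (ih (nextPrefix A x b e) (by have := length_nextPrefix_le A x b e; omega))).mono ?_
    rw [List.length_cons, add_mul]
    omega

/-- One copy of the input is consumed symbol by symbol. In each round the other copy is shuttled to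
`x` and back, and each passage adds n elements to one of the two counters. -/
theorem runs_initClocks (x : List Bool) :
    ORuns A Cmd.initClocks { x := x }
      { x := x, c1 := List.replicate (x.length ^ 2) true, c2 := List.replicate (x.length ^ 2) true }
      (2 * x.length + x.length * (2 * x.length + 1)) := by
  have m₁ : ORuns A (Cmd.move₂ .x .x1 .t) { x := x } { x1 := x.reverse, t := x.reverse } x.length := by
    refine .of_runs (Cmd.Runs.move₂ (by decide) (by decide) (by decide) _) ?_ le_rfl
    simp only [OState.update_store]
    simp [OState.set, OState.store]
  have m₂ : ∀ (t c1 c2 : List Bool), ORuns A (.loop .t (fun _ => false) fun _ =>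
      (Cmd.pushLength .x1 .x .c1 true).seq (Cmd.pushLength .x .x1 .c2 true))
      { x1 := x.reverse, t := t, c1 := c1, c2 := c2 }
      { x1 := x.reverse, c1 := List.replicate (t.length * x.length) true ++ c1,
        c2 := List.replicate (t.length * x.length) true ++ c2 } (t.length * (2 * x.length + 1)) := by
    intro t
    induction t with
    | nil => intro c1 c2; simpa using ORuns.loop_nil _ _ rfl
    | cons g t ih =>
      intro c1 c2
      have p₁ : ORuns A (Cmd.pushLength .x1 .x .c1 true)
          { x1 := x.reverse, t := t, c1 := c1, c2 := c2 }
          { x := x, t := t, c1 := List.replicate x.length true ++ c1, c2 := c2 } x.length := by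
        refine .of_runs (Cmd.Runs.pushLength (by decide) (by decide) (by decide) _ _) ?_
          (by simp [OState.store])
        simp only [OState.update_store]
        simp [OState.set, OState.store]
      have p₂ : ORuns A (Cmd.pushLength .x .x1 .c2 true)
          { x := x, t := t, c1 := List.replicate x.length true ++ c1, c2 := c2 }
          { x1 := x.reverse, t := t, c1 := List.replicate x.length true ++ c1,
            c2 := List.replicate x.length true ++ c2 } x.length := by
        refine .of_runs (Cmd.Runs.pushLength (by decide) (by decide) (by decide) _ _) ?_ le_rfl
        simp only [OState.update_store]
        simp [OState.set, OState.store]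
      have e : ∀ c, List.replicate ((g :: t).length * x.length) true ++ c =
          List.replicate (t.length * x.length) true ++ (List.replicate x.length true ++ c) := by
        intro c
        rw [List.length_cons, add_mul, one_mul, List.replicate_add, List.append_assoc]
      rw [e, e]
      refine ORuns.mono (ORuns.loop_step (k := .t) (b := g) (l := t) rfl rfl (p₁.seq p₂) (ih _ _)) ?_
      rw [List.length_cons, add_mul]
      omega
  have m₃ : ∀ c1 c2 : List Bool, ORuns A (Cmd.move .x1 .x) { x1 := x.reverse, c1 := c1, c2 := c2 }
      { x := x, c1 := c1, c2 := c2 } x.length := by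
    intro c1 c2
    refine .of_runs (Cmd.Runs.move (by decide) _) ?_ (by simp [OState.store])
    simp only [OState.update_store]
    simp [OState.set, OState.store]
  have : ORuns A Cmd.initClocks _ _ _ := (m₁.seq ((m₂ x.reverse [] []).seq (m₃ _ _))).mono
    (t' := 2 * x.length + x.length * (2 * x.length + 1)) (by simp; omega)
  simpa only [List.length_reverse, List.append_nil, ← sq] using this

/-- The result of the search. -/
noncomputable def searchResult (x : List Bool) : List Bool :=
  ((nextPrefix A x ((nextDigit A x)^[x.length ^ 2] []))^[x.length ^ 2] []).reverse

theorem length_iterate_nextDigit (x B : List Bool) (k : ℕ) :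
    ((nextDigit A x)^[k] B).length = B.length + k := by
  induction k with
  | zero => rfl
  | succ k ih => rw [iterate_succ_apply', length_nextDigit, ih, Nat.add_assoc]

theorem length_iterate_nextPrefix_le (x B e : List Bool) (k : ℕ) :
    ((nextPrefix A x B)^[k] e).length ≤ e.length + k := by
  induction k with
  | zero => exact le_rfl
  | succ k ih =>
    rw [iterate_succ_apply']
    have := length_nextPrefix_le A x B ((nextPrefix A x B)^[k] e)
    omega

theorem inFPNP_searchResult {A : Language Bool} (hA : InNP A) : InFPNP (searchResult A) := by
  refine Cmd.inFPNP_of_runs hA Cmd.search .x .out .q _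
    (2 * .X + .X * (2 * .X + 1) + (.X ^ 2 * (2 * .X + 2 * .X ^ 2 + 3) +
      (.X ^ 2 * (4 * .X + 4 * .X ^ 2 + 4 * .X ^ 2 + 5) + .X ^ 2))) fun x => ?_
  set n := x.length with hn
  have h₂ := runs_digits A x (List.replicate (n ^ 2) true) (n ^ 2) (List.replicate (n ^ 2) true) []
    (by simp)
  set B := (nextDigit A x)^[(List.replicate (n ^ 2) true).length] [] with hB
  have hBl : B.length = n ^ 2 := by rw [hB, length_iterate_nextDigit]; simp
  have h₃ := runs_prefixes A x B (n ^ 2) (List.replicate (n ^ 2) true) [] (by simp)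
  set e := (nextPrefix A x B)^[(List.replicate (n ^ 2) true).length] [] with he
  have hel : e.length ≤ n ^ 2 := by
    rw [he]
    refine (length_iterate_nextPrefix_le A x B [] _).trans (by simp)
  have h₄ : ORuns A (Cmd.move .e .out) { x := x, b := B, e := e } { x := x, b := B, out := e.reverse }
      (n ^ 2) := by
    refine .of_runs (Cmd.Runs.move (by decide) _) ?_ hel
    simp only [OState.update_store]
    simp [OState.set, OState.store]
  have h := (runs_initClocks A x).seq (h₂.seq (h₃.seq h₄))
  refine ⟨OState.store { x := x, b := B, out := e.reverse }, ?_, ?_⟩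
  · change e.reverse = _
    rw [he, hB, List.length_replicate]
    rfl
  · have e : update (fun _ => []) OReg.x x = OState.store { x := x } := by
      funext k
      cases k <;> rfl
    rw [e]
    refine Cmd.Runs.congr h rfl ?_
    simp only [Polynomial.eval_add, Polynomial.eval_mul, Polynomial.eval_pow, Polynomial.eval_X,
      Polynomial.eval_ofNat, Polynomial.eval_one, List.length_replicate, hBl]
    exact le_rfl

end Search

/-! ### Correctness of the search -/

theorem query_reverse (x B e : List Bool) :
    (query x B e).reverse = x ++ (encodeStr B ++ e.reverse.reverse) := by
  simp [query]

theorem query_mem {φ : NNF ℕ} {B e : List Bool} :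
    query (encodeNNF φ) B e ∈ optConfOracle ↔ Attains φ B e.reverse :=
  mem_optConfOracle (query_reverse _ _ _)

/-- `B` is the largest attained binary fraction with its number of digits. -/
def IsMaxDigits (φ : NNF ℕ) (B : List Bool) : Prop :=
  Attains φ B [] ∧ ∀ B', B'.length = B.length → Attains φ B' [] → bval B' ≤ bval B

theorem isMaxDigits_nil (φ : NNF ℕ) : IsMaxDigits φ [] := by
  obtain ⟨a, π, ha, hπ, -⟩ := exists_optimum φ
  refine ⟨⟨a, π, ha, List.nil_prefix, hπ, ?_⟩, fun B' h _ => ?_⟩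
  · simpa using Viterbi.toReal_nonneg _
  · rw [List.length_eq_zero_iff.mp h]

/-- The head of B is its least significant digit, so dropping it rounds the fraction down. -/
theorem Attains.tail {φ : NNF ℕ} {c : Bool} {B E : List Bool} (h : Attains φ (c :: B) E) :
    Attains φ B E := by
  obtain ⟨a, π, h1, h2, h3, h4⟩ := h
  refine ⟨a, π, h1, h2, h3, ?_⟩
  rw [List.length_cons, bval_cons, pow_succ] at h4
  push_cast at h4
  have : (0 : ℝ) ≤ (c.toNat : ℝ) := Nat.cast_nonneg _
  linarith

theorem Attains.cons_false {φ : NNF ℕ} {B E : List Bool} (h : Attains φ B E) :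
    Attains φ (false :: B) E := by
  obtain ⟨a, π, h1, h2, h3, h4⟩ := h
  refine ⟨a, π, h1, h2, h3, ?_⟩
  rw [List.length_cons, bval_cons, pow_succ]
  push_cast
  simp
  linarith

theorem Attains.congr {φ : NNF ℕ} {B B' E : List Bool} (h : Attains φ B E)
    (hl : B'.length = B.length) (hv : bval B' = bval B) : Attains φ B' E := by
  obtain ⟨a, π, h1, h2, h3, h4⟩ := h
  exact ⟨a, π, h1, h2, h3, by rwa [hl, hv]⟩

-- Truncating an attained fraction leaves an attained one, which is at most B by maximality. So the
-- best fraction with one more digit continues B itself, and a single question decides whether by 1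
-- or by 0.
open Classical in
theorem IsMaxDigits.next {φ : NNF ℕ} {B : List Bool} (h : IsMaxDigits φ B) :
    IsMaxDigits φ (nextDigit optConfOracle (encodeNNF φ) B) := by
  obtain ⟨h1, h2⟩ := h
  unfold nextDigit
  by_cases hq : query (encodeNNF φ) (true :: B) [] ∈ optConfOracle
  · rw [decide_eq_true hq]
    rw [query_mem] at hq
    refine ⟨hq, fun B' hl hB' => ?_⟩
    rcases B' with _ | ⟨c, B'⟩
    · simp at hl
    · have := h2 B' (by simpa using hl) hB'.tail
      rw [bval_cons, bval_cons]
      have := Bool.toNat_le c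
      simp only [Bool.toNat_true]
      omega
  · rw [decide_eq_false hq]
    rw [query_mem] at hq
    refine ⟨h1.cons_false, fun B' hl hB' => ?_⟩
    rcases B' with _ | ⟨c, B'⟩
    · simp at hl
    · have h3 := h2 B' (by simpa using hl) hB'.tail
      rw [bval_cons, bval_cons]
      have := Bool.toNat_le c
      simp only [Bool.toNat_false]
      rcases h3.lt_or_eq with h4 | h4
      · omega
      · cases c
        · simp only [Bool.toNat_false]
          omega
        -- Here `B'` has the same value and length as B, so attaining `true :: B'` would mean
        -- attaining the fraction that the oracle has just refused.
        · exact absurd (hB'.congr (by simpa using hl.symm) (by simp [h4])) hq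

theorem isMaxDigits_iterate (φ : NNF ℕ) (k : ℕ) :
    IsMaxDigits φ ((nextDigit optConfOracle (encodeNNF φ))^[k] []) := by
  induction k with
  | zero => exact isMaxDigits_nil φ
  | succ k ih =>
    rw [iterate_succ_apply']
    exact ih.next

/-- Each round either lengthens the prefix by one bit or finds that no bit extends it; in the latter
case it remains stuck in all later rounds. -/
theorem attains_iterate_nextPrefix {φ : NNF ℕ} {B : List Bool} (h : Attains φ B []) (k : ℕ) :
    Attains φ B ((nextPrefix optConfOracle (encodeNNF φ) B)^[k] []).reverse ∧
      (((nextPrefix optConfOracle (encodeNNF φ) B)^[k] []).length = k ∨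
        ∀ c, ¬ Attains φ B (c :: (nextPrefix optConfOracle (encodeNNF φ) B)^[k] []).reverse) := by
  induction k with
  | zero => exact ⟨h, .inl rfl⟩
  | succ k ih =>
    rw [iterate_succ_apply']
    set e := (nextPrefix optConfOracle (encodeNNF φ) B)^[k] []
    obtain ⟨h1, h2⟩ := ih
    unfold nextPrefix
    split_ifs with h3 h4 <;> simp only [query_mem] at *
    · exact ⟨h3, .inl (by simpa using h2.resolve_right fun h => h true h3)⟩
    · exact ⟨h4, .inl (by simpa using h2.resolve_right fun h => h false h4)⟩
    · exact ⟨h1, .inr fun c => by cases c <;> assumption⟩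

theorem isOptConfOutput_searchResult (φ : NNF ℕ) :
    IsOptConfOutput φ (searchResult optConfOracle (encodeNNF φ)) := by
  set n := (encodeNNF φ).length with hn
  have hn3 : 3 ≤ n := three_le_length_encodeNNF φ
  set B := (nextDigit optConfOracle (encodeNNF φ))^[n ^ 2] [] with hB
  have hBl : B.length = n ^ 2 := by rw [hB, length_iterate_nextDigit]; simp
  obtain ⟨hB1, hB2⟩ : IsMaxDigits φ B := isMaxDigits_iterate φ _
  obtain ⟨h1, h2⟩ := attains_iterate_nextPrefix hB1 (n ^ 2)
  set e := (nextPrefix optConfOracle (encodeNNF φ) B)^[n ^ 2] [] with he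
  have hres : searchResult optConfOracle (encodeNNF φ) = e.reverse := rfl
  obtain ⟨a, π, ha, ⟨w, hw⟩, hπ, hle⟩ := h1
  -- A prefix of length n² is impossible: admissible encodings have length at most 2n, and n ≥ 3.
  have hmax : ∀ c, ¬ Attains φ B (c :: e).reverse := by
    refine h2.resolve_left fun h => ?_
    have l1 := ha.length_le.trans φ.ruler_le
    rw [← hw] at l1
    simp only [List.length_append, List.length_reverse, h, ← hn] at l1
    have : 3 * n ≤ n ^ 2 := by rw [sq]; exact Nat.mul_le_mul_right n hn3
    omega
  -- If the encoding of the witness were longer than the prefix, its next bit would be an attained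
  -- extension.
  have hw' : e.reverse = encodeAssignment a := by
    rcases w with _ | ⟨c, w⟩
    · rwa [List.append_nil] at hw
    · refine absurd ⟨a, π, ha, ⟨w, ?_⟩, hπ, hle⟩ (hmax c)
      rw [← hw]
      simp
  refine ⟨a, π, hres.trans hw', ⟨ha.nodup, ha.vars_eq, fun t ht => (ha.bounds t ht).1, hπ⟩, ?_⟩
  exact isOptConf_of_maximal hBl ha hπ hle hB2

theorem mainTheorem3 :
    ∃ f : List Bool → List Bool, InFPNP f ∧
      ∀ φ : NNF ℕ, IsOptConfOutput φ (f (encodeNNF φ)) :=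
  ⟨searchResult optConfOracle, inFPNP_searchResult inNP_optConfOracle,
    isOptConfOutput_searchResult⟩
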